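/- Let $X$ be an integral scheme with function field $K$. Vector bundles are locally free sheaves of finite rank; Cartier divisors are global sections of $K^\times/\mathcal O_X^\times$, written additively. For a subsheaf $N$ of the constant sheaf of rational sections of a bundle and a Cartier divisor $D$ with local equation $f$, $N(D)$ is locally $f^{-1}N$. Two effective Cartier divisors have *no component in common* if at each point their local equations $f,g$ satisfy: $fc\in g\mathcal O_x$ implies $c\in g\mathcal O_x$ (in the locally Noetherian case: they share no associated point, i.e. no component, embedded ones included). A *pre-echelon datum* of length $m$ consists of a descending chain $E=E^0\supset E^1\supset\dots\supset E^m$ of locally free sheaves of the same finite rank and Cartier divisors $\delta_0=0,\delta_1,\dots,\delta_m$ with every $d\delta_i:=\delta_i-\delta_{i-1}$ effective such that, for $1\le i\le m$, $E^i\supset E^{i-1}(-d\delta_i)$ and, for every $j<i$, $E^i/E^{i-1}(-d\delta_i)$ maps isomorphically onto a locally free, locally split $\mathcal O_{d\delta_i}$-submodule of $E^j\otimes\mathcal O_{d\delta_i}$. An *echelon datum* $\chi=(E^\cdot,\delta_\cdot,D_\cdot)$ has in addition Cartier divisors $D_0=0,D_1,\dots,D_m$ such that $dD_i:=D_i-D_{i-1}$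 and $d\delta_i-dD_i$ are effective and $D_i$ has no component in common with $\delta_i-D_i$. Its *echelon modification* is $\mathrm{Mod}(\chi,E)=E_m$, where, inside the sheaf of rational sections of $E$, $E_0=E$, $E_0^i=E^i$ and $$E_{j+1}=E_j^1(dD_{j+1})+E_j,\qquad E_{j+1}^i=E_j^{i+1}(d\delta_{j+1})\cap E_{j+1}\quad(i\ge1).$$ A *morphism* $(E,\chi)\to(F,\psi)$ of echelon data of length $m$ on $X$ is a map $u:E\to F$ with $u(E^i)\subset F^i$ for all $i\le m$, where the divisors $D_i$ of $\chi$ and $D_i'$ of $\psi$ satisfy $D_i\le D'_i$ for all $i\leq m$. **Theorem.** (i) For every echelon datum $\chi$ on $X$ of length $m$, with bundle $E$, $\mathrm{Mod}(\chi,E)$ is locally free of finite rank, contains $E$ and is generically equal to $E$. It is functorial: to each morphism $u:(E,\chi)\to(F,\psi)$ of echelon data there is assigned a map $\mathrm{Mod}(\chi,E)\to\mathrm{Mod}(\psi,F)$ extending $u$, compatibly with identities and composition. (ii) Let $f:Y\to X$ be a dominant morphism from an integral scheme such that $f^*D_i$ and $f^*(\delta_i-D_i)$ have no component in common for all $i\leq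 m$. Then $f^*\chi=(f^*E^\cdot,f^*\delta_\cdot,f^*D_\cdot)$ is an echelon datum on $Y$, and there is a unique isomorphism $f^*\mathrm{Mod}_X(\chi,E)\cong\mathrm{Mod}_Y(f^*\chi,f^*E)$ compatible with the maps from $f^*E$. (iii) Call a map $\phi:E\to L$ to a line bundle *adapted* to $\chi$ if $\phi(E^i)\subset L(-D_i)$ for all $i\leq m$. Every adapted $\phi$ extends, uniquely, to a map $\mathrm{Mod}(\chi,E)\to L$. Moreover $\mathrm{Mod}(\chi,E)$ is the largest bundle with this property, in the following sense: let $E'\supset E$ be a locally free sheaf of finite rank generically equal to $E$, and suppose that $X$ is covered by affine open subschemes $U$ such that every map $E|_U\to L$ to a line bundle on $U$ that is adapted to $\chi|_U$ extends to $E'|_U$. Then $E'$ is contained in $\mathrm{Mod}(\chi,E)$ (by a unique inclusion that is the identity on $E$). -/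

import Mathlib

open CategoryTheory AlgebraicGeometry TopologicalSpace

universe u

noncomputable section

namespace Echelon

section GenericStalk

variable {X : Scheme.{u}} [IsIntegral X]

theorem genericPoint_mem {U : X.Opens} {x : X} (hx : x ∈ U) : genericPoint X ∈ U :=
  ((genericPoint_spec X).mem_open_set_iff U.isOpen).mpr ⟨x, trivial, hx⟩

/-- The local ring of `X` at `x`, as a subring of the function field. -/
def localRing (x : X) : Subring X.functionField :=
  (algebraMap (X.presheaf.stalk x) X.functionField).range

/-- The image in the function field of a section of the structure sheaf near `x`. -/
def toFunctionField {U : X.Opens} {x : X} (hx : x ∈ U) : Γ(X, U) →+* X.functionField :=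
  (X.presheaf.germ U (genericPoint X) (genericPoint_mem hx)).hom

theorem toFunctionField_mem {U : X.Opens} {x : X} (hx : x ∈ U) (r : Γ(X, U)) :
    toFunctionField hx r ∈ localRing x := by
  have : Nonempty U := ⟨⟨x, hx⟩⟩
  exact ⟨X.presheaf.germ U x hx r, Scheme.algebraMap_germ_eq_germToFunctionField X hx r⟩

theorem toFunctionField_res {U V : X.Opens} {x : X} (hx : x ∈ U) (i : U ⟶ V) (r : Γ(X, V)) :
    toFunctionField hx (X.presheaf.map i.op r) = toFunctionField (leOfHom i hx) r :=
  X.presheaf.germ_res_apply i _ _ r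

/-- The stalk of `M` at the generic point of `X`: the fibre of the sheaf of rational sections. -/
def GenericStalk (M : X.Modules) : Type u :=
  ((M.presheaf.stalk (genericPoint X) : Ab.{u}) : Type u)

instance (M : X.Modules) : AddCommGroup (GenericStalk M) :=
  inferInstanceAs (AddCommGroup ((M.presheaf.stalk (genericPoint X) : Ab.{u}) : Type u))

/-- The generic stalk is a vector space over the function field. -/
instance (M : X.Modules) : Module X.functionField (GenericStalk M) :=
  let P : PresheafOfModules (X.presheaf ⋙ forget₂ CommRingCat RingCat) := M.val
  inferInstanceAs (Module (X.presheaf.stalk (genericPoint X))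
      ((TopCat.Presheaf.stalk P.presheaf (genericPoint X) : Ab.{u}) : Type u))

/-- The germ at the generic point of a section of `M` over an open set containing `x`. -/
def genGerm (M : X.Modules) {U : X.Opens} {x : X} (hx : x ∈ U) : Γ(M, U) →+ GenericStalk M :=
  (M.presheaf.germ U (genericPoint X) (genericPoint_mem hx)).hom

theorem genGerm_res (M : X.Modules) {U V : X.Opens} {x : X} (hx : x ∈ U) (i : U ⟶ V)
    (s : Γ(M, V)) :
    genGerm M hx (M.presheaf.map i.op s) = genGerm M (leOfHom i hx) s :=
  M.presheaf.germ_res_apply i _ _ s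

theorem genGerm_smul (M : X.Modules) {U : X.Opens} {x : X} (hx : x ∈ U) (r : Γ(X, U))
    (s : Γ(M, U)) :
    genGerm M hx (r • s) = toFunctionField hx r • genGerm M hx s := by
  let P : PresheafOfModules (X.presheaf ⋙ forget₂ CommRingCat RingCat) := M.val
  exact PresheafOfModules.germ_smul P (genericPoint X) U (genericPoint_mem hx) r s

/-- A subsheaf of the constant sheaf of rational sections of `M`, given by its stalks. -/
abbrev RatSubsheaf (M : X.Modules) : Type u :=
  ∀ x : X, Submodule (localRing x) (GenericStalk M)

/-- The image of a morphism `φ : F ⟶ M` in the sheaf of rational sections of `M`: its stalk at `x`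
consists of the germs `φ(s)` for sections `s` of `F` near `x`. -/
def image {F M : X.Modules} (φ : F ⟶ M) : RatSubsheaf M := fun x =>
  Submodule.span (localRing x)
    {v | ∃ (U : X.Opens) (hx : x ∈ U) (s : Γ(F, U)), v = genGerm M hx (φ.app U s)}

theorem genGerm_mem_image {F M : X.Modules} (φ : F ⟶ M) {U : X.Opens} {x : X} (hx : x ∈ U)
    (s : Γ(F, U)) : genGerm M hx (φ.app U s) ∈ image φ x :=
  Submodule.subset_span ⟨U, hx, s, rfl⟩

end GenericStalk

section Cartier

variable (X : Scheme.{u}) [IsIntegral X]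

/-- The subgroup of the nonzero rational functions that are units of the local ring at `x`. -/
def localUnits {X : Scheme.{u}} [IsIntegral X] (x : X) : Subgroup (X.functionField)ˣ where
  carrier := {f | (f : X.functionField) ∈ localRing x ∧
    ((f⁻¹ : (X.functionField)ˣ) : X.functionField) ∈ localRing x}
  mul_mem' {a b} ha hb := by
    refine ⟨?_, ?_⟩
    · rw [Units.val_mul]; exact mul_mem ha.1 hb.1
    · rw [mul_inv, Units.val_mul]; exact mul_mem ha.2 hb.2
  one_mem' := by simp [one_mem]
  inv_mem' {a} ha := ⟨ha.2, by simpa using ha.1⟩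

/-- Cartier divisors on an integral scheme: the group (written additively) of global sections of
the sheaf `K^×/𝒪^×`, where `K` is the constant sheaf of rational functions. -/
def CartierDivisor : AddSubgroup (∀ x : X, Additive ((X.functionField)ˣ ⧸ localUnits x)) where
  carrier := {D | ∀ x, ∃ U : X.Opens, x ∈ U ∧ ∃ f : (X.functionField)ˣ, ∀ y ∈ U,
    D y = Additive.ofMul (QuotientGroup.mk f)}
  add_mem' {D D'} hD hD' x := by
    obtain ⟨U, hU, f, hf⟩ := hD x
    obtain ⟨U', hU', f', hf'⟩ := hD' x
    refine ⟨U ⊓ U', ⟨hU, hU'⟩, f * f', fun y hy => ?_⟩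
    rw [Pi.add_apply, hf y hy.1, hf' y hy.2]; rfl
  zero_mem' x := ⟨⊤, trivial, 1, fun y _ => rfl⟩
  neg_mem' {D} hD x := by
    obtain ⟨U, hU, f, hf⟩ := hD x
    refine ⟨U, hU, f⁻¹, fun y hy => ?_⟩
    rw [Pi.neg_apply, hf y hy]; rfl

variable {X}

/-- `f` is an equation of `D` at `x`. -/
def IsEquation (D : CartierDivisor X) (x : X) (f : (X.functionField)ˣ) : Prop :=
  D.1 x = Additive.ofMul (QuotientGroup.mk f)

/-- A Cartier divisor is effective if its local equations are regular functions. -/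
def IsEffective (D : CartierDivisor X) : Prop :=
  ∀ (x : X) (f : (X.functionField)ˣ), IsEquation D x f → (f : X.functionField) ∈ localRing x

theorem exists_isEquation (D : CartierDivisor X) (x : X) : ∃ f, IsEquation D x f := by
  obtain ⟨U, hU, f, hf⟩ := D.2 x
  exact ⟨f, hf x hU⟩

theorem isEffective_zero : IsEffective (0 : CartierDivisor X) := fun x f hf => by
  have h : (QuotientGroup.mk f : (X.functionField)ˣ ⧸ localUnits x) = 1 :=
    Additive.ofMul.injective hf.symm
  exact ((QuotientGroup.eq_one_iff f).1 h).1

theorem IsEffective.add {D D' : CartierDivisor X} (h : IsEffective D) (h' : IsEffective D') :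
    IsEffective (D + D') := fun x f hf => by
  obtain ⟨g, hg⟩ := exists_isEquation D x
  have hg' : IsEquation D' x (g⁻¹ * f) := by
    have hf' : D.1 x + D'.1 x = Additive.ofMul (QuotientGroup.mk f) := hf
    rw [show D.1 x = _ from hg] at hf'
    have h1 : Additive.toMul (D'.1 x) =
        (QuotientGroup.mk g : (X.functionField)ˣ ⧸ localUnits x)⁻¹ * QuotientGroup.mk f :=
      eq_inv_mul_of_mul_eq (congrArg Additive.toMul hf')
    exact congrArg Additive.ofMul h1
  have := mul_mem (h x g hg) (h' x _ hg')
  rwa [← Units.val_mul, mul_inv_cancel_left] at this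

/-- Two effective divisors have no component in common, embedded components included: at every
point, the equation `f` of the first one is a nonzerodivisor modulo the equation `g` of the
second one, that is, `f c ∈ g 𝒪_x` implies `c ∈ g 𝒪_x`. On a locally Noetherian scheme this says
that no point is an associated point of both divisors; on a normal one, associated points are the
same as generic points of components. -/
def NoCommonComponent (D D' : CartierDivisor X) : Prop :=
  ∀ (x : X) (f g : (X.functionField)ˣ), IsEquation D x f → IsEquation D' x g →
    ∀ c ∈ localRing x, (f : X.functionField) * c * ((g⁻¹ : (X.functionField)ˣ) : X.functionField)
      ∈ localRing x → c * ((g⁻¹ : (X.functionField)ˣ) : X.functionField) ∈ localRing x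

/-- The twist `N(D)`: if `f` is an equation of `D` at `x`, its stalk at `x` is `f⁻¹ N_x`. -/
def twist {M : X.Modules} (D : CartierDivisor X) (N : RatSubsheaf M) : RatSubsheaf M := fun x =>
  { carrier := {s | ∀ f : (X.functionField)ˣ, IsEquation D x f → (f : X.functionField) • s ∈ N x}
    add_mem' := fun ha hb f hf => by rw [smul_add]; exact add_mem (ha f hf) (hb f hf)
    zero_mem' := fun f _ => by rw [smul_zero]; exact zero_mem _
    smul_mem' := fun c s hs f hf => by
      have h : (f : X.functionField) • (c • s) = c • ((f : X.functionField) • s) :=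
        smul_comm (f : X.functionField) (c : X.functionField) s
      rw [h]; exact (N x).smul_mem c (hs f hf) }

end Cartier

section Sheaf

variable {X : Scheme.{u}} [IsIntegral X] {M : X.Modules} (N : RatSubsheaf M)

/-- The sections of `N` over `U`: the locally constant functions on `U` with values in the generic
stalk whose value at each point `x` lies in the stalk of `N` at `x`. -/
def sections (U : X.Opens) : AddSubgroup (U → GenericStalk M) where
  carrier := {s | IsLocallyConstant s ∧ ∀ x : U, s x ∈ N x}
  add_mem' ha hb := ⟨ha.1.add hb.1, fun x => add_mem (ha.2 x) (hb.2 x)⟩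
  zero_mem' := ⟨IsLocallyConstant.const 0, fun _ => zero_mem _⟩
  neg_mem' ha := ⟨ha.1.neg, fun x => neg_mem (ha.2 x)⟩

instance (U : X.Opens) : Module Γ(X, U) (sections N U) where
  smul r s := ⟨fun x => toFunctionField x.2 r • s.1 x, by
    refine ⟨?_, fun x => (N x).smul_mem ⟨_, toFunctionField_mem x.2 r⟩ (s.2.2 x)⟩
    refine (IsLocallyConstant.iff_exists_open _).2 fun x => ?_
    obtain ⟨W, hW, hxW, h⟩ := (IsLocallyConstant.iff_exists_open _).1 s.2.1 x
    exact ⟨W, hW, hxW, fun y hy => by rw [h y hy]; rfl⟩⟩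
  one_smul s := Subtype.ext (funext fun x => by
    change toFunctionField x.2 1 • s.1 x = s.1 x
    rw [map_one, one_smul])
  mul_smul r r' s := Subtype.ext (funext fun x => by
    change toFunctionField x.2 (r * r') • s.1 x
      = toFunctionField x.2 r • toFunctionField x.2 r' • s.1 x
    rw [map_mul, mul_smul])
  smul_zero r := Subtype.ext (funext fun x => smul_zero (toFunctionField x.2 r))
  smul_add r s t := Subtype.ext (funext fun x => smul_add (toFunctionField x.2 r) (s.1 x) (t.1 x))
  add_smul r r' s := Subtype.ext (funext fun x => by
    change toFunctionField x.2 (r + r') • s.1 x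
      = toFunctionField x.2 r • s.1 x + toFunctionField x.2 r' • s.1 x
    rw [map_add, add_smul])
  zero_smul s := Subtype.ext (funext fun x => by
    change toFunctionField x.2 0 • s.1 x = 0
    rw [map_zero, zero_smul])

theorem sections_smul_apply {U : X.Opens} (r : Γ(X, U)) (s : sections N U) (x : U) :
    (r • s).1 x = toFunctionField x.2 r • s.1 x := rfl

/-- Restriction of sections. -/
def sectionsRes {U V : X.Opens} (i : U ≤ V) : sections N V →+ sections N U where
  toFun s := ⟨fun x => s.1 ⟨x.1, i x.2⟩,
    s.2.1.comp_continuous (continuous_inclusion i), fun x => s.2.2 ⟨x.1, i x.2⟩⟩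
  map_zero' := rfl
  map_add' _ _ := rfl

/-- The presheaf of abelian groups of sections of `N`. -/
def sectionsPresheaf : TopCat.Presheaf Ab.{u} X where
  obj U := AddCommGrpCat.of (sections N U.unop)
  map i := AddCommGrpCat.ofHom (sectionsRes N (leOfHom i.unop))
  map_id _ := rfl
  map_comp _ _ := rfl

/-- The local condition that defines the sections of `N`. -/
def sectionsPredicate : TopCat.LocalPredicate (X := (X : TopCat.{u})) (fun _ => GenericStalk M) where
  pred {U} s := s ∈ sections N U
  res {U V} i s hs := (sectionsRes N (leOfHom i) ⟨s, hs⟩).2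
  locality {U} s h := by
    refine ⟨(IsLocallyConstant.iff_exists_open _).2 fun x => ?_, fun x => ?_⟩
    · obtain ⟨V, hxV, i, hs⟩ := h x
      obtain ⟨W, hW, hxW, hc⟩ := (IsLocallyConstant.iff_exists_open _).1 hs.1 ⟨x.1, hxV⟩
      refine ⟨(↑) ⁻¹' (Subtype.val '' W), ?_, ⟨_, hxW, rfl⟩, ?_⟩
      · exact (V.2.isOpenEmbedding_subtypeVal.isOpenMap W hW).preimage continuous_subtype_val
      · rintro y ⟨z, hz, hzy⟩
        have hy : y = i z := Subtype.ext hzy.symm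
        have := hc z hz
        rw [hy]; exact this
    · obtain ⟨V, hxV, i, hs⟩ := h x
      exact hs.2 ⟨x.1, hxV⟩

theorem isSheaf_sectionsPresheaf : TopCat.Presheaf.IsSheaf (sectionsPresheaf N) :=
  (TopCat.Presheaf.isSheaf_iff_isSheaf_comp (forget AddCommGrpCat.{u}) _).2
    (TopCat.subsheafToTypes (sectionsPredicate N)).2

/-- The sheaf of modules of sections of `N`. -/
def toModules : X.Modules where
  val :=
    letI (U : (Opens X)ᵒᵖ) : Module (X.ringCatSheaf.obj.obj U) ((sectionsPresheaf N).obj U) :=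
      inferInstanceAs (Module Γ(X, U.unop) (sections N U.unop))
    PresheafOfModules.ofPresheaf (R := X.ringCatSheaf.obj) (sectionsPresheaf N) (by
      intro U V i r s
      refine Subtype.ext (funext fun x => ?_)
      exact congrArg (· • s.1 ⟨x.1, leOfHom i.unop x.2⟩)
        (toFunctionField_res x.2 i.unop r).symm)
  isSheaf := isSheaf_sectionsPresheaf N

/-- A section `s` of `F` over `U` gives the section of `N` with constant value the germ of `φ(s)`
at the generic point, if the image of `φ : F ⟶ M` is contained in `N`. -/
def liftApp {F : X.Modules} (φ : F ⟶ M) (h : image φ ≤ N) (U : X.Opens) :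
    Γ(F, U) →+ sections N U where
  toFun s := ⟨fun x => genGerm M x.2 (φ.app U s), (IsLocallyConstant.iff_exists_open _).2 fun x =>
      ⟨Set.univ, isOpen_univ, trivial, fun _ _ => rfl⟩,
    fun x => h x.1 (genGerm_mem_image φ x.2 s)⟩
  map_zero' := Subtype.ext (funext fun x => by
    change genGerm M x.2 (φ.app U 0) = 0
    rw [map_zero, map_zero])
  map_add' s t := Subtype.ext (funext fun x => by
    change genGerm M x.2 (φ.app U (s + t)) = genGerm M x.2 (φ.app U s) + genGerm M x.2 (φ.app U t)
    rw [map_add, map_add])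

/-- The morphism `F ⟶ N` induced by a morphism `φ : F ⟶ M` whose image is contained in `N`. -/
def lift {F : X.Modules} (φ : F ⟶ M) (h : image φ ≤ N) : F ⟶ toModules N :=
  SheafOfModules.Hom.mk (PresheafOfModules.homMk
    (M₁ := F.val) (M₂ := (toModules N).val)
    { app := fun U => AddCommGrpCat.ofHom (liftApp N φ h U.unop)
      naturality := fun U V i => by
        refine AddCommGrpCat.hom_ext (AddMonoidHom.ext fun s => Subtype.ext (funext fun x => ?_))
        change genGerm M x.2 (φ.app V.unop (F.presheaf.map i.unop.op s)) = _
        have h1 : φ.app V.unop (F.presheaf.map i.unop.op s)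
            = M.presheaf.map i.unop.op (φ.app U.unop s) :=
          ConcreteCategory.congr_hom (φ.mapPresheaf.naturality i) s
        rw [h1]
        exact genGerm_res M x.2 i.unop _ }
    (fun U r s => Subtype.ext (funext fun x => by
      exact (congrArg (genGerm M x.2) (φ.app_smul (U := U.unop) r s)).trans
        (genGerm_smul M x.2 r _))))

end Sheaf

section Pullback

variable {X Y : Scheme.{u}} [IsIntegral X] [IsIntegral Y] (f : Y ⟶ X) [IsDominant f]

theorem map_genericPoint : f (genericPoint Y) = genericPoint X := by
  refine ((genericPoint_spec X).eq ?_).symm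
  have h := (genericPoint_spec Y).image f.continuous
  rwa [Set.image_univ, f.denseRange.closure_range] at h

/-- The extension of function fields induced by a dominant morphism. -/
def functionFieldMap : X.functionField →+* Y.functionField :=
  (X.presheaf.stalkSpecializes (specializes_of_eq (map_genericPoint f)) ≫
    f.stalkMap (genericPoint Y)).hom

theorem functionFieldMap_mem {y : Y} {g : X.functionField} (hg : g ∈ localRing (f y)) :
    functionFieldMap f g ∈ localRing y := by
  obtain ⟨a, rfl⟩ := hg
  refine ⟨(f.stalkMap y).hom a, ?_⟩
  have h := ((genericPoint_spec Y).specializes trivial : genericPoint Y ⤳ y)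
  refine (Scheme.Hom.stalkSpecializes_stalkMap_apply f _ _ h a).symm.trans
    (congrArg (f.stalkMap (genericPoint Y)).hom ?_)
  change _ = (X.presheaf.stalkSpecializes _ ≫ X.presheaf.stalkSpecializes _).hom a
  rw [TopCat.Presheaf.stalkSpecializes_comp]

/-- The pullback of a Cartier divisor along a dominant morphism: pull back the local equations. -/
def pullbackDivisor (D : CartierDivisor X) : CartierDivisor Y :=
  ⟨fun y => Additive.ofMul (QuotientGroup.map (localUnits (f y)) (localUnits y)
      (Units.map (functionFieldMap f).toMonoidHom)
      (fun _ hg => ⟨functionFieldMap_mem f hg.1, by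
        rw [← map_inv]; exact functionFieldMap_mem f hg.2⟩) (Additive.toMul (D.1 (f y)))), by
    intro y
    obtain ⟨U, hU, g, hg⟩ := D.2 (f y)
    refine ⟨f ⁻¹ᵁ U, hU, Units.map (functionFieldMap f).toMonoidHom g, fun z hz => ?_⟩
    dsimp only
    rw [hg (f z) hz]
    rfl⟩

end Pullback

/-- A sheaf of modules is locally free of rank `r` if it is locally isomorphic to `𝒪^r`. -/
def IsLocallyFreeOfRank {X : Scheme.{u}} (M : X.Modules) (r : ℕ) : Prop :=
  ∀ x : X, ∃ U : X.Opens, x ∈ U ∧ Nonempty (M.restrict U.ι ≅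
    (SheafOfModules.free (R := (U : Scheme.{u}).ringCatSheaf) (ULift.{u} (Fin r)) :
      (U : Scheme.{u}).Modules))

/-- `M` is locally free of finite (constant) rank. -/
def IsVectorBundle {X : Scheme.{u}} (M : X.Modules) : Prop := ∃ r, IsLocallyFreeOfRank M r

/-- `φ` exhibits `M` as a subsheaf of `N` generically equal to `N`: it is injective, and an
isomorphism over some nonempty open set. -/
structure IsGenericEquality {X : Scheme.{u}} {M N : X.Modules} (φ : M ⟶ N) : Prop where
  mono : Mono φ
  generic : ∃ U : X.Opens, (U : Set X).Nonempty ∧ IsIso ((Scheme.Modules.restrictFunctor U.ι).map φ)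

/-- A bundle `E = bundle` with subsheaves `E^i = fil i` and Cartier divisors `δ_i`, `D_i`, where
only the indices `i ≤ m` are relevant, before any condition is imposed. -/
structure RawDatum (X : Scheme.{u}) [IsIntegral X] (m : ℕ) where
  bundle : X.Modules
  fil : ℕ → X.Modules
  incl : ∀ i, fil i ⟶ bundle
  δ : ℕ → CartierDivisor X
  D : ℕ → CartierDivisor X

namespace RawDatum

variable {X : Scheme.{u}} [IsIntegral X] {m : ℕ} (χ : RawDatum X m)

/-- `E^i` as a subsheaf of the sheaf of rational sections of `E`. -/
abbrev sub (i : ℕ) : RatSubsheaf χ.bundle := image (χ.incl i)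

/-- `dδ_{i+1} = δ_{i+1} - δ_i`. -/
abbrev dδ (i : ℕ) : CartierDivisor X := χ.δ (i + 1) - χ.δ i

/-- `dD_{i+1} = D_{i+1} - D_i`. -/
abbrev dD (i : ℕ) : CartierDivisor X := χ.D (i + 1) - χ.D i

/-- The conditions on a pre-echelon datum of length `m`. -/
structure IsPreEchelon : Prop where
  /-- `E = E^0` -/
  isIso_zero : IsIso (χ.incl 0)
  /-- the `E^i` are subsheaves of `E` -/
  mono : ∀ i ≤ m, Mono (χ.incl i)
  /-- they form a descending chain -/
  chain : ∀ i < m, ∃ j : χ.fil (i + 1) ⟶ χ.fil i, j ≫ χ.incl i = χ.incl (i + 1)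
  /-- they are locally free of the same rank -/
  locallyFree : ∃ r, ∀ i ≤ m, IsLocallyFreeOfRank (χ.fil i) r
  δ_zero : χ.δ 0 = 0
  dδ_effective : ∀ i < m, IsEffective (χ.dδ i)
  /-- persistence: `E^{i+1}` contains `E^i(-dδ_{i+1})`, -/
  twist_le : ∀ i < m, twist (-χ.dδ i) (χ.sub i) ≤ χ.sub (i + 1)
  /-- persistence: for `j ≤ i`, the quotient `E^{i+1} / E^i(-dδ_{i+1})` maps injectively to
  `E^j ⊗ 𝒪_{dδ_{i+1}} = E^j / E^j(-dδ_{i+1})`, -/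
  injective : ∀ i < m, ∀ j ≤ i,
    χ.sub (i + 1) ⊓ twist (-χ.dδ i) (χ.sub j) = twist (-χ.dδ i) (χ.sub i)
  /-- persistence: and its image is locally a direct summand (hence locally free). -/
  split : ∀ i < m, ∀ j ≤ i, ∀ x : X, IsComplemented
    (((χ.sub (i + 1) x).submoduleOf (χ.sub j x)).map
      ((twist (-χ.dδ i) (χ.sub j) x).submoduleOf (χ.sub j x)).mkQ)

/-- The conditions on an echelon datum of length `m`. With `x_i`, `y_i` equations of
`dδ_i - dD_i` and `dD_i`, the product `t_i = x_i y_i` is an equation of `dδ_i`. -/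
structure IsEchelon : Prop extends χ.IsPreEchelon where
  D_zero : χ.D 0 = 0
  /-- `dD_{i+1}` is effective and contained in `dδ_{i+1}` -/
  dD_effective : ∀ i < m, IsEffective (χ.dD i)
  dD_le : ∀ i < m, IsEffective (χ.dδ i - χ.dD i)
  /-- `D_i` has no component in common with `δ_i - D_i` -/
  noCommonComponent : ∀ i ≤ m, NoCommonComponent (χ.D i) (χ.δ i - χ.D i)

/-- The subsheaves `E_j^i`, with `E_j^0 = E_j`. They are given by `E_0 = E`, `E_0^i = E^i`,
`E_{j+1} = E_j^1(dD_{j+1}) + E_j` and `E_{j+1}^i = E_j^{i+1}(dδ_{j+1}) ∩ E_{j+1}` for `i ≥ 1`. -/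
def chain : ℕ → ℕ → RatSubsheaf χ.bundle
  | 0, 0 => image (𝟙 χ.bundle)
  | 0, i + 1 => χ.sub (i + 1)
  | j + 1, 0 => twist (χ.dD j) (chain j 1) ⊔ chain j 0
  | j + 1, i + 1 => twist (χ.dδ j) (chain j (i + 2)) ⊓
      (twist (χ.dD j) (chain j 1) ⊔ chain j 0)

theorem image_id_le_chain (j : ℕ) : image (𝟙 χ.bundle) ≤ χ.chain j 0 := by
  induction j with
  | zero => exact le_rfl
  | succ j ih => exact ih.trans le_sup_right

/-- The echelon modification `Mod(χ, E) = E_m`. -/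
def modification : X.Modules := toModules (χ.chain m 0)

/-- The inclusion `E ⟶ Mod(χ, E)`. -/
def toModification : χ.bundle ⟶ χ.modification :=
  lift (χ.chain m 0) (𝟙 χ.bundle) (χ.image_id_le_chain m)

/-- The pullback of the sheaves and divisors along a dominant morphism. -/
def pullback {Y : Scheme.{u}} [IsIntegral Y] (f : Y ⟶ X) [IsDominant f] : RawDatum Y m where
  bundle := (Scheme.Modules.pullback f).obj χ.bundle
  fil i := (Scheme.Modules.pullback f).obj (χ.fil i)
  incl i := (Scheme.Modules.pullback f).map (χ.incl i)
  δ i := pullbackDivisor f (χ.δ i)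
  D i := pullbackDivisor f (χ.D i)

/-- `φ : E ⟶ L` satisfies `φ(E^i) ⊆ L(-D_i)` for all `i ≤ m`. -/
def IsAdapted {L : X.Modules} (φ : χ.bundle ⟶ L) : Prop :=
  ∀ i ≤ m, image (χ.incl i ≫ φ) ≤ twist (-χ.D i) (image (𝟙 L))

/-- Given a map `j : E ⟶ E'` of sheaves on `X` and a dominant `g : U ⟶ X` (an open immersion, say),
every map `φ : g^*E ⟶ L` to a line bundle with `φ(g^*E^i) ⊆ L(-g^*D_i)` for all `i` extends to
`g^*E'`. -/
def AdaptedMapsExtend {E' : X.Modules} (j : χ.bundle ⟶ E') {U : Scheme.{u}} [IsIntegral U]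
    (g : U ⟶ X) [IsDominant g] : Prop :=
  ∀ (L : U.Modules), IsLocallyFreeOfRank L 1 → ∀ φ : (χ.pullback g).bundle ⟶ L,
    (χ.pullback g).IsAdapted φ →
      ∃ ψ : (Scheme.Modules.pullback g).obj E' ⟶ L, (Scheme.Modules.pullback g).map j ≫ ψ = φ

end RawDatum

/-- Echelon data of length `m` on `X`. -/
structure EchelonDatum (X : Scheme.{u}) [IsIntegral X] (m : ℕ) extends RawDatum X m where
  isEchelon : toRawDatum.IsEchelon

namespace EchelonDatum

variable {X : Scheme.{u}} [IsIntegral X] {m : ℕ}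

/-- A morphism of echelon data of length `m`: a map of bundles that respects the filtrations,
from a datum with divisors `D_i` to one with divisors `D'_i ≥ D_i`. -/
@[ext]
structure Hom (χ ψ : EchelonDatum X m) where
  hom : χ.bundle ⟶ ψ.bundle
  fil : ∀ i ≤ m, ∃ v : χ.fil i ⟶ ψ.fil i, v ≫ ψ.incl i = χ.incl i ≫ hom
  D_le : ∀ i ≤ m, IsEffective (ψ.D i - χ.D i)

instance : Category (EchelonDatum X m) where
  Hom := Hom
  id χ := ⟨𝟙 _, fun i _ => ⟨𝟙 _, by simp⟩, fun i _ => by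
    rw [sub_self]; exact isEffective_zero⟩
  comp u v := ⟨u.hom ≫ v.hom, fun i hi => by
      obtain ⟨a, ha⟩ := u.fil i hi
      obtain ⟨b, hb⟩ := v.fil i hi
      exact ⟨a ≫ b, by rw [Category.assoc, hb, ← Category.assoc, ha, Category.assoc]⟩,
    fun i hi => by
      rw [← sub_add_sub_cancel]; exact (v.D_le i hi).add (u.D_le i hi)⟩

end EchelonDatum

end Echelon

end

open Echelon

/-! Everything is computed at stalks inside the generic fibre `V` of `E`, a finite-dimensional
vector space over the function field `K`. There the stalk of each `E^i` becomes a free lattice over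
the local ring `R`.

The heart is local (`exists_isAdaptedBasis`): `V` has a basis `e_a` with levels `n(a) ≤ m` such that
`E^i = ⊕ (δ_i / δ_{min(n(a), i)}) R e_a` for all `i ≤ m` at once. So `e_a` stays a generator of
`E^i` up to `i = n(a)`, and from then on it is multiplied by the equation of `dδ` at every step. To
find such a basis, reduce modulo the maximal ideal: the images of the `E^i` form a flag, and a basis
adapted to the flag is lifted so that each vector lies in the `E^i` of its level. Nakayama's lemma
applied to `E^0`, and then to the split submodule that `E^{i+1}` defines in `E^0 / E^0(-dδ_{i+1})`,
shows that the lifts generate; persistence controls the error.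

In an adapted basis the recursion is diagonal: `E_j = ⊕ D_{min(n(a), j)}⁻¹ R e_a`
(`IsAdaptedBasis.chain_eq_diag`). For a vector of level at most `j`, the coordinates of
`E_j^1(dD_{j+1})` satisfy two bounds: one from `E_j^1 ⊆ E_j`, the other from `E_j^1 ⊆ E^{j+1}(δ_j)`.
The first leaves a pole along `D_{j+1}`, the second a pole along `δ_{j+1} - D_{j+1}`, and since
these divisors have no common component there is no pole at all. Hence `Mod = ⊕ D_{n(a)}⁻¹ R e_a`,
which also equals `∑ E^i(D_i)`, a description that involves neither a basis nor the recursion.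

Since finitely generated lattices that agree at a point agree nearby, one basis serves a
neighbourhood, and `Mod` is locally free. A map respecting the filtrations, with `D_i ≤ D'_i`,
carries `E^i(D_i)` into `F^i(D'_i)`, which gives functoriality; in the same way an adapted map sends
each `E^i(D_i)` into `L`, hence extends. Adapted bases pull back along dominant morphisms
(`IsModelAt.pullback`) and conversely imply the persistence conditions, so echelon data and their
modifications commute with pullback although no flatness is available. For maximality, the functions
`D_{n(a)} e_a^*` are adapted maps to the structure sheaf near the given point. On an affine scheme
they become globally adapted after multiplication by a power of a function invertible at that point;
their extensions to `E'` bound the coordinates of `E'` by those of `Mod`.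

The sheaf theory reduces to lattices: a torsion-free sheaf is determined by its stalks in the
generic fibre, and the stalks of `f^*M` there are spanned by pullbacks of stalks of `M`
(`lattice_pullback`). -/

namespace Echelon

noncomputable section

/-! ### Diagonal lattices in a vector space -/

section Lattice

variable {K V : Type*} [Field K] [AddCommGroup V] [Module K V] (R : Subring K)

/-- The submodule `u⁻¹ N`. -/
def scale {R : Subring K} (u : Kˣ) (N : Submodule R V) : Submodule R V where
  carrier := {v | (u : K) • v ∈ N}
  add_mem' ha hb := by
    rw [Set.mem_ofPred_eq, smul_add]; exact add_mem ha hb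
  zero_mem' := by rw [Set.mem_ofPred_eq, smul_zero]; exact zero_mem _
  smul_mem' c v hv := by
    have h : (u : K) • (c • v) = c • ((u : K) • v) := smul_comm (u : K) (c : K) v
    rw [Set.mem_ofPred_eq, h]; exact N.smul_mem c hv

theorem mem_scale {R : Subring K} {u : Kˣ} {N : Submodule R V} {v : V} :
    v ∈ scale u N ↔ (u : K) • v ∈ N := Iff.rfl

theorem scale_mono {R : Subring K} (u : Kˣ) {N N' : Submodule R V} (h : N ≤ N') :
    scale u N ≤ scale u N' := fun _ hv => h hv

variable {ι : Type*}

/-- The `R`-submodule of `V` spanned by the multiples `c a • e a` of the vectors of a basis. -/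
def diag (e : Module.Basis ι K V) (c : ι → Kˣ) : Submodule R V :=
  Submodule.span R (Set.range fun a => (c a : K) • e a)

variable {R}

theorem smul_mem_of_mem {N : Submodule R V} {r : K} (hr : r ∈ R) {v : V} (hv : v ∈ N) :
    r • v ∈ N := N.smul_mem ⟨r, hr⟩ hv

/-- Reduces all later comparisons of lattices to divisibility in one coordinate at a time. -/
theorem mem_diag_iff [Fintype ι] {e : Module.Basis ι K V} {c : ι → Kˣ} {v : V} :
    v ∈ diag R e c ↔ ∀ a, ((c a)⁻¹ : Kˣ) * e.repr v a ∈ R := by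
  classical
  constructor
  · intro hv a
    induction hv using Submodule.span_induction with
    | mem x hx =>
      obtain ⟨b, rfl⟩ := hx
      rw [map_smul, Finsupp.smul_apply, e.repr_self, Finsupp.single_apply]
      split_ifs with h
      · subst h; simp [one_mem]
      · simp [zero_mem]
    | zero => simp [zero_mem]
    | add x y _ _ hx hy =>
      rw [map_add, Finsupp.add_apply, mul_add]; exact add_mem hx hy
    | smul r x _ hx =>
      have : e.repr (r • x) a = (r : K) * e.repr x a := by
        rw [show r • x = (r : K) • x from rfl, map_smul]; rfl
      rw [this, mul_left_comm]; exact mul_mem r.2 hx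
  · intro h
    rw [← e.sum_repr v]
    refine Submodule.sum_mem _ fun a _ => ?_
    have : e.repr v a • e a = (((c a)⁻¹ : Kˣ) * e.repr v a : K) • ((c a : K) • e a) := by
      rw [smul_smul, mul_right_comm, Units.inv_mul, one_mul]
    rw [this]
    exact smul_mem_of_mem (h a) (Submodule.subset_span ⟨a, rfl⟩)

theorem smul_mem_diag {e : Module.Basis ι K V} {c : ι → Kˣ} (a : ι) {r : K}
    (hr : ((c a)⁻¹ : Kˣ) * r ∈ R) : r • e a ∈ diag R e c := by
  have : r • e a = (((c a)⁻¹ : Kˣ) * r : K) • ((c a : K) • e a) := by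
    rw [smul_smul, mul_right_comm, Units.inv_mul, one_mul]
  rw [this]
  exact smul_mem_of_mem hr (Submodule.subset_span ⟨a, rfl⟩)

theorem diag_le {e : Module.Basis ι K V} {c : ι → Kˣ} {N : Submodule R V}
    (h : ∀ a, (c a : K) • e a ∈ N) : diag R e c ≤ N := by
  refine Submodule.span_le.2 ?_
  rintro _ ⟨a, rfl⟩
  exact h a

end Lattice

/-! ### Bases adapted to a flag of subspaces -/

section Flag

variable {k W : Type*} [Field k] [AddCommGroup W] [Module k W]

/-- A flag of subspaces admits an adapted basis. -/
theorem exists_linearIndepOn_flag (m : ℕ) (A : ℕ → Submodule k W) (hA : Antitone A) :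
    ∃ B : Set W, B ⊆ A 0 ∧ LinearIndepOn k id B ∧
      ∀ i ≤ m, A i ≤ Submodule.span k (B ∩ A i) := by
  induction m generalizing A with
  | zero =>
    have h0 : LinearIndepOn k (id : W → W) ∅ := linearIndepOn_empty k _
    refine ⟨h0.extend (Set.empty_subset (A 0 : Set W)), h0.extend_subset _,
      h0.linearIndepOn_extend _, fun i hi => ?_⟩
    obtain rfl : i = 0 := by omega
    rw [Set.inter_eq_left.2 (h0.extend_subset _)]
    intro w hw
    simpa using h0.subset_span_extend (Set.empty_subset (A 0 : Set W)) hw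
  | succ m ih =>
    -- Build from the small end of the flag: a set adapted to the shifted flag is enlarged to a
    -- basis of `A 0`, which keeps the spanning property of the smaller terms.
    obtain ⟨B', hB0, hB1, hB2⟩ := ih (fun i => A (i + 1)) (fun i j h => hA (by omega))
    have hsub : B' ⊆ (A 0 : Set W) := hB0.trans (hA (by omega))
    refine ⟨hB1.extend hsub, hB1.extend_subset _, hB1.linearIndepOn_extend _, fun i hi => ?_⟩
    rcases i with _ | i
    · rw [Set.inter_eq_left.2 (hB1.extend_subset _)]
      intro w hw
      simpa using hB1.subset_span_extend hsub hw
    · exact (hB2 i (by omega)).trans (Submodule.span_mono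
        (Set.inter_subset_inter_left _ (hB1.subset_extend hsub)))

end Flag

/-! ### Existence of adapted bases over a local ring -/

section Adapted

variable {K V : Type*} [Field K] [AddCommGroup V] [Module K V] {R : Subring K}

/-- A basis adapted to a chain of submodules: the `i`-th one is spanned by the multiples
`δ_i / δ_{min(n(a), i)} • e_a`. -/
structure IsAdaptedBasis (R : Subring K) (E : ℕ → Submodule R V) (δ : ℕ → Kˣ) (m : ℕ) {ι : Type*}
    (e : Module.Basis ι K V) (n : ι → ℕ) : Prop where
  le : ∀ a, n a ≤ m
  eq_diag : ∀ i ≤ m, E i = diag R e fun a => δ i / δ (min (n a) i)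

theorem IsAdaptedBasis.reindex {E : ℕ → Submodule R V} {δ : ℕ → Kˣ} {m : ℕ} {ι κ : Type*}
    {e : Module.Basis ι K V} {n : ι → ℕ} (h : IsAdaptedBasis R E δ m e n) (σ : ι ≃ κ) :
    IsAdaptedBasis R E δ m (e.reindex σ) (n ∘ σ.symm) where
  le a := h.le _
  eq_diag i hi := by
    rw [h.eq_diag i hi, diag, diag, ← σ.symm.surjective.range_comp]
    simp [Function.comp_def]

theorem div_mem_of_le {δ : ℕ → Kˣ} {m : ℕ} (hδ : ∀ i < m, ((δ (i + 1) / δ i : Kˣ) : K) ∈ R)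
    {i j : ℕ} (hij : i ≤ j) (hj : j ≤ m) : ((δ j / δ i : Kˣ) : K) ∈ R := by
  induction j, hij using Nat.le_induction with
  | base => rw [div_self']; exact one_mem R
  | succ j hij ih =>
    rw [← div_mul_div_cancel (δ (j + 1)) (δ j) (δ i), Units.val_mul]
    exact mul_mem (hδ j (by omega)) (ih (by omega))

variable {ι : Type*} [Fintype ι]

open IsLocalRing

/-- The reduction modulo the maximal ideal, in coordinates. -/
def reduction {R : Type*} [CommRing R] [IsLocalRing R] {P : Type*} [AddCommGroup P] [Module R P]
    (b : Module.Basis ι R P) : P →ₗ[R] (ι → ResidueField R) :=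
  (LinearMap.compLeft (Algebra.linearMap R (ResidueField R)) ι).comp b.equivFun.toLinearMap

theorem ker_reduction {R : Type*} [CommRing R] [IsLocalRing R] {P : Type*} [AddCommGroup P]
    [Module R P] (b : Module.Basis ι R P) {v : P} (hv : reduction b v = 0) :
    v ∈ maximalIdeal R • (⊤ : Submodule R P) := by
  rw [← b.sum_equivFun v]
  refine Submodule.sum_mem _ fun a _ => Submodule.smul_mem_smul ?_ trivial
  have := congrFun hv a
  exact (residue_eq_zero_iff _).1 this

theorem reduction_surjective {R : Type*} [CommRing R] [IsLocalRing R] {P : Type*} [AddCommGroup P]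
    [Module R P] (b : Module.Basis ι R P) : Function.Surjective (reduction b) := by
  intro w
  choose r hr using fun a => residue_surjective (R := R) (w a)
  refine ⟨b.equivFun.symm r, funext fun a => ?_⟩
  simp only [reduction, LinearMap.comp_apply, LinearEquiv.coe_coe, LinearEquiv.apply_symm_apply]
  exact hr a

/-- The reduction of a submodule. -/
def reductionImage {R : Type*} [CommRing R] [IsLocalRing R] {P : Type*} [AddCommGroup P]
    [Module R P] (b : Module.Basis ι R P) (N : Submodule R P) :
    Submodule (ResidueField R) (ι → ResidueField R) where
  carrier := reduction b '' N
  add_mem' := by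
    rintro _ _ ⟨x, hx, rfl⟩ ⟨y, hy, rfl⟩
    exact ⟨x + y, add_mem hx hy, map_add _ _ _⟩
  zero_mem' := ⟨0, zero_mem _, map_zero _⟩
  smul_mem' c := by
    rintro _ ⟨x, hx, rfl⟩
    obtain ⟨r, rfl⟩ := residue_surjective c
    exact ⟨r • x, N.smul_mem r hx, map_smul _ _ _⟩

/-- A linear combination of reductions lifts. -/
theorem exists_lift_of_mem_span {R : Type*} [CommRing R] [IsLocalRing R] {P : Type*}
    [AddCommGroup P] [Module R P] (b : Module.Basis ι R P) {S : Set P}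
    {w : ι → ResidueField R} (hw : w ∈ Submodule.span (ResidueField R) (reduction b '' S)) :
    ∃ v ∈ Submodule.span R S, reduction b v = w := by
  induction hw using Submodule.span_induction with
  | mem x hx => obtain ⟨s, hs, rfl⟩ := hx; exact ⟨s, Submodule.subset_span hs, rfl⟩
  | zero => exact ⟨0, zero_mem _, map_zero _⟩
  | add x y _ _ hx hy =>
    obtain ⟨v, hv, rfl⟩ := hx
    obtain ⟨v', hv', rfl⟩ := hy
    exact ⟨v + v', add_mem hv hv', map_add _ _ _⟩
  | smul c x _ hx =>
    obtain ⟨v, hv, rfl⟩ := hx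
    obtain ⟨r, rfl⟩ := residue_surjective c
    exact ⟨r • v, Submodule.smul_mem _ r hv, map_smul _ _ _⟩

/-- The projection onto `A` fixes `A` and maps `I Q` into `I A`. This lets Nakayama's lemma be
applied inside a direct summand. -/
theorem inf_smul_top_le_of_isCompl {R : Type*} [CommRing R] {Q : Type*} [AddCommGroup Q]
    [Module R Q] {A B : Submodule R Q} (h : IsCompl A B) (I : Ideal R) :
    A ⊓ I • (⊤ : Submodule R Q) ≤ I • A := by
  rintro q ⟨hA, hI⟩
  have h1 : A.subtype.comp (A.projectionOnto B h) q ∈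
      (I • (⊤ : Submodule R Q)).map (A.subtype.comp (A.projectionOnto B h)) := ⟨q, hI, rfl⟩
  rw [Submodule.map_smul''] at h1
  have h2 : A.subtype.comp (A.projectionOnto B h) q = q := by
    have := Submodule.projectionOnto_apply_left h ⟨q, hA⟩
    simp only [LinearMap.comp_apply]
    erw [this]; rfl
  rw [h2] at h1
  refine Submodule.smul_mono le_rfl ?_ h1
  rintro _ ⟨z, _, rfl⟩
  exact Subtype.property _

theorem fg_of_isCompl {R : Type*} [CommRing R] {Q : Type*} [AddCommGroup Q]
    [Module R Q] [Module.Finite R Q] {A B : Submodule R Q} (h : IsCompl A B) : A.FG := by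
  have h1 := Submodule.FG.map (A.subtype.comp (A.projectionOnto B h))
    (Module.Finite.fg_top (R := R) (M := Q))
  have h2 : A = (⊤ : Submodule R Q).map (A.subtype.comp (A.projectionOnto B h)) := by
    apply le_antisymm
    · intro q hq
      refine ⟨q, trivial, ?_⟩
      have := Submodule.projectionOnto_apply_left h ⟨q, hq⟩
      simp only [LinearMap.comp_apply]
      erw [this]; rfl
    · rintro _ ⟨z, _, rfl⟩
      exact Subtype.property _
  rwa [← h2] at h1

/-- Lift a basis of the residue space adapted to the flag of reductions of the `E^i`; the lifts
generate `E^0` by Nakayama. Then go up in `i`: with `t` the equation of `dδ_{i+1}`, the image of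
`E^{i+1}` in `E^0 / t E^0` is a summand, so by Nakayama it is generated by the lifts of level at
least `i + 1`. What remains lies in `E^{i+1} ∩ t E^0 ⊆ t E^i`, which is known by induction.
Comparison with `E^0` alone suffices; the other `E^j` do not enter. -/
theorem exists_isAdaptedBasis_of_antitone [IsLocalRing R] {m : ℕ} {E : ℕ → Submodule R V} {δ : ℕ → Kˣ}
    (g : Module.Basis ι K V) (hg : E 0 = Submodule.span R (Set.range g))
    (hE : Antitone E) (hδ : ∀ i < m, ((δ (i + 1) / δ i : Kˣ) : K) ∈ R)
    (htE : ∀ i < m, scale (δ (i + 1) / δ i)⁻¹ (E i) ≤ E (i + 1))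
    (hinj : ∀ i < m, E (i + 1) ⊓ scale (δ (i + 1) / δ i)⁻¹ (E 0) ≤ scale (δ (i + 1) / δ i)⁻¹ (E i))
    (hsplit : ∀ i < m, IsComplemented (((E (i + 1)).submoduleOf (E 0)).map
      ((scale (δ (i + 1) / δ i)⁻¹ (E 0)).submoduleOf (E 0)).mkQ)) :
    ∃ (e : Module.Basis ι K V) (n : ι → ℕ), IsAdaptedBasis R E δ m e n := by
  classical
  obtain ⟨b⟩ : Nonempty (Module.Basis ι R (E 0)) := by rw [hg]; exact ⟨g.restrictScalars R⟩
  have hE0 : ∀ i, E i ≤ E 0 := fun i => hE (Nat.zero_le i)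
  set k := ResidueField R
  let A : ℕ → Submodule k (ι → k) := fun i => reductionImage b ((E i).submoduleOf (E 0))
  have hA : Antitone A := fun i j hij => by
    rintro _ ⟨v, hv, rfl⟩
    exact ⟨v, hE hij hv, rfl⟩
  obtain ⟨B, -, hB1, hB2⟩ := exists_linearIndepOn_flag m A hA
  have hA0 : ∀ w, w ∈ A 0 := fun w => by
    obtain ⟨v, rfl⟩ := reduction_surjective b w
    exact ⟨v, v.2, rfl⟩
  have hBtop : ⊤ ≤ Submodule.span k (Set.range ((↑) : B → ι → k)) := by
    rw [Subtype.range_coe]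
    exact fun w _ => Submodule.span_mono Set.inter_subset_left (hB2 0 (by omega) (hA0 w))
  let β : Module.Basis B k (ι → k) := Module.Basis.mk hB1 hBtop
  have : Fintype B := FiniteDimensional.fintypeBasisIndex β
  have hcard : Fintype.card B = Fintype.card ι := by
    rw [← Module.finrank_eq_card_basis β, Module.finrank_pi]
  -- The level of a basis vector is the last step of the flag that contains it.
  let n : B → ℕ := fun w => Nat.findGreatest (fun i => (w : ι → k) ∈ A i) m
  have hn : ∀ w : B, (w : ι → k) ∈ A (n w) := fun w =>
    Nat.findGreatest_spec (P := fun i => (w : ι → k) ∈ A i) (Nat.zero_le m) (hA0 w)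
  have hn' : ∀ (w : B) (i : ℕ), i ≤ m → (w : ι → k) ∈ A i → i ≤ n w := fun w i hi h =>
    Nat.le_findGreatest hi h
  -- The lift is taken in `E (n w)`, not just in `E 0`; hence it lies in every `E i` with `i ≤ n w`.
  choose v hvE hv using hn
  let e : B → V := fun w => (v w : V)
  have hmax : maximalIdeal R ≤ (⊥ : Ideal R).jacobson := by
    rw [IsLocalRing.jacobson_eq_maximalIdeal _ bot_ne_top]
  have hfin : Module.Finite R (E 0) := Module.Finite.of_basis b
  have hspan : (⊤ : Submodule R (E 0)) ≤ Submodule.span R (Set.range v) := by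
    refine Submodule.le_of_le_smul_of_le_jacobson_bot Module.Finite.fg_top hmax fun x _ => ?_
    have h1 : reduction b x ∈ Submodule.span k (reduction b '' Set.range v) := by
      rw [← Set.range_comp]
      convert! hBtop (x := reduction b x) trivial using 3
      exact funext hv
    obtain ⟨y, hy, hxy⟩ := exists_lift_of_mem_span b h1
    refine Submodule.mem_sup.2 ⟨y, hy, x - y, ker_reduction b ?_, add_sub_cancel _ _⟩
    rw [map_sub, hxy, sub_self]
  have hspanV : E 0 ≤ Submodule.span R (Set.range e) := by
    intro x hx
    have := Submodule.mem_map_of_mem (f := (E 0).subtype) (hspan (x := ⟨x, hx⟩) trivial)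
    rw [Submodule.map_span, ← Set.range_comp] at this
    exact this
  have htop : ⊤ ≤ Submodule.span K (Set.range e) := by
    rw [← g.span_eq, Submodule.span_le]
    rintro _ ⟨a, rfl⟩
    refine Submodule.span_subset_span R K _ (hspanV ?_)
    rw [hg]; exact Submodule.subset_span ⟨a, rfl⟩
  have : FiniteDimensional K V := Module.Finite.of_basis g
  -- As many spanning vectors as the dimension: independence over `K` comes for free.
  let eb : Module.Basis B K V := basisOfTopLeSpanOfCardEqFinrank e htop
    (by rw [hcard, Module.finrank_eq_card_basis g])
  have heb : ∀ w, eb w = v w := fun w =>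
    congrFun (coe_basisOfTopLeSpanOfCardEqFinrank e htop _) w
  suffices h : IsAdaptedBasis R E δ m eb n from
    ⟨_, _, h.reindex (Fintype.equivOfCardEq hcard)⟩
  refine ⟨fun w => Nat.findGreatest_le m, fun i => ?_⟩
  induction i with
  | zero =>
    intro _
    refine le_antisymm (hspanV.trans (Submodule.span_le.2 ?_)) (diag_le fun w => ?_)
    · rintro _ ⟨w, rfl⟩
      refine Submodule.subset_span ⟨w, ?_⟩
      simp [heb, e]
    · simp only [Nat.min_zero, div_self', Units.val_one, one_smul, heb]
      exact (v w).2
  | succ i ih =>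
    intro hi
    have ih := ih (by omega)
    set t := δ (i + 1) / δ i
    -- generation of `E (i + 1)`
    have hgen : E (i + 1) ≤ Submodule.span R (e '' {w | i + 1 ≤ n w}) ⊔ scale t⁻¹ (E i) := by
      let q := ((scale t⁻¹ (E 0)).submoduleOf (E 0)).mkQ
      let P := ((E (i + 1)).submoduleOf (E 0))
      have hS : Submodule.span R (v '' {w | i + 1 ≤ n w}) ≤ P := by
        refine Submodule.span_le.2 ?_
        rintro _ ⟨w, hw, rfl⟩
        exact hE hw (hvE w)
      obtain ⟨C, hC⟩ := hsplit i (by omega)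
      have hle : P.map q ≤ (Submodule.span R (v '' {w | i + 1 ≤ n w})).map q := by
        refine Submodule.le_of_le_smul_of_le_jacobson_bot (fg_of_isCompl hC) hmax ?_
        rintro _ ⟨x, hx, rfl⟩
        have h1 : reduction b x ∈ Submodule.span k (reduction b '' (v '' {w | i + 1 ≤ n w})) := by
          refine Submodule.span_mono ?_ (hB2 (i + 1) hi (show reduction b x ∈ A (i + 1) from ⟨x, hx, rfl⟩))
          rintro w ⟨hw, hw'⟩
          exact ⟨v ⟨w, hw⟩, ⟨⟨w, hw⟩, hn' ⟨w, hw⟩ _ hi hw', rfl⟩, hv _⟩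
        obtain ⟨y, hy, hxy⟩ := exists_lift_of_mem_span b h1
        -- The error `x - y` reduces to zero, so its class lies in the maximal ideal times the whole
        -- quotient; being in the summand, it lies in the maximal ideal times the summand.
        refine Submodule.mem_sup.2 ⟨q y, ⟨y, hy, rfl⟩, q (x - y),
          inf_smul_top_le_of_isCompl hC _ ⟨⟨x - y, sub_mem hx (hS hy), rfl⟩, ?_⟩, by simp⟩
        have h2 := ker_reduction b (v := x - y) (by rw [map_sub, hxy, sub_self])
        have h3 := Submodule.mem_map_of_mem (f := q) h2
        rw [Submodule.map_smul''] at h3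
        exact Submodule.smul_mono le_rfl le_top h3
      intro x hx
      obtain ⟨y, hy, hxy⟩ := hle ⟨⟨x, hE0 _ hx⟩, hx, rfl⟩
      refine Submodule.mem_sup.2 ⟨y, ?_, x - y, ?_, add_sub_cancel _ _⟩
      · have := Submodule.mem_map_of_mem (f := (E 0).subtype) hy
        rw [Submodule.map_span, ← Set.image_comp] at this
        exact this
      -- Equality modulo `t E^0` puts the difference in `E^{i+1} ∩ t E^0`, and persistence sharpens
      -- this to `t E^i`.
      · refine hinj i (by omega) ⟨sub_mem hx (hS hy), ?_⟩
        have h1 : (⟨x, hE0 _ hx⟩ : E 0) - y ∈ (scale t⁻¹ (E 0)).submoduleOf (E 0) := by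
          rw [← Submodule.ker_mkQ ((scale t⁻¹ (E 0)).submoduleOf (E 0)), LinearMap.mem_ker, map_sub,
            sub_eq_zero]
          exact hxy.symm
        exact h1
    have hcoef : ∀ w, ((δ (i + 1) / δ (min (n w) (i + 1)) : Kˣ)) =
        if i + 1 ≤ n w then 1 else t * (δ i / δ (min (n w) i)) := fun w => by
      split_ifs with h
      · rw [min_eq_right h, div_self']
      · rw [min_eq_left (by omega : n w ≤ i + 1), min_eq_left (by omega : n w ≤ i),
          div_mul_div_cancel]
    refine le_antisymm (hgen.trans (sup_le (Submodule.span_le.2 ?_) ?_)) (diag_le fun w => ?_)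
    · rintro _ ⟨w, hw, rfl⟩
      refine Submodule.subset_span ⟨w, ?_⟩
      dsimp only
      rw [hcoef, if_pos (show i + 1 ≤ n w from hw), Units.val_one, one_smul, heb]
    · intro x hx
      rw [mem_scale, ih, mem_diag_iff] at hx
      refine mem_diag_iff.2 fun w => ?_
      have := hx w
      rw [map_smul, Finsupp.smul_apply, smul_eq_mul] at this
      rw [hcoef]
      split_ifs with h
      · rw [min_eq_right (by omega : i ≤ n w), div_self', inv_one, Units.val_one, one_mul] at this
        rw [inv_one, Units.val_one, one_mul, ← Units.mul_inv_cancel_left t (eb.repr x w)]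
        exact mul_mem (hδ i (by omega)) this
      · rwa [mul_inv, mul_comm, Units.val_mul, mul_comm, mul_comm ((t⁻¹ : Kˣ) : K), mul_assoc]
    · rw [hcoef]
      split_ifs with h
      · rw [Units.val_one, one_smul, heb]
        exact hE h (hvE w)
      · refine htE i (by omega) ?_
        rw [mem_scale, ih, smul_smul, Units.val_mul, Units.inv_mul_cancel_left]
        exact Submodule.subset_span ⟨w, rfl⟩

/-- Existence of adapted bases. -/
theorem exists_isAdaptedBasis [IsLocalRing R] {m : ℕ} {E : ℕ → Submodule R V} {δ : ℕ → Kˣ}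
    (g : Module.Basis ι K V) (hg : E 0 = Submodule.span R (Set.range g))
    (hE : ∀ i < m, E (i + 1) ≤ E i) (hδ : ∀ i < m, ((δ (i + 1) / δ i : Kˣ) : K) ∈ R)
    (htE : ∀ i < m, scale (δ (i + 1) / δ i)⁻¹ (E i) ≤ E (i + 1))
    (hinj : ∀ i < m, E (i + 1) ⊓ scale (δ (i + 1) / δ i)⁻¹ (E 0) ≤ scale (δ (i + 1) / δ i)⁻¹ (E i))
    (hsplit : ∀ i < m, IsComplemented (((E (i + 1)).submoduleOf (E 0)).map
      ((scale (δ (i + 1) / δ i)⁻¹ (E 0)).submoduleOf (E 0)).mkQ)) :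
    ∃ (e : Module.Basis ι K V) (n : ι → ℕ), IsAdaptedBasis R E δ m e n := by
  -- The chain is made constant beyond `m`, where nothing is known, so that it is descending on all
  -- of `ℕ`.
  have h1 : ∀ i ≤ m, E (min i m) = E i := fun i hi => by rw [min_eq_left hi]
  have h2 : ∀ i < m, E (min (i + 1) m) = E (i + 1) := fun i hi => by
    rw [min_eq_left (by omega : i + 1 ≤ m)]
  have h0 : E (min 0 m) = E 0 := h1 0 (by omega)
  obtain ⟨e, n, hen⟩ := exists_isAdaptedBasis_of_antitone (m := m) (E := fun i => E (min i m))
    (δ := δ) g (h0.trans hg) (antitone_nat_of_succ_le fun i => by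
      rcases lt_or_ge i m with hi | hi
      · rw [h1 i hi.le, h2 i hi]; exact hE i hi
      · rw [min_eq_right hi, min_eq_right (by omega : m ≤ i + 1)]) hδ
    (fun i hi => by rw [h1 i hi.le, h2 i hi]; exact htE i hi)
    (fun i hi => by rw [h1 i hi.le, h2 i hi, h0]; exact hinj i hi)
    (fun i hi => by rw [h2 i hi, h0]; exact hsplit i hi)
  exact ⟨e, n, hen.le, fun i hi => (h1 i hi).symm.trans (hen.eq_diag i hi)⟩

/-! ### Persistence and the recursion in an adapted basis -/

namespace IsAdaptedBasis

variable {E : ℕ → Submodule R V} {δ : ℕ → Kˣ} {m : ℕ} {e : Module.Basis ι K V} {n : ι → ℕ}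

omit [Fintype ι] in
theorem smul_mem (h : IsAdaptedBasis R E δ m e n) {i : ℕ} (hi : i ≤ m) (a : ι) {r : K}
    (hr : ((δ i / δ (min (n a) i))⁻¹ : Kˣ) * r ∈ R) : r • e a ∈ E i := by
  rw [h.eq_diag i hi]
  exact smul_mem_diag a hr

omit [Fintype ι] in
theorem mem_of_le (h : IsAdaptedBasis R E δ m e n) {i : ℕ} (a : ι) (hi : i ≤ n a) : e a ∈ E i := by
  rw [← one_smul K (e a)]
  refine h.smul_mem (hi.trans (h.le a)) a ?_
  rw [min_eq_right hi, div_self', inv_one, Units.val_one, one_mul]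
  exact one_mem R

theorem mem_iff (h : IsAdaptedBasis R E δ m e n) {i : ℕ} (hi : i ≤ m) {v : V} :
    v ∈ E i ↔ ∀ a, ((δ i / δ (min (n a) i))⁻¹ : Kˣ) * e.repr v a ∈ R := by
  rw [h.eq_diag i hi, mem_diag_iff]

theorem mem_zero_iff (h : IsAdaptedBasis R E δ m e n) {v : V} :
    v ∈ E 0 ↔ ∀ a, e.repr v a ∈ R := by
  simp [h.mem_iff (Nat.zero_le m)]

/-- The coefficients of the adapted basis of `E i`. -/
theorem coeff_succ (n i : ℕ) :
    δ (i + 1) / δ (min n (i + 1)) =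
      if i + 1 ≤ n then 1 else δ (i + 1) / δ i * (δ i / δ (min n i)) := by
  split_ifs with h
  · rw [min_eq_right h, div_self']
  · rw [min_eq_left (by omega : n ≤ i + 1), min_eq_left (by omega : n ≤ i), div_mul_div_cancel]

theorem coeff_of_le {n i : ℕ} (h : i ≤ n) : δ i / δ (min n i) = 1 := by
  rw [min_eq_right h, div_self']

/-- The coefficient is 1 as long as `i ≤ n` and then picks up one effective factor per step, so each
coefficient divides the later ones. -/
theorem coeff_div_coeff_mem (hδ : ∀ i < m, ((δ (i + 1) / δ i : Kˣ) : K) ∈ R) (n : ℕ) {i j : ℕ}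
    (hij : i ≤ j) (hj : j ≤ m) :
    ((δ j / δ (min n j) / (δ i / δ (min n i)) : Kˣ) : K) ∈ R := by
  rcases le_total n i with h | h
  · rw [min_eq_left h, min_eq_left (h.trans hij), div_div_div_cancel_right]
    exact div_mem_of_le hδ hij hj
  · rw [coeff_of_le h, div_one]
    exact div_mem_of_le hδ (min_le_right _ _) hj

theorem mem_of_inv_mul_mem {u : Kˣ} {x : K} (hu : (u : K) ∈ R) (h : ((u⁻¹ : Kˣ) : K) * x ∈ R) :
    x ∈ R := by
  rw [← Units.mul_inv_cancel_left u x]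
  exact mul_mem hu h

theorem inv_mul_mem_of_div_mem {c d : Kˣ} {x : K} (h : ((c / d : Kˣ) : K) ∈ R)
    (hx : ((c⁻¹ : Kˣ) : K) * x ∈ R) : ((d⁻¹ : Kˣ) : K) * x ∈ R := by
  refine mem_of_inv_mul_mem h ?_
  rwa [← mul_assoc, ← Units.val_mul, inv_div, div_mul_eq_mul_div, mul_inv_cancel, one_div]

theorem mem_scale_iff (h : IsAdaptedBasis R E δ m e n) {i : ℕ} (hi : i ≤ m) (u : Kˣ) {v : V} :
    v ∈ scale u (E i) ↔ ∀ a, ((δ i / δ (min (n a) i) / u)⁻¹ : Kˣ) * e.repr v a ∈ R := by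
  rw [mem_scale, h.mem_iff hi]
  refine forall_congr' fun a => ?_
  rw [map_smul, Finsupp.smul_apply, smul_eq_mul, ← mul_assoc, ← Units.val_mul, ← div_eq_inv_mul, ← inv_div u,
    inv_inv]

variable (hδ : ∀ i < m, ((δ (i + 1) / δ i : Kˣ) : K) ∈ R)

include hδ

theorem le_of_le (h : IsAdaptedBasis R E δ m e n) {i j : ℕ} (hij : i ≤ j) (hj : j ≤ m) :
    E j ≤ E i := fun v hv => by
  rw [h.mem_iff hj] at hv
  rw [h.mem_iff (hij.trans hj)]
  exact fun a => inv_mul_mem_of_div_mem (coeff_div_coeff_mem hδ (n a) hij hj) (hv a)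

/-- In passing from `i` to `i + 1` each coefficient is multiplied by 1 or by the equation of
`dδ_{i+1}`. With the next two lemmas this recovers the persistence conditions from the adapted basis
alone, which is how they are transported to pullbacks. -/
theorem scale_le (h : IsAdaptedBasis R E δ m e n) {i : ℕ} (hi : i < m) :
    scale (δ (i + 1) / δ i)⁻¹ (E i) ≤ E (i + 1) := fun v hv => by
  rw [h.mem_scale_iff hi.le] at hv
  rw [h.mem_iff hi]
  intro a
  have := hv a
  rw [coeff_succ]
  split_ifs with hn
  · rw [coeff_of_le (by omega : i ≤ n a), one_div, inv_inv] at this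
    rw [inv_one, Units.val_one, one_mul]
    exact mem_of_inv_mul_mem (hδ i hi) this
  · rwa [div_inv_eq_mul, mul_comm (δ i / _)] at this

/-- Where the level is at least `i + 1`, the coefficients of `E^i` and `E^j` are both 1, so lying in
the twist of `E^j` is enough; where it is at most `i`, the coefficient of `E^{i+1}` is already that
of the twist of `E^i`. -/
theorem inf_scale_eq (h : IsAdaptedBasis R E δ m e n) {i j : ℕ} (hi : i < m) (hj : j ≤ i) :
    E (i + 1) ⊓ scale (δ (i + 1) / δ i)⁻¹ (E j) = scale (δ (i + 1) / δ i)⁻¹ (E i) := by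
  refine le_antisymm (fun v hv => ?_)
    (le_inf (h.scale_le hδ hi) (scale_mono _ (h.le_of_le hδ hj hi.le)))
  obtain ⟨h1, h2⟩ := hv
  rw [SetLike.mem_coe, h.mem_iff hi] at h1
  rw [SetLike.mem_coe, h.mem_scale_iff (hj.trans hi.le)] at h2
  rw [h.mem_scale_iff hi.le]
  intro a
  have h1 := h1 a
  have h2 := h2 a
  rw [coeff_succ] at h1
  split_ifs at h1 with hn
  · rwa [coeff_of_le (by omega : i ≤ n a), ← coeff_of_le (δ := δ) (by omega : j ≤ n a)]
  · rwa [div_inv_eq_mul, mul_comm (δ i / _)]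

/-- Modulo `E^j(-dδ_{i+1})` only the basis vectors of level at least `i + 1` survive in `E^{i+1}`;
the vectors of lower level span a complement. -/
theorem isComplemented (h : IsAdaptedBasis R E δ m e n) {i j : ℕ} (hi : i < m) (hj : j ≤ i) :
    IsComplemented (((E (i + 1)).submoduleOf (E j)).map
      ((scale (δ (i + 1) / δ i)⁻¹ (E j)).submoduleOf (E j)).mkQ) := by
  classical
  let S : Submodule R (E j) :=
    { carrier := {v | ∀ a, i + 1 ≤ n a → e.repr v a = 0}
      add_mem' := fun {x y} hx hy a ha => by
        rw [Submodule.coe_add, map_add, Finsupp.add_apply, hx a ha, hy a ha, add_zero]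
      zero_mem' := fun a _ => by rw [Submodule.coe_zero, map_zero, Finsupp.zero_apply]
      smul_mem' := fun c x hx a ha => by
        have : e.repr ((c • x : E j) : V) a = (c : K) * e.repr x a := by
          rw [show ((c • x : E j) : V) = (c : K) • (x : V) from rfl, map_smul]; rfl
        rw [this, hx a ha, mul_zero] }
  have hjm : j ≤ m := hj.trans hi.le
  refine ⟨S.map ((scale (δ (i + 1) / δ i)⁻¹ (E j)).submoduleOf (E j)).mkQ, ?_, ?_⟩
  · rw [Submodule.disjoint_def]
    rintro _ ⟨x, hx, rfl⟩ ⟨y, hy, hxy⟩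
    have h1 : y - x ∈ (scale (δ (i + 1) / δ i)⁻¹ (E j)).submoduleOf (E j) := by
      rw [← Submodule.ker_mkQ ((scale (δ (i + 1) / δ i)⁻¹ (E j)).submoduleOf (E j)),
        LinearMap.mem_ker, map_sub, sub_eq_zero]
      exact hxy
    have h2 : ((y - x : E j) : V) ∈ scale (δ (i + 1) / δ i)⁻¹ (E j) := h1
    have hx' : (x : V) ∈ E (i + 1) := hx
    rw [h.mem_scale_iff hjm] at h2
    rw [h.mem_iff hi] at hx'
    rw [← LinearMap.mem_ker, Submodule.ker_mkQ]
    change (x : V) ∈ scale (δ (i + 1) / δ i)⁻¹ (E j)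
    rw [h.mem_scale_iff hjm]
    intro a
    by_cases hn : i + 1 ≤ n a
    · have := h2 a
      rw [Submodule.coe_sub, map_sub, Finsupp.sub_apply, hy a hn, zero_sub, mul_neg] at this
      exact neg_mem_iff.1 this
    · refine inv_mul_mem_of_div_mem ?_ (hx' a)
      rw [coeff_succ, if_neg hn, div_inv_eq_mul, mul_comm (δ j / _), mul_div_mul_left_eq_div]
      exact coeff_div_coeff_mem hδ (n a) hj hi.le
  · rw [codisjoint_iff_le_sup]
    intro q _
    obtain ⟨v, rfl⟩ := Submodule.mkQ_surjective _ q
    have hv := v.2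
    rw [h.mem_iff hjm] at hv
    let x : V := e.equivFun.symm fun a => if i + 1 ≤ n a then e.repr v a else 0
    have hxa : ∀ a, e.repr x a = if i + 1 ≤ n a then e.repr v a else 0 := fun a =>
      congrFun (e.equivFun.apply_symm_apply _) a
    have hx : x ∈ E (i + 1) := by
      rw [h.mem_iff hi]
      intro a
      rw [hxa, coeff_succ]
      split_ifs with hn
      · have := hv a
        rwa [coeff_of_le (by omega : j ≤ n a)] at this
      · rw [mul_zero]; exact zero_mem R
    have hxj : x ∈ E j := h.le_of_le hδ (by omega) hi hx
    refine Submodule.mem_sup.2 ⟨_, ⟨⟨x, hxj⟩, hx, rfl⟩, _, ⟨v - ⟨x, hxj⟩, fun a ha => ?_, rfl⟩, ?_⟩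
    · rw [Submodule.coe_sub, map_sub, Finsupp.sub_apply, hxa, if_pos ha, sub_self]
    · rw [← map_add, add_sub_cancel]

omit hδ

/-- The submodules `C j i` of the recursive construction of the modification. -/
theorem chain_eq_diag (h : IsAdaptedBasis R E δ m e n) {D : ℕ → Kˣ}
    (hD0 : D 0 = 1) (hδ0 : δ 0 = 1)
    (hD : ∀ i < m, ((D (i + 1) / D i : Kˣ) : K) ∈ R)
    (hx : ∀ i < m, ((δ (i + 1) / D (i + 1) / (δ i / D i) : Kˣ) : K) ∈ R)
    (hcop : ∀ i < m, ∀ c ∈ R, (D (i + 1) : K) * c * ((δ (i + 1) / D (i + 1))⁻¹ : Kˣ) ∈ R →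
      c * ((δ (i + 1) / D (i + 1))⁻¹ : Kˣ) ∈ R)
    (C : ℕ → ℕ → Submodule R V) (hC00 : C 0 0 = E 0) (hC0 : ∀ i, C 0 (i + 1) = E (i + 1))
    (hC1 : ∀ j < m, C (j + 1) 0 = scale (D (j + 1) / D j) (C j 1) ⊔ C j 0)
    (hC2 : ∀ j < m, ∀ i, C (j + 1) (i + 1) = scale (δ (j + 1) / δ j) (C j (i + 2)) ⊓ C (j + 1) 0) :
    C m 0 = diag R e fun a => (D (n a))⁻¹ := by
  have hδ : ∀ i < m, ((δ (i + 1) / δ i : Kˣ) : K) ∈ R := fun i hi => by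
    have : δ (i + 1) / δ i = (δ (i + 1) / D (i + 1) / (δ i / D i)) * (D (i + 1) / D i) := by
      rw [div_mul_div_comm, div_mul_cancel, div_mul_cancel]
    rw [this, Units.val_mul]; exact mul_mem (hx i hi) (hD i hi)
  set X : ℕ → Kˣ := fun i => δ i / D i with hX
  have hδX : ∀ i, δ i = X i * D i := fun i => by simp [hX]
  -- Upper bound `E_j^{i+1} ⊆ E^{i+1+j}(δ_j)`: the twists by `dδ` accumulate to `δ_j`.
  have hup : ∀ j ≤ m, ∀ i, C j (i + 1) ≤ scale (δ j) (E (i + 1 + j)) := by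
    intro j
    induction j with
    | zero =>
      intro _ i v hv
      rw [hC0] at hv; simpa [mem_scale, hδ0] using hv
    | succ j ih =>
      intro hj i v hv
      rw [hC2 j hj] at hv
      have h1 := ih (by omega) (i + 1) hv.1
      rw [mem_scale, smul_smul, ← Units.val_mul, mul_div_cancel] at h1
      rwa [mem_scale, show i + 1 + (j + 1) = i + 1 + 1 + j by omega]
  have hC2' : ∀ j ≤ m, ∀ i, i + 1 ≤ m → C j (i + 1) ≤ C j 0 := by
    rintro (_ | j) hj i hi
    · rw [hC0, hC00]; exact h.le_of_le hδ (Nat.zero_le _) hi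
    · rw [hC2 j hj]; exact inf_le_right
  -- Lower bound: a vector of high enough level gains the full pole along `D_j` in `E_j^{i+1}`.
  have hlow : ∀ j i a, i + 1 + j ≤ n a → (((D j)⁻¹ : Kˣ) : K) • e a ∈ C j (i + 1) := by
    intro j
    induction j with
    | zero =>
      intro i a hi
      rw [hC0, hD0, inv_one, Units.val_one, one_smul]
      exact h.mem_of_le a (by omega)
    | succ j ih =>
      intro i a hi
      have hjm : j < m := by have := h.le a; omega
      rw [hC2 j hjm, hC1 j hjm]
      refine ⟨?_, Submodule.mem_sup_left ?_⟩
      · change (((δ (j + 1) / δ j : Kˣ) : K)) • (((D (j + 1))⁻¹ : Kˣ) : K) • e a ∈ C j (i + 2)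
        have h1 : δ (j + 1) / δ j * (D (j + 1))⁻¹ = X (j + 1) / X j * (D j)⁻¹ := by
          rw [hδX, hδX, mul_div_mul_comm, mul_assoc, div_eq_mul_inv (D (j + 1)),
            mul_inv_cancel_comm]
        rw [smul_smul, ← Units.val_mul, h1, Units.val_mul, ← smul_smul]
        exact smul_mem_of_mem (hx j hjm) (ih (i + 1) a (by omega))
      · rw [mem_scale, smul_smul, ← Units.val_mul, div_eq_mul_inv, mul_inv_cancel_comm]
        exact ih 0 a (by omega)
  -- The `j`-th step enlarges the pole only on vectors of level at least `j`; since levels do not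
  -- exceed `m`, the truncation disappears at `j = m`.
  suffices hmain : ∀ j ≤ m, C j 0 = diag R e fun a => (D (min (n a) j))⁻¹ by
    rw [hmain m le_rfl]
    simp only [min_eq_left (h.le _)]
  intro j
  induction j with
  | zero =>
    intro _
    rw [hC00, h.eq_diag 0 (Nat.zero_le m)]
    simp only [Nat.min_zero, div_self', hD0, inv_one]
  | succ j ih =>
    intro hj
    have ih := ih (by omega)
    rw [hC1 j hj]
    refine le_antisymm (sup_le ?_ ?_) (diag_le fun a => ?_)
    · intro v hv
      have h1 := hC2' j (by omega) 0 (by omega) hv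
      rw [ih, mem_diag_iff] at h1
      have h2 := hup j (by omega) 0 hv
      rw [mem_scale, smul_smul, ← Units.val_mul, h.mem_iff (by omega)] at h2
      refine mem_diag_iff.2 fun a => ?_
      have h1 := h1 a
      have h2 := h2 a
      rw [map_smul, Finsupp.smul_apply, smul_eq_mul] at h1 h2
      rw [inv_inv] at h1 ⊢
      by_cases hn : j + 1 ≤ n a
      · rw [min_eq_right (by omega : j ≤ n a), ← mul_assoc, ← Units.val_mul, mul_div_cancel] at h1
        rwa [min_eq_right hn]
      · rw [min_eq_left (by omega : n a ≤ j)] at h1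
        rw [zero_add, add_comm 1 j, min_eq_left (by omega : n a ≤ j + 1)] at h2
        rw [min_eq_left (by omega : n a ≤ j + 1)]
        set x := e.repr v a
        have hXX : ((X (j + 1) / X (n a) : Kˣ) : K) ∈ R :=
          div_mem_of_le (δ := X) (m := m) hx (by omega) hj
        have hXj : ((X (j + 1) / X j : Kˣ) : K) ∈ R := hx j (by omega)
        -- For level at most `j` the pole must not grow: `D (n a) * x` has to be regular. The
        -- induction hypothesis makes it regular after multiplication by `D (j + 1)`, the bound
        -- `hup` after multiplication by `X (j + 1)`, the equation of `δ_{j+1} - D_{j+1}`.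
        -- Coprimality of the two equations is applied to `c = X (j + 1) * D (n a) * x`.
        have hDj : (D j : K) ∈ R := by
          simpa [hD0] using div_mem_of_le hD (Nat.zero_le j) (by omega)
        have h3 := hcop j (by omega) ((X (j + 1) : K) * D (n a) * x)
        have e1 : (X (j + 1) : K) * D (n a) * x = ((X (j + 1) / X (n a) : Kˣ) : K) *
            (((X (j + 1) / X j : Kˣ) : K) * ((((δ (j + 1) / δ (n a))⁻¹ : Kˣ) : K) *
              (((δ j * (D (j + 1) / D j) : Kˣ) : K) * x))) := by
          simp only [hδX, Units.val_div_eq_div_val, Units.val_mul, Units.val_inv_eq_inv_val]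
          field_simp
        have e2 : (D (j + 1) : K) * ((X (j + 1) : K) * D (n a) * x) * ((X (j + 1))⁻¹ : Kˣ) =
            D j * (D (n a) * (((D (j + 1) / D j : Kˣ) : K) * x)) := by
          simp only [Units.val_div_eq_div_val, Units.val_inv_eq_inv_val]
          field_simp
        have e3 : (X (j + 1) : K) * D (n a) * x * ((X (j + 1))⁻¹ : Kˣ) = D (n a) * x := by
          simp only [Units.val_inv_eq_inv_val]
          field_simp
        have hX' : δ (j + 1) / D (j + 1) = X (j + 1) := rfl
        rw [hX', e2, e3] at h3
        refine h3 ?_ (mul_mem hDj h1)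
        rw [e1]
        exact mul_mem hXX (mul_mem hXj h2)
    · rw [ih]
      refine diag_le fun a => smul_mem_diag a ?_
      rw [inv_inv, ← Units.val_mul, ← div_eq_mul_inv]
      exact div_mem_of_le hD (min_le_min_left _ (by omega)) ((min_le_right _ _).trans hj)
    · by_cases hn : j + 1 ≤ n a
      · refine Submodule.mem_sup_left ?_
        rw [mem_scale, smul_smul, min_eq_right hn, ← Units.val_mul, div_eq_mul_inv,
          mul_inv_cancel_comm]
        exact hlow j 0 a (by omega)
      · refine Submodule.mem_sup_right ?_
        rw [ih, min_eq_left (by omega : n a ≤ j + 1)]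
        refine smul_mem_diag a ?_
        rw [inv_inv, min_eq_left (by omega : n a ≤ j), Units.mul_inv]
        exact one_mem R

/-- The coordinates of an element of `E i`, multiplied by `D (n a)`, are divisible by `D i`. -/
theorem inv_mul_mul_repr_mem (h : IsAdaptedBasis R E δ m e n) {D : ℕ → Kˣ}
    (hD : ∀ i < m, ((D (i + 1) / D i : Kˣ) : K) ∈ R)
    (hx : ∀ i < m, ((δ (i + 1) / D (i + 1) / (δ i / D i) : Kˣ) : K) ∈ R)
    {i : ℕ} (hi : i ≤ m) {v : V} (hv : v ∈ E i) (a : ι) :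
    ((D i)⁻¹ : Kˣ) * (D (n a) * e.repr v a) ∈ R := by
  have h1 := (h.mem_iff hi).1 hv a
  rcases le_total i (n a) with hn | hn
  · rw [coeff_of_le hn, inv_one, Units.val_one, one_mul] at h1
    rw [← mul_assoc, ← Units.val_mul, mul_comm _ (D (n a)), ← div_eq_mul_inv]
    exact mul_mem (div_mem_of_le hD hn (h.le a)) h1
  · rw [min_eq_left hn] at h1
    -- Past its level the coordinate is divisible by `δ i / δ (n a)`, of which `D i / D (n a)` is a
    -- factor because `δ - D` also grows effectively.
    have h2 := mul_mem (div_mem_of_le (δ := fun i => δ i / D i) hx hn hi) h1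
    convert h2 using 1
    simp only [Units.val_div_eq_div_val, Units.val_inv_eq_inv_val]
    field_simp

/-- With the next lemma this identifies the diagonal lattice of the modification with the sum of the
`D_i⁻¹ E^i`, a description free of bases. -/
theorem scale_le_diag (h : IsAdaptedBasis R E δ m e n) {D : ℕ → Kˣ}
    (hD : ∀ i < m, ((D (i + 1) / D i : Kˣ) : K) ∈ R)
    (hx : ∀ i < m, ((δ (i + 1) / D (i + 1) / (δ i / D i) : Kˣ) : K) ∈ R)
    {i : ℕ} (hi : i ≤ m) : scale (D i) (E i) ≤ diag R e fun a => (D (n a))⁻¹ := fun v hv => by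
  refine mem_diag_iff.2 fun a => ?_
  have h1 := h.inv_mul_mul_repr_mem hD hx hi hv a
  rwa [map_smul, Finsupp.smul_apply, smul_eq_mul, mul_left_comm, Units.inv_mul_cancel_left,
    ← inv_inv (D (n a))] at h1

-- The generator `D_{n(a)}⁻¹ e_a` already occurs in the term `i = n(a)`, since `e_a` lies in
-- `E^{n(a)}`.
omit [Fintype ι] in
theorem diag_le_of_scale_le (h : IsAdaptedBasis R E δ m e n) {D : ℕ → Kˣ} {N : Submodule R V}
    (hN : ∀ i ≤ m, scale (D i) (E i) ≤ N) : (diag R e fun a => (D (n a))⁻¹) ≤ N :=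
  diag_le fun a => hN (n a) (h.le a) <| by
    rw [mem_scale, smul_smul, Units.mul_inv, one_smul]
    exact h.mem_of_le a le_rfl

end IsAdaptedBasis

end Adapted

/-! ### Generic stalks, lattices and torsion-free sheaves -/

section GenericMap

variable {X : Scheme.{u}} [IsIntegral X] {M N P : X.Modules}

theorem genericPoint_mem_of_nonempty {U : X.Opens} (hU : (U : Set X).Nonempty) :
    genericPoint X ∈ U := genericPoint_mem hU.some_mem

theorem exists_genGerm (v : GenericStalk M) :
    ∃ (U : X.Opens) (hU : genericPoint X ∈ U) (s : Γ(M, U)), genGerm M hU s = v :=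
  M.presheaf.exists_germ_eq v

theorem exists_toFunctionField (c : X.functionField) :
    ∃ (U : X.Opens) (hU : genericPoint X ∈ U) (r : Γ(X, U)), toFunctionField hU r = c :=
  X.presheaf.exists_germ_eq c

/-- A rational function and a rational section have representatives over a common open set. -/
theorem exists_toFunctionField_genGerm (c : X.functionField) (v : GenericStalk M) :
    ∃ (U : X.Opens) (hU : genericPoint X ∈ U) (r : Γ(X, U)) (s : Γ(M, U)),
      toFunctionField hU r = c ∧ genGerm M hU s = v := by
  obtain ⟨U, hU, r, rfl⟩ := exists_toFunctionField c
  obtain ⟨W, hW, s, rfl⟩ := exists_genGerm v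
  exact ⟨U ⊓ W, ⟨hU, hW⟩, X.presheaf.map (homOfLE inf_le_left).op r,
    M.presheaf.map (homOfLE inf_le_right).op s, toFunctionField_res _ _ _, genGerm_res _ _ _ _⟩

theorem exists_of_genGerm_eq {U W : X.Opens} {x y : X} {hx : x ∈ U} {hy : y ∈ W} {s : Γ(M, U)}
    {t : Γ(M, W)} (h : genGerm M hx s = genGerm M hy t) :
    ∃ (O : X.Opens) (_ : genericPoint X ∈ O) (i : O ⟶ U) (j : O ⟶ W),
      M.presheaf.map i.op s = M.presheaf.map j.op t :=
  M.presheaf.germ_eq _ _ _ s t h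

/-- The map on generic stalks induced by a morphism. -/
def genMap (φ : M ⟶ N) : GenericStalk M →ₗ[X.functionField] GenericStalk N where
  toFun := ((TopCat.Presheaf.stalkFunctor Ab.{u} (genericPoint X)).map φ.mapPresheaf).hom
  map_add' := map_add _
  map_smul' c v := by
    obtain ⟨U, hU, r, s, rfl, rfl⟩ := exists_toFunctionField_genGerm c v
    have key : ∀ t : Γ(M, U), ((TopCat.Presheaf.stalkFunctor Ab.{u} (genericPoint X)).map
        φ.mapPresheaf).hom (genGerm M hU t) = genGerm N hU (φ.app U t) := fun t =>
      TopCat.Presheaf.stalkFunctor_map_germ_apply U (genericPoint X) hU φ.mapPresheaf t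
    rw [← genGerm_smul, key, key, Scheme.Modules.Hom.app_smul, genGerm_smul]
    rfl

theorem genMap_genGerm (φ : M ⟶ N) {U : X.Opens} {x : X} (hx : x ∈ U) (s : Γ(M, U)) :
    genMap φ (genGerm M hx s) = genGerm N hx (φ.app U s) :=
  TopCat.Presheaf.stalkFunctor_map_germ_apply U (genericPoint X) (genericPoint_mem hx)
    φ.mapPresheaf s

@[simp] theorem genMap_id : genMap (𝟙 M) = LinearMap.id :=
  LinearMap.ext fun v => by
    obtain ⟨U, hU, s, rfl⟩ := exists_genGerm v
    rw [genMap_genGerm]; rfl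

theorem genMap_comp (φ : M ⟶ N) (ψ : N ⟶ P) : genMap (φ ≫ ψ) = (genMap ψ).comp (genMap φ) :=
  LinearMap.ext fun v => by
    obtain ⟨U, hU, s, rfl⟩ := exists_genGerm v
    rw [LinearMap.comp_apply, genMap_genGerm, genMap_genGerm, genMap_genGerm]; rfl

theorem genMap_comp_apply (φ : M ⟶ N) (ψ : N ⟶ P) (v : GenericStalk M) :
    genMap (φ ≫ ψ) v = genMap ψ (genMap φ v) := by rw [genMap_comp]; rfl

/-- No span is needed: germs of sections form a submodule already, because representatives restrict
to a common neighbourhood and elements of the local ring are germs of functions. -/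
theorem mem_image_iff {φ : M ⟶ N} {x : X} {v : GenericStalk N} :
    v ∈ image φ x ↔
      ∃ (U : X.Opens) (hx : x ∈ U) (s : Γ(M, U)), v = genGerm N hx (φ.app U s) := by
  refine ⟨fun hv => ?_, fun ⟨U, hx, s, h⟩ => h ▸ genGerm_mem_image φ hx s⟩
  induction hv using Submodule.span_induction with
  | mem v hv => exact hv
  | zero => exact ⟨⊤, trivial, 0, by rw [map_zero, map_zero]⟩
  | add v w _ _ hv hw =>
    obtain ⟨U, hx, s, rfl⟩ := hv
    obtain ⟨W, hx', t, rfl⟩ := hw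
    refine ⟨U ⊓ W, (show x ∈ U ⊓ W from ⟨hx, hx'⟩), M.presheaf.map (homOfLE inf_le_left).op s +
      M.presheaf.map (homOfLE inf_le_right).op t, ?_⟩
    rw [← genMap_genGerm, ← genMap_genGerm, ← genMap_genGerm, ← map_add, map_add (genGerm M _),
      genGerm_res, genGerm_res]
  | smul c v _ hv =>
    obtain ⟨U, hx, s, rfl⟩ := hv
    obtain ⟨_, a, rfl⟩ := c
    obtain ⟨W, hx', r, rfl⟩ := X.presheaf.exists_germ_eq a
    refine ⟨U ⊓ W, (show x ∈ U ⊓ W from ⟨hx, hx'⟩),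
      (X.presheaf.map (homOfLE inf_le_right : U ⊓ W ⟶ W).op r •
        M.presheaf.map (homOfLE inf_le_left : U ⊓ W ⟶ U).op s : Γ(M, U ⊓ W)), ?_⟩
    have : Nonempty W := ⟨⟨x, hx'⟩⟩
    have h1 : algebraMap (X.presheaf.stalk x) X.functionField (X.presheaf.germ W x hx' r) =
        toFunctionField hx' r := Scheme.algebraMap_germ_eq_germToFunctionField X hx' r
    rw [← genMap_genGerm, ← genMap_genGerm, genGerm_smul, toFunctionField_res, genGerm_res, map_smul]
    exact congrArg (· • genMap φ (genGerm M hx s)) h1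

/-- A compatible family of additive maps on sections induces a map on the generic stalk. -/
def genDesc {A : Type*} [AddCommGroup A]
    (f : ∀ U : X.Opens, genericPoint X ∈ U → Γ(M, U) →+ A)
    (hf : ∀ {U W : X.Opens} (i : U ⟶ W) (hU : genericPoint X ∈ U) (s : Γ(M, W)),
      f U hU (M.presheaf.map i.op s) = f W (leOfHom i hU) s) : GenericStalk M →+ A :=
  have key : ∀ {U W : X.Opens} (hU : genericPoint X ∈ U) (hW : genericPoint X ∈ W) (s : Γ(M, U))
      (t : Γ(M, W)), genGerm M hU s = genGerm M hW t → f U hU s = f W hW t := by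
    intro U W hU hW s t h
    obtain ⟨O, hO, i, j, hij⟩ := exists_of_genGerm_eq h
    rw [← hf i hO, hij, hf j hO]
  AddMonoidHom.mk' (fun v => f _ (exists_genGerm v).choose_spec.choose
      (exists_genGerm v).choose_spec.choose_spec.choose) fun v w => by
    obtain ⟨U, hU, s, hs⟩ := exists_genGerm v
    obtain ⟨W, hW, t, ht⟩ := exists_genGerm w
    have hUW : genericPoint X ∈ U ⊓ W := ⟨hU, hW⟩
    have hs' := (exists_genGerm v).choose_spec.choose_spec.choose_spec
    have ht' := (exists_genGerm w).choose_spec.choose_spec.choose_spec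
    have hst := (exists_genGerm (v + w)).choose_spec.choose_spec.choose_spec
    rw [key _ hU _ s (hs'.trans hs.symm), key _ hW _ t (ht'.trans ht.symm),
      key _ hUW _ (M.presheaf.map (homOfLE inf_le_left).op s +
        M.presheaf.map (homOfLE inf_le_right).op t), map_add, hf, hf]
    rw [hst, map_add, genGerm_res, genGerm_res, hs, ht]

theorem genDesc_genGerm {A : Type*} [AddCommGroup A]
    (f : ∀ U : X.Opens, genericPoint X ∈ U → Γ(M, U) →+ A)
    (hf : ∀ {U W : X.Opens} (i : U ⟶ W) (hU : genericPoint X ∈ U) (s : Γ(M, W)),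
      f U hU (M.presheaf.map i.op s) = f W (leOfHom i hU) s)
    {U : X.Opens} {x : X} (hx : x ∈ U) (s : Γ(M, U)) :
    genDesc f hf (genGerm M hx s) = f U (genericPoint_mem hx) s := by
  have h := (exists_genGerm (genGerm M hx s)).choose_spec.choose_spec.choose_spec
  obtain ⟨O, hO, i, j, hij⟩ := exists_of_genGerm_eq h
  change f _ _ _ = _
  rw [← hf i hO, hij, hf j hO]

/-- The stalks of a sheaf of modules, as submodules of the generic stalk. -/
abbrev lattice (M : X.Modules) : RatSubsheaf M := image (𝟙 M)

theorem mem_lattice_iff {x : X} {v : GenericStalk M} :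
    v ∈ lattice M x ↔ ∃ (U : X.Opens) (hx : x ∈ U) (s : Γ(M, U)), v = genGerm M hx s :=
  mem_image_iff

theorem genGerm_mem_lattice {U : X.Opens} {x : X} (hx : x ∈ U) (s : Γ(M, U)) :
    genGerm M hx s ∈ lattice M x := genGerm_mem_image (𝟙 M) hx s

theorem mem_image_iff_exists_lattice {φ : M ⟶ N} {x : X} {v : GenericStalk N} :
    v ∈ image φ x ↔ ∃ w ∈ lattice M x, genMap φ w = v := by
  rw [mem_image_iff]
  constructor
  · rintro ⟨U, hx, s, rfl⟩
    exact ⟨_, genGerm_mem_lattice hx s, genMap_genGerm _ _ _⟩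
  · rintro ⟨w, hw, rfl⟩
    obtain ⟨U, hx, s, rfl⟩ := mem_lattice_iff.1 hw
    exact ⟨U, hx, s, genMap_genGerm _ _ _⟩

theorem image_eq_map (φ : M ⟶ N) (x : X) :
    image φ x = (lattice M x).map ((genMap φ).restrictScalars (localRing x)) :=
  Submodule.ext fun _ => mem_image_iff_exists_lattice

theorem genMap_mem_image (φ : M ⟶ N) {x : X} {v : GenericStalk M} (hv : v ∈ lattice M x) :
    genMap φ v ∈ image φ x := mem_image_iff_exists_lattice.2 ⟨v, hv, rfl⟩

theorem image_le_lattice (φ : M ⟶ N) : image φ ≤ lattice N := fun x v hv => by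
  obtain ⟨U, hx, s, rfl⟩ := mem_image_iff.1 hv
  exact genGerm_mem_lattice hx _

theorem exists_mem_lattice (v : GenericStalk M) : v ∈ lattice M (genericPoint X) := by
  obtain ⟨U, hU, s, rfl⟩ := exists_genGerm v
  exact genGerm_mem_lattice hU s

/-- A sheaf of modules on an integral scheme is torsion-free if its sections are determined by
their germs at the generic point. -/
def IsTorsionFree (M : X.Modules) : Prop :=
  ∀ (U : X.Opens) (x : X) (hx : x ∈ U), Function.Injective (genGerm M hx)

theorem IsTorsionFree.hom_ext (hN : IsTorsionFree N) {φ ψ : M ⟶ N} (h : genMap φ = genMap ψ) :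
    φ = ψ := by
  refine Scheme.Modules.hom_ext _ _ fun U => ?_
  ext s
  rcases (U : Set X).eq_empty_or_nonempty with hU | ⟨x, hx⟩
  · exact TopCat.Presheaf.section_ext ⟨N.presheaf, N.isSheaf⟩ U _ _ fun x hx =>
      absurd (show x ∈ (U : Set X) from hx) (hU ▸ Set.notMem_empty x)
  · apply hN U x hx
    rw [← genMap_genGerm, ← genMap_genGerm, h]

omit [IsIntegral X] in
theorem app_injective (φ : M ⟶ N) [Mono φ] (U : X.Opens) : Function.Injective (φ.app U) := by
  have h1 : Mono ((Scheme.Modules.toPresheaf X).map φ) := inferInstance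
  have h2 := (NatTrans.mono_iff_mono_app _).1 h1 (.op U)
  exact (AddCommGrpCat.mono_iff_injective _).1 h2

theorem genMap_injective (φ : M ⟶ N) [Mono φ] : Function.Injective (genMap φ) :=
  TopCat.Presheaf.stalkFunctor_map_injective_of_app_injective (f := φ.mapPresheaf) (app_injective φ)
    (genericPoint X)

theorem IsTorsionFree.mono_of_injective (hM : IsTorsionFree M) {φ : M ⟶ N}
    (h : Function.Injective (genMap φ)) : Mono φ := ⟨fun a b hab => hM.hom_ext <|
  LinearMap.ext fun v => h (by rw [← genMap_comp_apply, hab, genMap_comp_apply])⟩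

end GenericMap

/-! ### Sheaves defined by lattices, and their morphisms -/

section ToModules

variable {X : Scheme.{u}} [IsIntegral X] {M M' : X.Modules}

/-- Open subsets of an irreducible space are connected, so a section is a single rational section.
-/
theorem sections_eq {N : RatSubsheaf M} {U : X.Opens} (s : sections N U) (x y : U) :
    s.1 x = s.1 y := by
  have h : PreconnectedSpace U := by
    have := (PreirreducibleSpace.isPreirreducible_univ (X := X)).open_subset U.2 (Set.subset_univ _)
    exact Subtype.preconnectedSpace this.isPreconnected
  exact @IsLocallyConstant.apply_eq_of_preconnectedSpace _ _ _ h _ s.2.1 x y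

/-- The constant section with a given value. -/
def constSection (N : RatSubsheaf M) (U : X.Opens) (v : GenericStalk M) (hv : ∀ x ∈ U, v ∈ N x) :
    Γ(toModules N, U) :=
  (⟨fun _ => v, IsLocallyConstant.const v, fun x => hv x x.2⟩ : sections N U)

/-- The value of a section of `N` at a point. -/
def value (N : RatSubsheaf M) {U : X.Opens} {x : X} (hx : x ∈ U) :
    Γ(toModules N, U) →+ GenericStalk M where
  toFun s := (show sections N U from s).1 ⟨x, hx⟩
  map_zero' := rfl
  map_add' _ _ := rfl

theorem value_mem (N : RatSubsheaf M) {U : X.Opens} {x : X} (hx : x ∈ U)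
    (s : Γ(toModules N, U)) : value N hx s ∈ N x :=
  (show sections N U from s).2.2 ⟨x, hx⟩

theorem value_eq (N : RatSubsheaf M) {U : X.Opens} {x y : X} (hx : x ∈ U) (hy : y ∈ U)
    (s : Γ(toModules N, U)) : value N hx s = value N hy s :=
  sections_eq (show sections N U from s) _ _

theorem value_res (N : RatSubsheaf M) {U W : X.Opens} {x : X} (hx : x ∈ U) (i : U ⟶ W)
    (s : Γ(toModules N, W)) :
    value N hx ((toModules N).presheaf.map i.op s) = value N (leOfHom i hx) s := rfl

theorem toModules_ext {N : RatSubsheaf M} {U : X.Opens} {s t : Γ(toModules N, U)}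
    (h : ∀ (x : X) (hx : x ∈ U), value N hx s = value N hx t) : s = t :=
  Subtype.ext (funext fun x => h x.1 x.2)

theorem value_injective (N : RatSubsheaf M) {U : X.Opens} {x : X} (hx : x ∈ U) :
    Function.Injective (value N hx) := fun s t h => toModules_ext fun y hy => by
  rw [value_eq N hy hx, h, value_eq N hx hy]

/-- Evaluation of rational sections. -/
def evalGen (N : RatSubsheaf M) : GenericStalk (toModules N) →ₗ[X.functionField] GenericStalk M :=
  { genDesc (fun _ hU => value N hU) (fun i hU s => value_res N hU i s) with
    map_smul' := fun c v => by
      obtain ⟨U, hU, r, s, rfl, rfl⟩ := exists_toFunctionField_genGerm c v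
      change genDesc _ _ _ = _ • genDesc _ _ _
      rw [← genGerm_smul, genDesc_genGerm _ _ hU, genDesc_genGerm _ _ hU]
      rfl }

theorem evalGen_genGerm (N : RatSubsheaf M) {U : X.Opens} {x : X} (hx : x ∈ U)
    (s : Γ(toModules N, U)) : evalGen N (genGerm _ hx s) = value N hx s :=
  (genDesc_genGerm (fun _ hU => value N hU) (fun i hU s => value_res N hU i s) hx s).trans
    (value_eq N _ hx s)

theorem isTorsionFree_toModules (N : RatSubsheaf M) : IsTorsionFree (toModules N) :=
  fun U x hx s t h => value_injective N hx <| by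
    rw [← evalGen_genGerm, ← evalGen_genGerm, h]

theorem evalGen_injective (N : RatSubsheaf M) : Function.Injective (evalGen N) := by
  rw [injective_iff_map_eq_zero]
  intro v hv
  obtain ⟨U, hU, s, rfl⟩ := exists_genGerm v
  rw [evalGen_genGerm] at hv
  rw [value_injective N hU (hv.trans (map_zero _).symm), map_zero]

theorem evalGen_mem (N : RatSubsheaf M) {x : X} {v : GenericStalk (toModules N)}
    (hv : v ∈ lattice (toModules N) x) : evalGen N v ∈ N x := by
  obtain ⟨U, hx, s, rfl⟩ := mem_lattice_iff.1 hv
  rw [evalGen_genGerm]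
  exact value_mem N hx s

/-- A rational section that lies in `N` near a point comes from a section near that point. -/
theorem exists_evalGen_eq (N : RatSubsheaf M) {U : X.Opens} {v : GenericStalk M}
    (hv : ∀ x ∈ U, v ∈ N x) {x : X} (hx : x ∈ U) :
    ∃ w ∈ lattice (toModules N) x, evalGen N w = v :=
  ⟨_, genGerm_mem_lattice hx (constSection N U v hv), evalGen_genGerm _ _ _⟩

/-- A linear map between generic stalks that sends a sheaf into `N` induces a morphism. -/
def homOfGen (N : RatSubsheaf M') (T : GenericStalk M →ₗ[X.functionField] GenericStalk M')
    (hT : ∀ x, ∀ v ∈ lattice M x, T v ∈ N x) : M ⟶ toModules N :=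
  SheafOfModules.Hom.mk (PresheafOfModules.homMk
    (M₁ := M.val) (M₂ := (toModules N).val)
    { app := fun U => AddCommGrpCat.ofHom
        { toFun := fun s => (⟨fun x => T (genGerm M x.2 s), (IsLocallyConstant.iff_exists_open _).2
              fun x => ⟨Set.univ, isOpen_univ, trivial, fun _ _ => rfl⟩,
            fun x => hT x _ (genGerm_mem_lattice x.2 s)⟩ : sections N U.unop)
          map_zero' := Subtype.ext (funext fun x => by
            change T (genGerm M x.2 0) = 0
            rw [map_zero, map_zero])
          map_add' := fun s t => Subtype.ext (funext fun x => by
            change T (genGerm M x.2 (s + t)) = T (genGerm M x.2 s) + T (genGerm M x.2 t)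
            exact (congrArg T (map_add (genGerm M x.2) s t)).trans (map_add T _ _)) }
      naturality := fun U V i =>
        AddCommGrpCat.hom_ext (AddMonoidHom.ext fun s => Subtype.ext (funext fun x =>
          congrArg T (genGerm_res M x.2 i.unop s))) }
    (fun U r s => Subtype.ext (funext fun x => by
      exact (congrArg T (genGerm_smul M x.2 r s)).trans (map_smul T _ _))))

theorem value_homOfGen (N : RatSubsheaf M') (T : GenericStalk M →ₗ[X.functionField] GenericStalk M')
    (hT : ∀ x, ∀ v ∈ lattice M x, T v ∈ N x) {U : X.Opens} {x : X} (hx : x ∈ U) (s : Γ(M, U)) :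
    value N hx ((homOfGen N T hT).app U s) = T (genGerm M hx s) := rfl

theorem evalGen_genMap_homOfGen (N : RatSubsheaf M')
    (T : GenericStalk M →ₗ[X.functionField] GenericStalk M')
    (hT : ∀ x, ∀ v ∈ lattice M x, T v ∈ N x) (v : GenericStalk M) :
    evalGen N (genMap (homOfGen N T hT) v) = T v := by
  obtain ⟨U, hU, s, rfl⟩ := exists_genGerm v
  rw [genMap_genGerm, evalGen_genGerm, value_homOfGen]

/-- The morphism of sheaves of sections induced by a linear map of generic stalks. -/
def toModulesMap (N : RatSubsheaf M) (N' : RatSubsheaf M')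
    (T : GenericStalk M →ₗ[X.functionField] GenericStalk M')
    (hT : ∀ x, ∀ v ∈ N x, T v ∈ N' x) : toModules N ⟶ toModules N' :=
  homOfGen N' (T.comp (evalGen N)) fun x _ hv => hT x _ (evalGen_mem N hv)

theorem evalGen_genMap_toModulesMap (N : RatSubsheaf M) (N' : RatSubsheaf M')
    (T : GenericStalk M →ₗ[X.functionField] GenericStalk M')
    (hT : ∀ x, ∀ v ∈ N x, T v ∈ N' x) (v : GenericStalk (toModules N)) :
    evalGen N' (genMap (toModulesMap N N' T hT) v) = T (evalGen N v) :=
  evalGen_genMap_homOfGen _ _ _ _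

theorem value_toModulesMap (N : RatSubsheaf M) (N' : RatSubsheaf M')
    (T : GenericStalk M →ₗ[X.functionField] GenericStalk M')
    (hT : ∀ x, ∀ v ∈ N x, T v ∈ N' x) {U : X.Opens} {x : X} (hx : x ∈ U)
    (s : Γ(toModules N, U)) :
    value N' hx ((toModulesMap N N' T hT).app U s) = T (value N hx s) :=
  (value_homOfGen _ _ _ hx s).trans (congrArg T (evalGen_genGerm N hx s))

theorem evalGen_genMap_lift {F : X.Modules} (N : RatSubsheaf M) (φ : F ⟶ M) (h : image φ ≤ N)
    (v : GenericStalk F) : evalGen N (genMap (lift N φ h) v) = genMap φ v := by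
  obtain ⟨U, hU, s, rfl⟩ := exists_genGerm v
  rw [genMap_genGerm, evalGen_genGerm, genMap_genGerm]
  rfl

/-- Morphisms into a sheaf of sections are determined by the induced map of rational sections. -/
theorem toModules_hom_ext {N : RatSubsheaf M'} {φ ψ : M ⟶ toModules N}
    (h : ∀ v, evalGen N (genMap φ v) = evalGen N (genMap ψ v)) : φ = ψ :=
  (isTorsionFree_toModules N).hom_ext (LinearMap.ext fun v => evalGen_injective N (h v))

/-- A torsion-free sheaf is the sheaf of sections of its lattice. -/
theorem IsTorsionFree.isIso_homOfGen (hM : IsTorsionFree M) :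
    IsIso (homOfGen (M := M) (lattice M) LinearMap.id fun _ _ hv => hv) := by
  set φ := homOfGen (M := M) (lattice M) LinearMap.id fun _ _ hv => hv
  have hinj : ∀ U, Function.Injective (φ.app U) := by
    have hm : Mono φ := hM.mono_of_injective fun v w h => by
      have := congrArg (evalGen _) h
      rwa [evalGen_genMap_homOfGen, evalGen_genMap_homOfGen] at this
    exact app_injective φ
  rw [Scheme.Modules.Hom.isIso_iff_isIso_app]
  intro U
  rw [ConcreteCategory.isIso_iff_bijective]
  refine ⟨hinj U, ?_⟩
  -- Once the map is injective, surjectivity is local; near a point, the value of a section of the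
  -- lattice sheaf is by definition the germ of a section of `M`.
  refine TopCat.Presheaf.app_surjective_of_injective_of_locally_surjective
    (F := ⟨M.presheaf, M.isSheaf⟩) (G := ⟨(toModules (lattice M)).presheaf, Scheme.Modules.isSheaf _⟩)
    ⟨φ.mapPresheaf⟩ U (fun x _ => TopCat.Presheaf.stalkFunctor_map_injective_of_app_injective hinj _)
    fun t x hx => ?_
  obtain ⟨W, hW, s, hs⟩ := mem_lattice_iff.1 (value_mem (lattice M) hx t)
  refine ⟨U ⊓ W, ⟨hx, hW⟩, homOfLE inf_le_left, M.presheaf.map (homOfLE inf_le_right).op s, ?_⟩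
  refine toModules_ext fun y hy => ?_
  refine (value_homOfGen (lattice M) LinearMap.id (fun _ _ hv => hv) hy _).trans ?_
  rw [LinearMap.id_apply, genGerm_res]
  exact hs.symm.trans (value_eq _ hx _ t)

/-- A linear map between generic stalks that maps one lattice to the other induces a morphism. -/
theorem IsTorsionFree.exists_hom (hM' : IsTorsionFree M')
    (T : GenericStalk M →ₗ[X.functionField] GenericStalk M')
    (hT : ∀ x, ∀ v ∈ lattice M x, T v ∈ lattice M' x) : ∃ φ : M ⟶ M', genMap φ = T := by
  have := hM'.isIso_homOfGen
  refine ⟨homOfGen (lattice M') T hT ≫ inv (homOfGen (M := M') (lattice M') LinearMap.id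
    fun _ _ hv => hv), LinearMap.ext fun v => ?_⟩
  have h1 := evalGen_genMap_homOfGen (M := M') (lattice M') LinearMap.id (fun _ _ hv => hv)
    (genMap (homOfGen (lattice M') T hT ≫ inv (homOfGen (M := M') (lattice M') LinearMap.id
      fun _ _ hv => hv)) v)
  rw [← genMap_comp_apply, Category.assoc, IsIso.inv_hom_id, Category.comp_id,
    evalGen_genMap_homOfGen] at h1
  exact h1.symm

/-- A linear isomorphism of generic stalks that identifies the lattices is induced by an
isomorphism. -/
theorem exists_iso (hM : IsTorsionFree M) (hM' : IsTorsionFree M')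
    (T : GenericStalk M ≃ₗ[X.functionField] GenericStalk M')
    (hT : ∀ x v, T v ∈ lattice M' x ↔ v ∈ lattice M x) :
    ∃ φ : M ≅ M', genMap φ.hom = T.toLinearMap := by
  obtain ⟨φ, hφ⟩ := hM'.exists_hom T.toLinearMap fun x v hv => (hT x v).2 hv
  obtain ⟨ψ, hψ⟩ := hM.exists_hom T.symm.toLinearMap fun x v hv => by
    rw [← hT]; simpa using hv
  refine ⟨⟨φ, ψ, hM.hom_ext ?_, hM'.hom_ext ?_⟩, hφ⟩
  · rw [genMap_comp, hφ, hψ, genMap_id]; ext; simp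
  · rw [genMap_comp, hφ, hψ, genMap_id]; ext; simp

end ToModules

/-! ### Sections of free sheaves -/

section Free

variable {S : Scheme.{u}} (I : Type u)

/-- The structure sheaf as a module over itself. -/
abbrev unitModule (S : Scheme.{u}) : S.Modules := SheafOfModules.unit S.ringCatSheaf

/-- The free sheaf of modules on a type. -/
abbrev freeModule (S : Scheme.{u}) (I : Type u) : S.Modules :=
  SheafOfModules.free (R := S.ringCatSheaf) I

variable {I}

/-- The inclusions of the summands of a free sheaf. -/
def freeIncl (i : I) : unitModule S ⟶ freeModule S I := SheafOfModules.ιFree (R := S.ringCatSheaf) i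

theorem free_hom_ext {P : S.Modules} {φ ψ : freeModule S I ⟶ P}
    (h : ∀ i, freeIncl i ≫ φ = freeIncl i ≫ ψ) : φ = ψ :=
  Limits.Cofan.IsColimit.hom_ext (SheafOfModules.isColimitFreeCofan (R := S.ringCatSheaf) I) _ _ h

/-- The projections of a free sheaf to its summands. -/
def freeProj [DecidableEq I] (i : I) : freeModule S I ⟶ unitModule S :=
  Limits.Cofan.IsColimit.desc (SheafOfModules.isColimitFreeCofan (R := S.ringCatSheaf) I)
    (fun j => if j = i then 𝟙 (unitModule S) else 0)

theorem freeIncl_freeProj [DecidableEq I] (i j : I) :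
    (freeIncl j : unitModule S ⟶ freeModule S I) ≫ freeProj i =
      if j = i then 𝟙 (unitModule S) else 0 :=
  Limits.Cofan.IsColimit.fac (SheafOfModules.isColimitFreeCofan (R := S.ringCatSheaf) I) _ _

theorem sum_freeProj_freeIncl [DecidableEq I] [Fintype I] :
    ∑ i, (freeProj i : freeModule S I ⟶ unitModule S) ≫ freeIncl i = 𝟙 (freeModule S I) :=
  free_hom_ext fun j => by
    rw [Preadditive.comp_sum, Category.comp_id, Finset.sum_eq_single j]
    · rw [← Category.assoc, freeIncl_freeProj, if_pos rfl, Category.id_comp]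
    · intro i _ hij
      rw [← Category.assoc, freeIncl_freeProj, if_neg (Ne.symm hij), Limits.zero_comp]
    · simp

/-- The unit section. -/
def unitSection (W : S.Opens) : Γ(unitModule S, W) := (1 : Γ(S, W))

/-- A section of the structure sheaf. -/
def ofUnit {W : S.Opens} (s : Γ(unitModule S, W)) : Γ(S, W) := s

theorem ofUnit_smul_unitSection {W : S.Opens} (s : Γ(unitModule S, W)) :
    ofUnit s • unitSection W = s := mul_one (ofUnit s)

theorem ofUnit_smul {W : S.Opens} (r : Γ(S, W)) :
    ofUnit (r • unitSection W) = r := mul_one r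

theorem unitSection_res {W W' : S.Opens} (i : W ⟶ W') :
    (unitModule S).presheaf.map i.op (unitSection W') = unitSection W :=
  map_one (S.presheaf.map i.op).hom

theorem sum_app {M N : S.Modules} {J : Type*} (s : Finset J) (φ : J → (M ⟶ N)) (W : S.Opens)
    (x : Γ(M, W)) : (∑ j ∈ s, φ j).app W x = ∑ j ∈ s, (φ j).app W x := by
  classical
  induction s using Finset.induction_on with
  | empty => simp
  | insert a s ha ih =>
    rw [Finset.sum_insert ha, Finset.sum_insert ha, Scheme.Modules.Hom.add_app, ← ih]; rfl

/-- The basis sections of a free sheaf. -/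
def freeBasisSection (i : I) (W : S.Opens) : Γ(freeModule S I, W) :=
  (freeIncl i).app W (unitSection W)

/-- Restriction of sections of a module. -/
abbrev res (M : S.Modules) {U W : S.Opens} (h : W ≤ U) (s : Γ(M, U)) : Γ(M, W) :=
  M.presheaf.map (homOfLE h).op s

theorem res_res (M : S.Modules) {U V W : S.Opens} (h : V ≤ U) (h' : W ≤ V) (s : Γ(M, U)) :
    res M h' (res M h s) = res M (h'.trans h) s := by
  rw [res, res, ← ConcreteCategory.comp_apply, ← M.presheaf.map_comp]; rfl

theorem app_res {M N : S.Modules} (φ : M ⟶ N) {U W : S.Opens} (h : W ≤ U) (s : Γ(M, U)) :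
    φ.app W (res M h s) = res N h (φ.app U s) :=
  ConcreteCategory.congr_hom (φ.mapPresheaf.naturality (homOfLE h).op) s

theorem freeBasisSection_res (i : I) {U W : S.Opens} (h : W ≤ U) :
    res (freeModule S I) h (freeBasisSection i U) = freeBasisSection i W := by
  rw [freeBasisSection, ← app_res]
  exact congrArg _ (unitSection_res (homOfLE h))

/-- The free sheaf is given as a coproduct; for a finite index type it is a biproduct, whose
projections read off the coefficients. -/
theorem bijective_free [Fintype I] (W : S.Opens) :
    Function.Bijective fun c : I → Γ(S, W) =>
      ∑ i, c i • (freeBasisSection i W : Γ(freeModule S I, W)) := by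
  classical
  constructor
  · intro c d h
    funext j
    have h1 : ∀ c : I → Γ(S, W), (freeProj j).app W (∑ i, c i •
        (freeBasisSection i W : Γ(freeModule S I, W))) = c j • unitSection W := by
      intro c
      rw [map_sum, Finset.sum_eq_single j]
      · rw [Scheme.Modules.Hom.app_smul, freeBasisSection, ← ConcreteCategory.comp_apply,
          ← Scheme.Modules.Hom.comp_app, freeIncl_freeProj, if_pos rfl]
        rfl
      · intro i _ hij
        rw [Scheme.Modules.Hom.app_smul, freeBasisSection, ← ConcreteCategory.comp_apply,
          ← Scheme.Modules.Hom.comp_app, freeIncl_freeProj, if_neg hij]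
        change c i • (0 : Γ(unitModule S, W)) = 0
        exact mul_zero (c i)
      · simp
    have h2 := congrArg (fun s => ofUnit ((freeProj j).app W s)) h
    dsimp only at h2
    rwa [h1, h1, ofUnit_smul, ofUnit_smul] at h2
  · intro s
    refine ⟨fun i => ofUnit ((freeProj i).app W s), ?_⟩
    have h := congrArg (fun φ => Scheme.Modules.Hom.app φ W s)
      (sum_freeProj_freeIncl (S := S) (I := I))
    dsimp only at h
    rw [sum_app] at h
    refine Eq.trans (Finset.sum_congr rfl fun i _ => ?_) h
    rw [freeBasisSection, ← Scheme.Modules.Hom.app_smul, ofUnit_smul_unitSection]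
    rfl

end Free

/-! ### Frames: local freeness in terms of sections -/

section Frame

variable {X : Scheme.{u}}

/-- Sections over `U` that form a basis of the sections over every smaller open set. -/
def IsFrame (M : X.Modules) (U : X.Opens) {I : Type*} [Fintype I] (g : I → Γ(M, U)) : Prop :=
  ∀ (W : X.Opens) (h : W ≤ U),
    Function.Bijective fun c : I → Γ(X, W) => ∑ i, c i • res M h (g i)

theorem restrict_smul (M : X.Modules) {U : X.Opens} {W : (U : Scheme.{u}).Opens} (r : Γ(U, W))
    (s : Γ(M.restrict U.ι, W)) :
    r • s = ((show Γ(X, U.ι ''ᵁ W) from r) • (show Γ(M, U.ι ''ᵁ W) from s) :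
      Γ(M, U.ι ''ᵁ W)) := by
  have h : r • s = ((U.ι.appIso W).inv.hom r • (show Γ(M, U.ι ''ᵁ W) from s) :
      Γ(M, U.ι ''ᵁ W)) := rfl
  rw [h, Scheme.Opens.ι_appIso]
  rfl

theorem ι_image_le {U : X.Opens} (W : (U : Scheme.{u}).Opens) : U.ι ''ᵁ W ≤ U := by
  rintro _ ⟨x, _, rfl⟩
  exact x.2

/-- A trivialisation over `U` carries the standard sections to a frame, since the open sets of the
subscheme are the open sets of `X` inside `U`. -/
theorem IsLocallyFreeOfRank.exists_isFrame {M : X.Modules} {r : ℕ} (hM : IsLocallyFreeOfRank M r)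
    (x : X) : ∃ U : X.Opens, x ∈ U ∧ ∃ g : ULift.{u} (Fin r) → Γ(M, U), IsFrame M U g := by
  obtain ⟨U, hx, ⟨e⟩⟩ := hM x
  let e' : M.restrict U.ι ≅ freeModule (U : Scheme.{u}) (ULift.{u} (Fin r)) := e
  have hU : U.ι ''ᵁ ⊤ = U := by simp
  let g₀ : ULift.{u} (Fin r) → Γ(M, U.ι ''ᵁ ⊤) := fun i =>
    e'.inv.app ⊤ (freeBasisSection i ⊤)
  refine ⟨U, hx, fun i => res M hU.ge (g₀ i), fun W h => ?_⟩
  obtain ⟨W', rfl⟩ : ∃ W' : (U : Scheme.{u}).Opens, U.ι ''ᵁ W' = W := 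
    ⟨U.ι ⁻¹ᵁ W, by rw [Scheme.Hom.image_preimage_eq_opensRange_inf]; simpa using h⟩
  have h1 : Function.Bijective (e'.inv.app W') :=
    (ConcreteCategory.isIso_iff_bijective (e'.inv.app W')).1 inferInstance
  convert! h1.comp (bijective_free (S := U) W') using 1
  funext c
  refine Eq.trans ?_ (map_sum (e'.inv.app W').hom _ _).symm
  refine Finset.sum_congr rfl fun i _ => ?_
  refine Eq.trans ?_ (Scheme.Modules.Hom.app_smul e'.inv (c i) (freeBasisSection i W')).symm
  have h2 : e'.inv.app W' (freeBasisSection i W') = res M h (res M hU.ge (g₀ i)) := by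
    rw [res_res, ← freeBasisSection_res i (le_top : W' ≤ ⊤), app_res]
    rfl
  rw [h2]
  exact (restrict_smul M (c i) _).symm

/-- A module with a frame on `U` is free on `U`. -/
theorem IsFrame.nonempty_iso {M : X.Modules} {U : X.Opens} {I : Type u} [Fintype I]
    {g : I → Γ(M, U)} (hg : IsFrame M U g) :
    Nonempty (M.restrict U.ι ≅ freeModule (U : Scheme.{u}) I) := by
  let P : (U : Scheme.{u}).Modules := M.restrict U.ι
  let σ : I → SheafOfModules.sections (R := (U : Scheme.{u}).ringCatSheaf) P := fun i =>
    PresheafOfModules.sectionsMk (M := P.val)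
      (fun W => (show Γ(P, W.unop) from res M (ι_image_le W.unop) (g i)))
      fun V W f => res_res M (ι_image_le V.unop)
        (Scheme.Hom.image_mono U.ι (leOfHom f.unop)) (g i)
  let φ : freeModule (U : Scheme.{u}) I ⟶ P := Limits.Cofan.IsColimit.desc
    (SheafOfModules.isColimitFreeCofan (R := (U : Scheme.{u}).ringCatSheaf) I)
    (fun i => (SheafOfModules.unitHomEquiv (R := (U : Scheme.{u}).ringCatSheaf) P).symm (σ i))
  have hφ : ∀ i W, φ.app W (freeBasisSection i W) = res M (ι_image_le W) (g i) := by
    intro i W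
    have h1 : freeIncl i ≫ φ =
        (SheafOfModules.unitHomEquiv (R := (U : Scheme.{u}).ringCatSheaf) P).symm (σ i) :=
      Limits.Cofan.IsColimit.fac
        (SheafOfModules.isColimitFreeCofan (R := (U : Scheme.{u}).ringCatSheaf) I) _ _
    have h2 : φ.app W (freeBasisSection i W) = (freeIncl i ≫ φ).app W (unitSection W) := rfl
    rw [h2, h1]
    have h3 := SheafOfModules.unitHomEquiv_apply_coe (R := (U : Scheme.{u}).ringCatSheaf) P
      ((SheafOfModules.unitHomEquiv (R := (U : Scheme.{u}).ringCatSheaf) P).symm (σ i)) (.op W)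
    rw [Equiv.apply_symm_apply] at h3
    exact h3.symm
  have : IsIso φ := by
    rw [Scheme.Modules.Hom.isIso_iff_isIso_app]
    intro W
    rw [ConcreteCategory.isIso_iff_bijective]
    refine (Function.Bijective.of_comp_iff (φ.app W) (bijective_free (S := U) (I := I) W)).1 ?_
    convert! hg _ (ι_image_le W) using 1
    funext c
    refine (map_sum (φ.app W).hom _ _).trans (Finset.sum_congr rfl fun i _ => ?_)
    refine (Scheme.Modules.Hom.app_smul φ (c i) (freeBasisSection i W)).trans ?_
    rw [hφ]
    exact restrict_smul M (c i) _
  exact ⟨(asIso φ).symm⟩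

end Frame

/-! ### Frames as bases of the generic stalk -/

section

variable {X : Scheme.{u}} [IsIntegral X] {M : X.Modules}

theorem toFunctionField_injective {U : X.Opens} {x : X} (hx : x ∈ U) :
    Function.Injective (toFunctionField hx) :=
  have : Nonempty U := ⟨⟨x, hx⟩⟩
  Scheme.germToFunctionField_injective X U

theorem mem_localRing_iff {x : X} {c : X.functionField} :
    c ∈ localRing x ↔ ∃ (U : X.Opens) (hx : x ∈ U) (r : Γ(X, U)), toFunctionField hx r = c := by
  constructor
  · rintro ⟨a, rfl⟩
    obtain ⟨W, hx', r, rfl⟩ := X.presheaf.exists_germ_eq a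
    have : Nonempty W := ⟨⟨x, hx'⟩⟩
    exact ⟨W, hx', r, (Scheme.algebraMap_germ_eq_germToFunctionField X hx' r).symm⟩
  · rintro ⟨U, hx, r, rfl⟩
    exact toFunctionField_mem hx r

/-- Rational functions that are regular at every point of `U` are regular on `U`. -/
theorem exists_toFunctionField_eq {U : X.Opens} {x : X} (hx : x ∈ U) {c : X.functionField}
    (hc : ∀ y ∈ U, c ∈ localRing y) : ∃ r : Γ(X, U), toFunctionField hx r = c := by
  have h1 : ∀ y : U, ∃ (W : X.Opens) (_ : W ≤ U) (hy : y.1 ∈ W) (r : Γ(X, W)),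
      toFunctionField hy r = c := fun y => by
    obtain ⟨W, hy, r, hr⟩ := mem_localRing_iff.1 (hc y y.2)
    exact ⟨U ⊓ W, inf_le_left, ⟨y.2, hy⟩, X.presheaf.map (homOfLE inf_le_right).op r,
      (toFunctionField_res _ _ _).trans hr⟩
  choose W hWU hyW r hr using h1
  obtain ⟨s, hs, -⟩ := X.sheaf.existsUnique_gluing' W U (fun y => homOfLE (hWU y))
    (fun y hy => Opens.mem_iSup.2 ⟨⟨y, hy⟩, hyW _⟩) r (fun y z => by
      have hyz : genericPoint X ∈ W y ⊓ W z :=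
        ⟨genericPoint_mem (hyW y), genericPoint_mem (hyW z)⟩
      apply toFunctionField_injective hyz
      refine (toFunctionField_res hyz _ _).trans (Eq.trans ?_ (toFunctionField_res hyz _ _).symm)
      exact (hr y).trans (hr z).symm)
  refine ⟨s, ?_⟩
  rw [← hr ⟨x, hx⟩]
  exact (toFunctionField_res (hyW ⟨x, hx⟩) (homOfLE (hWU ⟨x, hx⟩)) s).symm.trans
    (congrArg _ (hs ⟨x, hx⟩))

/-- Finitely many rational functions are regular on a common open set. -/
theorem exists_common_toFunctionField {I : Type*} [Fintype I] (c : I → X.functionField)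
    {U : X.Opens} (hU : genericPoint X ∈ U) :
    ∃ (W : X.Opens) (_ : W ≤ U) (hW : genericPoint X ∈ W) (r : I → Γ(X, W)),
      ∀ i, toFunctionField hW (r i) = c i := by
  choose O hO r hr using fun i => exists_toFunctionField (c i)
  have hle : ∀ i, U ⊓ Finset.univ.inf O ≤ O i := fun i =>
    inf_le_right.trans (Finset.inf_le (Finset.mem_univ i))
  refine ⟨U ⊓ Finset.univ.inf O, inf_le_left, ⟨hU, ?_⟩,
    fun i => X.presheaf.map (homOfLE (hle i)).op (r i), fun i =>
    (toFunctionField_res _ _ _).trans (hr i)⟩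
  change _ ∈ (Finset.univ.inf O : X.Opens)
  rw [← SetLike.mem_coe, Opens.coe_finset_inf]
  simpa using hO

omit [IsIntegral X] in
theorem subsingleton_of_isEmpty {U : X.Opens} (hU : (U : Set X) = ∅) : Subsingleton Γ(X, U) :=
  ⟨fun s t => TopCat.Presheaf.section_ext X.sheaf U s t fun x hx =>
      absurd (show x ∈ (U : Set X) from hx) (hU ▸ Set.notMem_empty x)⟩

omit [IsIntegral X] in
theorem subsingleton_modules_of_isEmpty (M : X.Modules) {U : X.Opens} (hU : (U : Set X) = ∅) :
    Subsingleton Γ(M, U) :=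
  ⟨fun s t => TopCat.Presheaf.section_ext ⟨M.presheaf, M.isSheaf⟩ U s t fun x hx =>
      absurd (show x ∈ (U : Set X) from hx) (hU ▸ Set.notMem_empty x)⟩

variable {I : Type*} [Fintype I] {U : X.Opens} {g : I → Γ(M, U)}

theorem genGerm_sum {W : X.Opens} (h : W ≤ U) {x : X} (hx : x ∈ W) (c : I → Γ(X, W)) :
    genGerm M hx (∑ i, c i • res M h (g i)) =
      ∑ i, toFunctionField hx (c i) • genGerm M (h hx) (g i) := by
  rw [map_sum]
  refine Finset.sum_congr rfl fun i _ => ?_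
  rw [genGerm_smul, genGerm_res]

/-- The coefficients of a linear relation over `K` are regular on a common open set, and the
relation holds on a smaller one, where a frame admits only the trivial relation. -/
theorem IsFrame.linearIndependent (hg : IsFrame M U g) {x : X} (hx : x ∈ U) :
    LinearIndependent X.functionField fun i => genGerm M hx (g i) := by
  rw [Fintype.linearIndependent_iff]
  intro c hc i
  obtain ⟨W, hWU, hW, r, hr⟩ := exists_common_toFunctionField c (genericPoint_mem hx)
  have h1 : genGerm M hW (∑ i, r i • res M hWU (g i)) = genGerm M hW 0 := by
    rw [genGerm_sum, map_zero, ← hc]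
    simp only [hr]; rfl
  obtain ⟨O, hO, j, k, hjk⟩ := exists_of_genGerm_eq h1
  have h2 : (fun i => X.presheaf.map j.op (r i)) = fun _ => 0 := by
    apply (hg O ((leOfHom j).trans hWU)).1
    dsimp only
    rw [map_zero, map_sum] at hjk
    refine Eq.trans (Finset.sum_congr rfl fun i _ => ?_) (hjk.trans (by simp))
    rw [Scheme.Modules.map_smul]
    exact congrArg _ (res_res M hWU (leOfHom j) (g i)).symm
  rw [← hr i, ← toFunctionField_res hO j, congrFun h2 i, map_zero]

theorem IsFrame.exists_eq_sum (hg : IsFrame M U g) {x y : X} (hx : x ∈ U) (hy : y ∈ U)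
    {v : GenericStalk M} (hv : v ∈ lattice M y) :
    ∃ c : I → X.functionField, (∀ i, c i ∈ localRing y) ∧ v = ∑ i, c i • genGerm M hx (g i) := by
  obtain ⟨W, hW, s, rfl⟩ := mem_lattice_iff.1 hv
  obtain ⟨c, hc⟩ := (hg (U ⊓ W) inf_le_left).2 (res M inf_le_right s)
  have hyUW : y ∈ U ⊓ W := ⟨hy, hW⟩
  refine ⟨fun i => toFunctionField hyUW (c i), fun i => toFunctionField_mem _ _, ?_⟩
  have h1 := congrArg (genGerm M hyUW) hc
  rw [genGerm_res] at h1
  exact h1.symm.trans (genGerm_sum _ _ _)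

/-- A frame gives a basis of the generic stalk. -/
def IsFrame.basis (hg : IsFrame M U g) {x : X} (hx : x ∈ U) :
    Module.Basis I X.functionField (GenericStalk M) :=
  Module.Basis.mk (hg.linearIndependent hx) fun v _ => by
    obtain ⟨c, -, rfl⟩ := hg.exists_eq_sum hx (genericPoint_mem hx) (exists_mem_lattice v)
    exact Submodule.sum_mem _ fun i _ => Submodule.smul_mem _ _ (Submodule.subset_span ⟨i, rfl⟩)

theorem IsFrame.basis_apply (hg : IsFrame M U g) {x : X} (hx : x ∈ U) (i : I) :
    hg.basis hx i = genGerm M hx (g i) := Module.Basis.mk_apply _ _ _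

theorem IsFrame.lattice_eq (hg : IsFrame M U g) {x y : X} (hx : x ∈ U) (hy : y ∈ U) :
    lattice M y = Submodule.span (localRing y) (Set.range (hg.basis hx)) := by
  refine le_antisymm (fun v hv => ?_) (Submodule.span_le.2 ?_)
  · obtain ⟨c, hc, rfl⟩ := hg.exists_eq_sum hx hy hv
    refine Submodule.sum_mem _ fun i _ => smul_mem_of_mem (hc i) (Submodule.subset_span ⟨i, ?_⟩)
    exact hg.basis_apply hx i
  · rintro _ ⟨i, rfl⟩
    rw [hg.basis_apply]
    exact genGerm_mem_lattice hy (g i)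

theorem IsFrame.eq_zero (hg : IsFrame M U g) {W : X.Opens} (h : W ≤ U) {x : X} (hx : x ∈ W)
    {s : Γ(M, W)} (hs : genGerm M hx s = 0) : s = 0 := by
  obtain ⟨c, rfl⟩ := (hg W h).2 s
  rw [genGerm_sum] at hs
  have h1 := Fintype.linearIndependent_iff.1 (hg.linearIndependent (h hx)) _ hs
  refine Finset.sum_eq_zero fun i _ => ?_
  rw [toFunctionField_injective hx ((h1 i).trans (map_zero _).symm), zero_smul]

/-- A module that has frames near every point is torsion-free. -/
theorem isTorsionFree_of_isFrame
    (h : ∀ x : X, ∃ U : X.Opens, x ∈ U ∧ ∃ (I : Type u) (_ : Fintype I) (g : I → Γ(M, U)),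
      IsFrame M U g) : IsTorsionFree M := by
  intro W x hx
  rw [injective_iff_map_eq_zero]
  intro s hs
  choose U hyU I hI g hg using h
  refine TopCat.Sheaf.eq_of_locally_eq' ⟨M.presheaf, M.isSheaf⟩ (fun y : W => W ⊓ U y.1) W
    (fun y => homOfLE inf_le_left) (fun y hy => Opens.mem_iSup.2 ⟨⟨y, hy⟩, hy, hyU y⟩) s 0 fun y => ?_
  rw [map_zero]
  refine (hg y.1).eq_zero inf_le_right (x := y.1) ⟨y.2, hyU y.1⟩ ?_
  exact (genGerm_res M _ _ s).trans hs

theorem IsLocallyFreeOfRank.isTorsionFree {r : ℕ} (hM : IsLocallyFreeOfRank M r) :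
    IsTorsionFree M := isTorsionFree_of_isFrame fun x => by
  obtain ⟨U, hx, g, hg⟩ := hM.exists_isFrame x
  exact ⟨U, hx, _, inferInstance, g, hg⟩

/-- A module is locally free if its stalks are locally spanned by a basis of the generic stalk. -/
structure IsLocalBasis (N : RatSubsheaf M) (U : X.Opens) {I : Type*}
    (b : Module.Basis I X.functionField (GenericStalk M)) : Prop where
  eq_span : ∀ y ∈ U, N y = Submodule.span (localRing y) (Set.range b)

theorem IsLocallyFreeOfRank.exists_isLocalBasis {r : ℕ} (hM : IsLocallyFreeOfRank M r) (x : X) :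
    ∃ U : X.Opens, x ∈ U ∧ ∃ b : Module.Basis (ULift.{u} (Fin r)) X.functionField (GenericStalk M),
      IsLocalBasis (lattice M) U b := by
  obtain ⟨U, hx, g, hg⟩ := hM.exists_isFrame x
  exact ⟨U, hx, hg.basis hx, ⟨fun y hy => hg.lattice_eq hx hy⟩⟩

/-- A section over `W` is one rational section; its coordinates are regular at every point of `W`,
hence are functions on `W`. -/
theorem IsLocalBasis.isFrame {N : RatSubsheaf M} {b : Module.Basis I X.functionField (GenericStalk M)}
    (hb : IsLocalBasis N U b) :
    IsFrame (toModules N) U (fun i => constSection N U (b i) fun y hy => by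
      rw [hb.eq_span y hy]; exact Submodule.subset_span ⟨i, rfl⟩) := by
  intro W h
  have hval : ∀ {y : X} (hy : y ∈ W) (c : I → Γ(X, W)), value N hy (∑ i, c i • res _ h
      (constSection N U (b i) fun y hy => by
        rw [hb.eq_span y hy]; exact Submodule.subset_span ⟨i, rfl⟩)) =
      ∑ i, toFunctionField hy (c i) • b i := fun hy c => by
    rw [map_sum]; rfl
  rcases (W : Set X).eq_empty_or_nonempty with hW | ⟨x, hx⟩
  · have := subsingleton_of_isEmpty hW
    have := subsingleton_modules_of_isEmpty (toModules N) hW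
    exact ⟨fun _ _ _ => Subsingleton.elim _ _, fun s => ⟨0, Subsingleton.elim _ _⟩⟩
  constructor
  · intro c d hcd
    have h1 := congrArg (value N hx) hcd
    dsimp only at h1
    rw [hval hx, hval hx] at h1
    funext i
    apply toFunctionField_injective hx
    rw [← b.equivFun_symm_apply, ← b.equivFun_symm_apply] at h1
    exact congrFun (b.equivFun.symm.injective h1) i
  · intro s
    have h1 : ∀ i, ∃ r : Γ(X, W), toFunctionField hx r = b.repr (value N hx s) i := fun i => by
      refine exists_toFunctionField_eq hx fun y hy => ?_
      have h2 := value_mem N hy s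
      rw [value_eq N hy hx, hb.eq_span y (h hy)] at h2
      have h3 : value N hx s ∈ diag (localRing y) b fun _ => 1 := by
        rw [diag]; simpa using h2
      simpa using mem_diag_iff.1 h3 i
    choose c hc using h1
    refine ⟨c, value_injective N hx ?_⟩
    refine (hval hx c).trans ?_
    simp only [hc]
    exact b.sum_repr _

theorem isLocallyFreeOfRank_toModules {N : RatSubsheaf M} {r : ℕ}
    (h : ∀ x : X, ∃ U : X.Opens, x ∈ U ∧
      ∃ b : Module.Basis (Fin r) X.functionField (GenericStalk M), IsLocalBasis N U b) :
    IsLocallyFreeOfRank (toModules N) r := fun x => by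
  obtain ⟨U, hx, b, hb⟩ := h x
  have hb' : IsLocalBasis N U (b.reindex Equiv.ulift.{u}.symm) := ⟨fun y hy => by
    rw [hb.eq_span y hy, Module.Basis.range_reindex]⟩
  exact ⟨U, hx, hb'.isFrame.nonempty_iso⟩

end

/-! ### Pullback of rational sections -/

section

variable {X Y : Scheme.{u}} [IsIntegral X] [IsIntegral Y] (f : Y ⟶ X) [IsDominant f]

omit [IsIntegral X] [IsIntegral Y] [IsDominant f] in
theorem mem_preimage {U : X.Opens} {y : Y} (hy : f y ∈ U) : y ∈ f ⁻¹ᵁ U := hy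

theorem functionFieldMap_toFunctionField {U : X.Opens} {y : Y} (hy : f y ∈ U) (r : Γ(X, U)) :
    functionFieldMap f (toFunctionField hy r) =
      toFunctionField (mem_preimage f hy) (f.app U r) := by
  have h1 := TopCat.Presheaf.germ_stalkSpecializes_apply X.presheaf
    (genericPoint_mem hy) (specializes_of_eq (map_genericPoint f)) r
  refine (congrArg (f.stalkMap (genericPoint Y)).hom ?_).trans
    (Scheme.Hom.germ_stalkMap_apply f U (genericPoint Y) (genericPoint_mem (mem_preimage f hy)) r)
  exact h1

/-- The pullback of sections. -/
def pullSection {X Y : Scheme.{u}} (f : Y ⟶ X) (M : X.Modules) (U : X.Opens) :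
    Γ(M, U) →+ Γ((Scheme.Modules.pullback f).obj M, f ⁻¹ᵁ U) :=
  (((Scheme.Modules.pullbackPushforwardAdjunction f).unit.app M).app U).hom

theorem pullSection_smul {X Y : Scheme.{u}} (f : Y ⟶ X) (M : X.Modules) {U : X.Opens}
    (r : Γ(X, U)) (s : Γ(M, U)) :
    pullSection f M U (r • s) = f.app U r • pullSection f M U s :=
  Scheme.Modules.Hom.app_smul ((Scheme.Modules.pullbackPushforwardAdjunction f).unit.app M) r s

theorem pullSection_res {X Y : Scheme.{u}} (f : Y ⟶ X) (M : X.Modules) {U W : X.Opens}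
    (i : U ⟶ W) (s : Γ(M, W)) :
    pullSection f M U (M.presheaf.map i.op s) =
      res _ (f.preimage_mono (leOfHom i)) (pullSection f M W s) :=
  app_res ((Scheme.Modules.pullbackPushforwardAdjunction f).unit.app M) (leOfHom i) s

theorem pullSection_app {X Y : Scheme.{u}} (f : Y ⟶ X) {M N : X.Modules} (φ : M ⟶ N) {U : X.Opens}
    (s : Γ(M, U)) :
    pullSection f N U (φ.app U s) =
      ((Scheme.Modules.pullback f).map φ).app (f ⁻¹ᵁ U) (pullSection f M U s) := by
  have h := (Scheme.Modules.pullbackPushforwardAdjunction f).unit.naturality φ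
  exact congrArg (fun ψ => Scheme.Modules.Hom.app ψ U s) h

variable (M : X.Modules)

theorem genericPoint_mem_preimage {U : X.Opens} (hU : genericPoint X ∈ U) :
    genericPoint Y ∈ f ⁻¹ᵁ U := mem_preimage f ((map_genericPoint f).symm ▸ hU)

theorem pullGen_compat {U W : X.Opens} (i : U ⟶ W) (hU : genericPoint X ∈ U) (s : Γ(M, W)) :
    (genGerm ((Scheme.Modules.pullback f).obj M) (genericPoint_mem_preimage f hU)).comp
        (pullSection f M U) (M.presheaf.map i.op s) =
      (genGerm ((Scheme.Modules.pullback f).obj M)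
        (genericPoint_mem_preimage f (leOfHom i hU))).comp (pullSection f M W) s := by
  rw [AddMonoidHom.comp_apply, pullSection_res, genGerm_res]; rfl

/-- The pullback of rational sections. -/
def pullGen : GenericStalk M →ₛₗ[functionFieldMap f]
    GenericStalk ((Scheme.Modules.pullback f).obj M) :=
  { genDesc (fun U hU => (genGerm ((Scheme.Modules.pullback f).obj M)
        (genericPoint_mem_preimage f hU)).comp (pullSection f M U))
      (pullGen_compat f M) with
    map_smul' := fun c v => by
      obtain ⟨U, hU, r, s, rfl, rfl⟩ := exists_toFunctionField_genGerm c v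
      change genDesc _ _ _ = _ • genDesc _ _ _
      rw [← genGerm_smul, genDesc_genGerm _ _ hU, genDesc_genGerm _ _ hU]
      rw [AddMonoidHom.comp_apply,
        pullSection_smul, genGerm_smul,
        ← functionFieldMap_toFunctionField f (y := genericPoint Y)
          (genericPoint_mem_preimage f (genericPoint_mem hU))]
      rfl }

theorem pullGen_genGerm {U : X.Opens} {y : Y} (hy : f y ∈ U) (s : Γ(M, U)) :
    pullGen f M (genGerm M hy s) =
      genGerm _ (mem_preimage f hy) (pullSection f M U s) :=
  genDesc_genGerm (M := M) (fun U hU => (genGerm ((Scheme.Modules.pullback f).obj M)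
    (genericPoint_mem_preimage f hU)).comp (pullSection f M U)) (pullGen_compat f M) hy s

theorem pullGen_genMap {M N : X.Modules} (φ : M ⟶ N) (v : GenericStalk M) :
    pullGen f N (genMap φ v) = genMap ((Scheme.Modules.pullback f).map φ) (pullGen f M v) := by
  obtain ⟨U, hU, s, rfl⟩ := exists_genGerm v
  have hU' : f (genericPoint Y) ∈ U := genericPoint_mem_preimage f hU
  change pullGen f N (genMap φ (genGerm M hU' s)) = genMap _ (pullGen f M (genGerm M hU' s))
  rw [genMap_genGerm, pullGen_genGerm, pullGen_genGerm, genMap_genGerm, pullSection_app]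

theorem pullGen_mem_lattice {y : Y} {v : GenericStalk M} (hv : v ∈ lattice M (f y)) :
    pullGen f M v ∈ lattice ((Scheme.Modules.pullback f).obj M) y := by
  obtain ⟨U, hy, s, rfl⟩ := mem_lattice_iff.1 hv
  rw [pullGen_genGerm]
  exact genGerm_mem_lattice _ _

/-- The pullback of a subsheaf of the sheaf of rational sections. -/
def pullSub {M : X.Modules} (N : RatSubsheaf M) : RatSubsheaf ((Scheme.Modules.pullback f).obj M) :=
  fun y => Submodule.span (localRing y) (pullGen f M '' N (f y))

/-- The morphism to the pushforward that is given by pullback of rational sections. -/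
def toPushforward :
    M ⟶ (Scheme.Modules.pushforward f).obj (toModules (pullSub f (lattice M))) :=
  SheafOfModules.Hom.mk (PresheafOfModules.homMk
    (M₁ := M.val)
    (M₂ := ((Scheme.Modules.pushforward f).obj (toModules (pullSub f (lattice M)))).val)
    { app := fun U => AddCommGrpCat.ofHom
        { toFun := fun s => (⟨fun y => pullGen f M (genGerm M (U := U.unop) (x := f y.1) y.2 s),
            (IsLocallyConstant.iff_exists_open _).2
              fun x => ⟨Set.univ, isOpen_univ, trivial, fun _ _ => rfl⟩,
            fun y => Submodule.subset_span ⟨_, genGerm_mem_lattice _ s, rfl⟩⟩ :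
            sections (pullSub f (lattice M)) (f ⁻¹ᵁ U.unop))
          map_zero' := Subtype.ext (funext fun y => by
            change pullGen f M (genGerm M (U := U.unop) (x := f y.1) y.2 0) = 0
            rw [map_zero, map_zero])
          map_add' := fun s t => Subtype.ext (funext fun y => by
            exact (congrArg (pullGen f M)
              (map_add (genGerm M (U := U.unop) (x := f y.1) y.2) s t)).trans
              (map_add (pullGen f M) _ _)) }
      naturality := fun U V i =>
        AddCommGrpCat.hom_ext (AddMonoidHom.ext fun s => Subtype.ext (funext fun y =>
          congrArg (pullGen f M) (genGerm_res M (U := V.unop) (x := f y.1) y.2 i.unop s))) }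
    (fun U r s => Subtype.ext (funext fun y => by
      refine (congrArg (pullGen f M) (genGerm_smul M (U := U.unop) (x := f y.1) y.2 r s)).trans ?_
      refine (map_smulₛₗ (pullGen f M) _ _).trans ?_
      exact congrArg (· • pullGen f M (genGerm M (U := U.unop) (x := f y.1) y.2 s))
        (functionFieldMap_toFunctionField f (U := U.unop) (y := y.1) y.2 r))))

/-- Adjunction replaces a stalkwise computation of `f^*M`. Pulling back rational sections maps `M`
to the pushforward of the sheaf of `pullSub f (lattice M)`. The adjoint map out of `f^*M` does not
change rational sections, so every germ of `f^*M` lies in the span of pulled-back germs. -/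
theorem lattice_pullback_le :
    lattice ((Scheme.Modules.pullback f).obj M) ≤ pullSub f (lattice M) := by
  set P := (Scheme.Modules.pullback f).obj M
  have hle : pullSub f (lattice M) ≤ lattice P := fun y => Submodule.span_le.2 <| by
    rintro _ ⟨v, hv, rfl⟩
    exact pullGen_mem_lattice f M hv
  let adj := Scheme.Modules.pullbackPushforwardAdjunction f
  let a : P ⟶ toModules (pullSub f (lattice M)) :=
    (adj.homEquiv _ _).symm (toPushforward f M)
  let b : toModules (pullSub f (lattice M)) ⟶ toModules (lattice P) :=
    toModulesMap _ _ LinearMap.id hle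
  let c : P ⟶ toModules (lattice P) := homOfGen (M := P) (lattice P) LinearMap.id fun _ _ hv => hv
  -- By adjunction it is enough to compare on sections pulled back from `X`.
  have hab : a ≫ b = c := by
    apply (adj.homEquiv _ _).injective
    rw [adj.homEquiv_naturality_right, Equiv.apply_symm_apply, adj.homEquiv_unit]
    refine Scheme.Modules.hom_ext _ _ fun U => ?_
    ext s
    refine toModules_ext (N := lattice P) fun y hy => ?_
    refine (value_toModulesMap (pullSub f (lattice M)) (lattice P) LinearMap.id hle hy
      ((toPushforward f M).app U s)).trans ?_
    refine Eq.trans ?_ (value_homOfGen (M := P) (lattice P) LinearMap.id (fun _ _ hv => hv) hy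
      (pullSection f M U s)).symm
    exact pullGen_genGerm f M (y := y) hy s
  have ha : ∀ v, evalGen _ (genMap a v) = v := fun v => by
    have h1 := evalGen_genMap_toModulesMap (pullSub f (lattice M)) (lattice P) LinearMap.id hle
      (genMap a v)
    have h2 := evalGen_genMap_homOfGen (M := P) (lattice P) LinearMap.id (fun _ _ hv => hv) v
    change evalGen _ (genMap b (genMap a v)) = _ at h1
    rw [← genMap_comp_apply, hab] at h1
    exact h1.symm.trans h2
  intro y v hv
  rw [← ha v]
  exact evalGen_mem _ (image_le_lattice a y (genMap_mem_image a hv))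

end

/-! ### Pullback of locally free sheaves -/

section PullbackFree

variable {X Y : Scheme.{u}} (f : Y ⟶ X)

/-- The whole space receives an arrow from every object of the comma category, so the latter is
connected. Finality is needed for pullback to preserve free sheaves. -/
theorem final_opensMap {S T : TopCat.{u}} (f : S ⟶ T) : (Opens.map f).Final where
  out V := by
    have : Nonempty (StructuredArrow V (Opens.map f)) :=
      ⟨StructuredArrow.mk (Y := ⊤) (homOfLE le_top)⟩
    refine zigzag_isConnected fun A B => ?_
    have h : ∀ A : StructuredArrow V (Opens.map f), Nonempty
        (A ⟶ StructuredArrow.mk (T := Opens.map f) (Y := ⊤) (homOfLE le_top)) := fun A =>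
      ⟨StructuredArrow.homMk (homOfLE le_top) rfl⟩
    exact (Zigzag.of_hom (h A).some).trans (Zigzag.of_inv (h B).some)

theorem nonempty_pullback_free_iso (I : Type u) :
    Nonempty ((Scheme.Modules.pullback f).obj (freeModule X I) ≅ freeModule Y I) := by
  have h1 := final_opensMap f.base
  have h2 : (SheafOfModules.pushforward.{u} (Scheme.Hom.toRingCatSheafHom f)).IsRightAdjoint :=
    (inferInstance : (Scheme.Modules.pushforward f).IsRightAdjoint)
  exact ⟨@SheafOfModules.pullbackObjFreeIso _ _ _ _ _ _ _ _ _ _ f.toRingCatSheafHom h2 _ _ _ _ h1 I⟩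

/-- Pullback commutes with restriction to an open subscheme of the target. -/
def restrictPullbackIso (M : X.Modules) (U : X.Opens) :
    ((Scheme.Modules.pullback f).obj M).restrict (f ⁻¹ᵁ U).ι ≅
      (Scheme.Modules.pullback (f ∣_ U)).obj (M.restrict U.ι) :=
  (Scheme.Modules.restrictFunctorIsoPullback (f ⁻¹ᵁ U).ι).app _ ≪≫
    (Scheme.Modules.pullbackComp (f ⁻¹ᵁ U).ι f).app M ≪≫
    (Scheme.Modules.pullbackCongr (morphismRestrict_ι f U).symm).app M ≪≫
    ((Scheme.Modules.pullbackComp (f ∣_ U) U.ι).app M).symm ≪≫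
    (Scheme.Modules.pullback (f ∣_ U)).mapIso
      ((Scheme.Modules.restrictFunctorIsoPullback U.ι).app M).symm

theorem IsLocallyFreeOfRank.pullback {M : X.Modules} {r : ℕ} (hM : IsLocallyFreeOfRank M r) :
    IsLocallyFreeOfRank ((Scheme.Modules.pullback f).obj M) r := fun y => by
  obtain ⟨U, hy, ⟨e⟩⟩ := hM (f y)
  obtain ⟨e'⟩ := nonempty_pullback_free_iso (f ∣_ U) (ULift.{u} (Fin r))
  exact ⟨f ⁻¹ᵁ U, hy, ⟨restrictPullbackIso f M U ≪≫
    (Scheme.Modules.pullback (f ∣_ U)).mapIso e ≪≫ e'⟩⟩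

end PullbackFree

/-! ### Pullback of lattices and bases -/

section PullbackLattice

variable {X : Scheme.{u}} [IsIntegral X]

theorem IsLocallyFreeOfRank.finrank_eq {M : X.Modules} {r : ℕ} (hM : IsLocallyFreeOfRank M r) :
    Module.finrank X.functionField (GenericStalk M) = r := by
  obtain ⟨U, -, b, -⟩ := hM.exists_isLocalBasis (genericPoint X)
  rw [Module.finrank_eq_card_basis b]; simp

theorem IsLocallyFreeOfRank.finiteDimensional {M : X.Modules} {r : ℕ}
    (hM : IsLocallyFreeOfRank M r) : FiniteDimensional X.functionField (GenericStalk M) := by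
  obtain ⟨U, -, b, -⟩ := hM.exists_isLocalBasis (genericPoint X)
  exact Module.Finite.of_basis b

variable {Y : Scheme.{u}} [IsIntegral Y] (f : Y ⟶ X) [IsDominant f]

theorem lattice_pullback (M : X.Modules) :
    lattice ((Scheme.Modules.pullback f).obj M) = pullSub f (lattice M) :=
  le_antisymm (lattice_pullback_le f M) fun y => Submodule.span_le.2 <| by
    rintro _ ⟨v, hv, rfl⟩
    exact pullGen_mem_lattice f M hv

theorem image_pullback {M N : X.Modules} (φ : M ⟶ N) :
    image ((Scheme.Modules.pullback f).map φ) = pullSub f (image φ) := by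
  funext y
  rw [image_eq_map, lattice_pullback, pullSub, pullSub, Submodule.map_span]
  congr 1
  ext v
  constructor
  · rintro ⟨_, ⟨w, hw, rfl⟩, rfl⟩
    exact ⟨genMap φ w, genMap_mem_image φ hw, pullGen_genMap f φ w⟩
  · rintro ⟨w, hw, rfl⟩
    obtain ⟨w', hw', rfl⟩ := mem_image_iff_exists_lattice.1 hw
    exact ⟨_, ⟨w', hw', rfl⟩, (pullGen_genMap f φ w').symm⟩

theorem pullGen_mem_pullSub {M : X.Modules} {N : RatSubsheaf M} {y : Y} {v : GenericStalk M}
    (hv : v ∈ N (f y)) : pullGen f M v ∈ pullSub f N y := Submodule.subset_span ⟨v, hv, rfl⟩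

theorem pullSub_le {M : X.Modules} {N : RatSubsheaf M} {y : Y}
    {P : Submodule (localRing y) (GenericStalk ((Scheme.Modules.pullback f).obj M))}
    (h : ∀ v ∈ N (f y), pullGen f M v ∈ P) : pullSub f N y ≤ P := Submodule.span_le.2 <| by
  rintro _ ⟨v, hv, rfl⟩
  exact h v hv

/-- The pullback of an invertible rational function. -/
def pullUnits : (X.functionField)ˣ →* (Y.functionField)ˣ :=
  Units.map (functionFieldMap f).toMonoidHom

@[simp] theorem coe_pullUnits (u : (X.functionField)ˣ) :
    (pullUnits f u : Y.functionField) = functionFieldMap f u := rfl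

variable {M : X.Modules} {r : ℕ} {I : Type*} [Fintype I]

/-- The lattice at the generic point is the whole generic stalk, and for a pullback it is spanned by
pulled-back rational sections. With equality of ranks this makes the pullback of a basis a basis. -/
theorem top_le_span_pullGen (e : Module.Basis I X.functionField (GenericStalk M)) :
    ⊤ ≤ Submodule.span Y.functionField (Set.range fun a => pullGen f M (e a)) := fun v _ => by
  have h1 := lattice_pullback_le f M _ (exists_mem_lattice v)
  refine pullSub_le f (P := { Submodule.span Y.functionField
    (Set.range fun a => pullGen f M (e a)) with
      smul_mem' := fun c _ hv => Submodule.smul_mem _ (c : Y.functionField) hv }) ?_ h1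
  intro w _
  change pullGen f M w ∈ Submodule.span Y.functionField _
  rw [← e.sum_repr w, map_sum]
  refine Submodule.sum_mem _ fun a _ => ?_
  rw [map_smulₛₗ]
  exact Submodule.smul_mem _ _ (Submodule.subset_span ⟨a, rfl⟩)

omit [IsDominant f] in
theorem card_eq_finrank_pullback (hM : IsLocallyFreeOfRank M r)
    (e : Module.Basis I X.functionField (GenericStalk M)) :
    Fintype.card I =
      Module.finrank Y.functionField (GenericStalk ((Scheme.Modules.pullback f).obj M)) := by
  rw [(hM.pullback f).finrank_eq, ← hM.finrank_eq, Module.finrank_eq_card_basis e]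

/-- The pullback of a basis of the space of rational sections of a vector bundle. -/
def pullBasis (hM : IsLocallyFreeOfRank M r)
    (e : Module.Basis I X.functionField (GenericStalk M)) :
    Module.Basis I Y.functionField (GenericStalk ((Scheme.Modules.pullback f).obj M)) :=
  have := (hM.pullback f).finiteDimensional
  basisOfTopLeSpanOfCardEqFinrank (fun a => pullGen f M (e a)) (top_le_span_pullGen f e)
    (card_eq_finrank_pullback f hM e)

theorem pullBasis_apply (hM : IsLocallyFreeOfRank M r)
    (e : Module.Basis I X.functionField (GenericStalk M)) (a : I) :
    pullBasis f hM e a = pullGen f M (e a) := by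
  have := (hM.pullback f).finiteDimensional
  exact congrFun (coe_basisOfTopLeSpanOfCardEqFinrank _ (top_le_span_pullGen f e)
    (card_eq_finrank_pullback f hM e)) a

theorem repr_pullGen (hM : IsLocallyFreeOfRank M r)
    (e : Module.Basis I X.functionField (GenericStalk M)) (v : GenericStalk M) (a : I) :
    (pullBasis f hM e).repr (pullGen f M v) a = functionFieldMap f (e.repr v a) := by
  have h1 : pullGen f M v =
      (pullBasis f hM e).equivFun.symm fun a => functionFieldMap f (e.repr v a) := by
    rw [Module.Basis.equivFun_symm_apply]
    conv_lhs => rw [← e.sum_repr v, map_sum]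
    refine Finset.sum_congr rfl fun a _ => ?_
    rw [map_smulₛₗ, pullBasis_apply]
  rw [h1, ← Module.Basis.equivFun_apply, LinearEquiv.apply_symm_apply]

/-- Only generators and coordinates are pulled back, so no flatness is needed. All of base change
rests on this. -/
theorem pullSub_eq_diag (hM : IsLocallyFreeOfRank M r)
    {e : Module.Basis I X.functionField (GenericStalk M)} {c : I → (X.functionField)ˣ}
    {N : RatSubsheaf M} {y : Y} (hN : N (f y) = diag (localRing (f y)) e c) :
    pullSub f N y = diag (localRing y) (pullBasis f hM e) fun a => pullUnits f (c a) := by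
  refine le_antisymm (pullSub_le f fun v hv => ?_) (diag_le fun a => ?_)
  · rw [hN, mem_diag_iff] at hv
    refine mem_diag_iff.2 fun a => ?_
    rw [repr_pullGen, ← map_inv, coe_pullUnits, ← map_mul]
    exact functionFieldMap_mem f (hv a)
  · rw [pullBasis_apply, coe_pullUnits, ← map_smulₛₗ]
    refine pullGen_mem_pullSub f ?_
    rw [hN]
    exact Submodule.subset_span ⟨a, rfl⟩

end PullbackLattice

/-! ### Calculus of local equations -/

section Divisor

variable {X : Scheme.{u}} [IsIntegral X] {D D' : CartierDivisor X} {x : X}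
  {g g' : (X.functionField)ˣ}

theorem isEquation_zero : IsEquation (0 : CartierDivisor X) x 1 := rfl

theorem IsEquation.add (h : IsEquation D x g) (h' : IsEquation D' x g') :
    IsEquation (D + D') x (g * g') := by
  have h1 : (D + D').1 x = D.1 x + D'.1 x := rfl
  rw [IsEquation, h1, show D.1 x = _ from h, show D'.1 x = _ from h']; rfl

theorem IsEquation.neg (h : IsEquation D x g) : IsEquation (-D) x g⁻¹ := by
  have h1 : (-D).1 x = -D.1 x := rfl
  rw [IsEquation, h1, show D.1 x = _ from h]; rfl

theorem IsEquation.sub (h : IsEquation D x g) (h' : IsEquation D' x g') :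
    IsEquation (D - D') x (g / g') := by
  rw [sub_eq_add_neg, div_eq_mul_inv]; exact h.add h'.neg

theorem IsEquation.div_mem (h : IsEquation D x g) (h' : IsEquation D x g') :
    ((g / g' : (X.functionField)ˣ) : X.functionField) ∈ localRing x := by
  have h1 := h.sub h'
  rw [sub_self] at h1
  exact isEffective_zero x _ h1

theorem IsEquation.isEffective_of_mem (h : ∀ x : X, ∃ g, IsEquation D x g ∧
    (g : X.functionField) ∈ localRing x) : IsEffective D := fun x g hg => by
  obtain ⟨g', hg', hmem⟩ := h x
  have := mul_mem (hg.div_mem hg') hmem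
  rwa [← Units.val_mul, div_mul_cancel] at this

theorem twist_eq_scale {M : X.Modules} (N : RatSubsheaf M) (h : IsEquation D x g) :
    twist D N x = scale g (N x) := by
  ext v
  refine ⟨fun hv => hv g h, fun hv g' hg' => ?_⟩
  have h1 := smul_mem_of_mem (hg'.div_mem h) (mem_scale.1 hv)
  rwa [smul_smul, ← Units.val_mul, div_mul_cancel] at h1

/-- Equations extend to neighbourhoods. -/
theorem IsEquation.exists_open (h : IsEquation D x g) :
    ∃ U : X.Opens, x ∈ U ∧ ∀ y ∈ U, IsEquation D y g := by
  obtain ⟨U, hx, g', hg'⟩ := D.2 x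
  have h1 : IsEquation D x g' := hg' x hx
  obtain ⟨W, hxW, a, ha⟩ := mem_localRing_iff.1 (h.div_mem h1)
  obtain ⟨W', hxW', a', ha'⟩ := mem_localRing_iff.1 (h1.div_mem h)
  refine ⟨U ⊓ (W ⊓ W'), ⟨hx, hxW, hxW'⟩, fun y hy => ?_⟩
  have h2 : IsEquation D y g' := hg' y hy.1
  rw [IsEquation, show D.1 y = _ from h2]
  refine congrArg Additive.ofMul (QuotientGroup.eq.2 ?_)
  have e1 : toFunctionField hy.2.1 a = ((g'⁻¹ * g : (X.functionField)ˣ) : X.functionField) := by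
    rw [mul_comm, ← div_eq_mul_inv]; exact ha
  have e2 : toFunctionField hy.2.2 a' = (((g'⁻¹ * g)⁻¹ : (X.functionField)ˣ) : X.functionField) := by
    rw [mul_inv, inv_inv, ← div_eq_mul_inv]; exact ha'
  exact ⟨e1 ▸ toFunctionField_mem _ a, e2 ▸ toFunctionField_mem _ a'⟩

variable {Y : Scheme.{u}} [IsIntegral Y] (f : Y ⟶ X) [IsDominant f]

theorem IsEquation.pullback {y : Y} (h : IsEquation D (f y) g) :
    IsEquation (pullbackDivisor f D) y (pullUnits f g) := by
  simp only [IsEquation, pullbackDivisor]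
  rw [show D.1 (f y) = _ from h]
  rfl

theorem pullbackDivisor_sub : pullbackDivisor f (D - D') = pullbackDivisor f D - pullbackDivisor f D' := by
  refine Subtype.ext (funext fun y => ?_)
  obtain ⟨g, hg⟩ := exists_isEquation D (f y)
  obtain ⟨g', hg'⟩ := exists_isEquation D' (f y)
  have h1 := (hg.sub hg').pullback f
  have h2 := (hg.pullback f).sub (hg'.pullback f)
  rw [map_div] at h1
  exact h1.trans h2.symm

theorem pullbackDivisor_zero : pullbackDivisor f (0 : CartierDivisor X) = 0 := by
  refine Subtype.ext (funext fun y => ?_)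
  have h1 := (isEquation_zero (X := X) (x := f y)).pullback f
  rw [map_one] at h1
  exact h1

theorem IsEffective.pullback (h : IsEffective D) : IsEffective (pullbackDivisor f D) :=
  IsEquation.isEffective_of_mem fun y => by
    obtain ⟨g, hg⟩ := exists_isEquation D (f y)
    exact ⟨_, hg.pullback f, functionFieldMap_mem f (h _ _ hg)⟩

end Divisor

/-! ### Spreading out from a point to a neighbourhood -/

section Spread

open Topology

variable {X : Scheme.{u}} [IsIntegral X] {M N : X.Modules} {x : X}

theorem eventually_mem_localRing {c : X.functionField} (hc : c ∈ localRing x) :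
    ∀ᶠ y in 𝓝 x, c ∈ localRing y := by
  obtain ⟨U, hx, r, rfl⟩ := mem_localRing_iff.1 hc
  filter_upwards [U.isOpen.mem_nhds hx] with y hy
  exact toFunctionField_mem (x := y) hy r

theorem eventually_mem_span {I : Type*} [Finite I] {g : I → GenericStalk M} {v : GenericStalk M}
    (hv : v ∈ Submodule.span (localRing x) (Set.range g)) :
    ∀ᶠ y in 𝓝 x, v ∈ Submodule.span (localRing y) (Set.range g) := by
  have := Fintype.ofFinite I
  obtain ⟨c, rfl⟩ := (Submodule.mem_span_range_iff_exists_fun _).1 hv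
  filter_upwards [Filter.eventually_all.2 fun i => eventually_mem_localRing (c i).2] with y hy
  exact Submodule.sum_mem _ fun i _ =>
    smul_mem_of_mem (hy i) (Submodule.subset_span (Set.mem_range_self i))

/-- An inclusion of finitely generated lattices involves finitely many coefficients, and these
remain regular nearby. -/
theorem eventually_span_le {I J : Type*} [Finite I] [Finite J] {g : I → GenericStalk M}
    {h : J → GenericStalk M}
    (hgh : Submodule.span (localRing x) (Set.range g) ≤
      Submodule.span (localRing x) (Set.range h)) :
    ∀ᶠ y in 𝓝 x, Submodule.span (localRing y) (Set.range g) ≤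
      Submodule.span (localRing y) (Set.range h) := by
  filter_upwards [Filter.eventually_all.2 fun i =>
    eventually_mem_span (hgh (Submodule.subset_span (Set.mem_range_self i)))] with y hy
  exact Submodule.span_le.2 (Set.range_subset_iff.2 hy)

theorem eventually_span_eq {I J : Type*} [Finite I] [Finite J] {g : I → GenericStalk M}
    {h : J → GenericStalk M}
    (hgh : Submodule.span (localRing x) (Set.range g) =
      Submodule.span (localRing x) (Set.range h)) :
    ∀ᶠ y in 𝓝 x, Submodule.span (localRing y) (Set.range g) =
      Submodule.span (localRing y) (Set.range h) := by
  filter_upwards [eventually_span_le hgh.le, eventually_span_le hgh.ge] with y h1 h2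
  exact le_antisymm h1 h2

theorem IsEquation.eventually {D : CartierDivisor X} {g : (X.functionField)ˣ}
    (h : IsEquation D x g) : ∀ᶠ y in 𝓝 x, IsEquation D y g := by
  obtain ⟨U, hx, hU⟩ := h.exists_open
  exact Filter.mem_of_superset (U.isOpen.mem_nhds hx) hU

theorem IsLocallyFreeOfRank.eventually_image_eq_span {r : ℕ} (hM : IsLocallyFreeOfRank M r)
    (φ : M ⟶ N) (x : X) : ∃ g : ULift.{u} (Fin r) → GenericStalk N,
      ∀ᶠ y in 𝓝 x, image φ y = Submodule.span (localRing y) (Set.range g) := by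
  obtain ⟨U, hx, b, hb⟩ := hM.exists_isLocalBasis x
  refine ⟨fun i => genMap φ (b i), Filter.mem_of_superset (U.isOpen.mem_nhds hx) fun y hy => ?_⟩
  change image φ y = _
  rw [image_eq_map, hb.eq_span y hy, Submodule.map_span, ← Set.range_comp]
  rfl

theorem exists_equations (D : ℕ → CartierDivisor X) (h : D 0 = 0) (x : X) :
    ∃ d : ℕ → (X.functionField)ˣ, d 0 = 1 ∧ ∀ i, IsEquation (D i) x (d i) := by
  choose d hd using fun i => exists_isEquation (D i) x
  -- The equation at index 0 is normalised to 1 exactly, not just up to a unit, because the formulas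
  -- for the recursion start from there.
  refine ⟨fun i => if i = 0 then 1 else d i, if_pos rfl, fun i => ?_⟩
  by_cases hi : i = 0
  · subst hi; rw [h]; exact isEquation_zero
  · simpa only [if_neg hi] using hd i

instance isLocalRing_localRing (x : X) : IsLocalRing (localRing x) :=
  IsLocalRing.of_surjective' (algebraMap (X.presheaf.stalk x) X.functionField).rangeRestrict
    (RingHom.rangeRestrict_surjective _)

theorem image_eq_lattice (φ : M ⟶ N) [IsIso φ] : image φ = lattice N := by
  refine le_antisymm (image_le_lattice φ) fun x v hv => ?_
  refine mem_image_iff_exists_lattice.2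
    ⟨genMap (inv φ) v, image_le_lattice _ _ (genMap_mem_image (inv φ) hv), ?_⟩
  rw [← genMap_comp_apply, IsIso.inv_hom_id, genMap_id]; rfl

omit [IsIntegral X] in
theorem IsLocallyFreeOfRank.of_iso {r : ℕ} (e : M ≅ N) (hM : IsLocallyFreeOfRank M r) :
    IsLocallyFreeOfRank N r := fun x => by
  obtain ⟨U, hx, ⟨e'⟩⟩ := hM x
  exact ⟨U, hx, ⟨(Scheme.Modules.restrictFunctor U.ι).mapIso e.symm ≪≫ e'⟩⟩

end Spread

/-! ### Local models of echelon data -/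

section Model

open Topology

variable {X : Scheme.{u}} [IsIntegral X] {m : ℕ}

/-- At the point `x`, the divisors of `χ` have equations `δ i` and `D i`, and the basis `e` with
levels `n` is adapted to its filtration. -/
structure IsModelAt (χ : RawDatum X m) (x : X) (δ D : ℕ → (X.functionField)ˣ) {I : Type*}
    (e : Module.Basis I X.functionField (GenericStalk χ.bundle)) (n : I → ℕ) : Prop where
  δ_zero : δ 0 = 1
  D_zero : D 0 = 1
  δ_eq : ∀ i ≤ m, IsEquation (χ.δ i) x (δ i)
  D_eq : ∀ i ≤ m, IsEquation (χ.D i) x (D i)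
  adapted : IsAdaptedBasis (localRing x) (fun i => χ.sub i x) δ m e n

namespace RawDatum

variable {χ : RawDatum X m}

theorem IsPreEchelon.exists_bundle (h : χ.IsPreEchelon) : ∃ r, IsLocallyFreeOfRank χ.bundle r ∧
    ∀ i ≤ m, IsLocallyFreeOfRank (χ.fil i) r := by
  obtain ⟨r, hr⟩ := h.locallyFree
  have := h.isIso_zero
  exact ⟨r, (hr 0 (Nat.zero_le m)).of_iso (asIso (χ.incl 0)), hr⟩

theorem IsPreEchelon.sub_zero (h : χ.IsPreEchelon) : χ.sub 0 = lattice χ.bundle :=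
  have := h.isIso_zero
  image_eq_lattice (χ.incl 0)

theorem IsPreEchelon.sub_succ_le (h : χ.IsPreEchelon) {i : ℕ} (hi : i < m) :
    χ.sub (i + 1) ≤ χ.sub i := fun x v hv => by
  obtain ⟨j, hj⟩ := h.chain i hi
  obtain ⟨w, hw, rfl⟩ := mem_image_iff_exists_lattice.1 hv
  rw [← hj, genMap_comp_apply]
  exact genMap_mem_image _ (image_le_lattice _ _ (genMap_mem_image j hw))

/-- An adapted basis at `x`, with the same equations and levels, stays adapted nearby: each `E^i` is
spanned near `x` by finitely many fixed rational sections, and so is its diagonal model. -/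
theorem IsEchelon.exists_isModelAt (h : χ.IsEchelon) {r : ℕ} (hr : IsLocallyFreeOfRank χ.bundle r)
    (x : X) : ∃ (δ D : ℕ → (X.functionField)ˣ)
      (e : Module.Basis (Fin r) X.functionField (GenericStalk χ.bundle)) (n : Fin r → ℕ),
      ∀ᶠ y in 𝓝 x, IsModelAt χ y δ D e n := by
  obtain ⟨δ, hδ0, hδ⟩ := exists_equations χ.δ h.δ_zero x
  obtain ⟨D, hD0, hD⟩ := exists_equations χ.D h.D_zero x
  obtain ⟨U, hxU, b, hb⟩ := hr.exists_isLocalBasis x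
  have hsc : ∀ i (N : RatSubsheaf χ.bundle),
      twist (-χ.dδ i) N x = scale (δ (i + 1) / δ i)⁻¹ (N x) :=
    fun i N => twist_eq_scale N ((hδ (i + 1)).sub (hδ i)).neg
  obtain ⟨e, n, he⟩ := exists_isAdaptedBasis (R := localRing x) (m := m) (δ := δ)
    (E := fun i => χ.sub i x) b (by rw [h.sub_zero, hb.eq_span x hxU])
    (fun i hi => h.sub_succ_le hi x)
    (fun i hi => h.dδ_effective i hi x _ ((hδ (i + 1)).sub (hδ i)))
    (fun i hi => by rw [← hsc]; exact h.twist_le i hi x)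
    -- Of persistence, only the comparison with `j = 0` is used here and in the next argument.
    (fun i hi => by
      rw [← hsc, ← hsc, ← h.injective i hi 0 (Nat.zero_le i)]; exact le_rfl)
    (fun i hi => by
      have := h.split i hi 0 (Nat.zero_le i) x
      rwa [hsc] at this)
  refine ⟨δ, D, e.reindex Equiv.ulift, n ∘ Equiv.ulift.symm, ?_⟩
  obtain ⟨r', hr'⟩ := h.locallyFree
  have hsub : ∀ i ∈ Set.Iic m, ∀ᶠ y in 𝓝 x,
      χ.sub i y = diag (localRing y) e fun a => δ i / δ (min (n a) i) := fun i hi => by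
    obtain ⟨g, hg⟩ := (hr' i hi).eventually_image_eq_span (χ.incl i) x
    have h1 := (hg.self_of_nhds).symm.trans (he.eq_diag i hi)
    filter_upwards [hg, eventually_span_eq h1] with y h2 h3
    exact h2.trans h3
  filter_upwards [(Set.finite_Iic m).eventually_all.2 hsub,
    (Set.finite_Iic m).eventually_all.2 fun i _ => (hδ i).eventually,
    (Set.finite_Iic m).eventually_all.2 fun i _ => (hD i).eventually] with y h1 h2 h3
  exact ⟨hδ0, hD0, h2, h3, IsAdaptedBasis.reindex ⟨he.le, h1⟩ Equiv.ulift⟩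

end RawDatum

namespace IsModelAt

variable {χ : RawDatum X m} {x : X} {δ D : ℕ → (X.functionField)ˣ} {I : Type*}
  {e : Module.Basis I X.functionField (GenericStalk χ.bundle)} {n : I → ℕ}

theorem dδ_eq (h : IsModelAt χ x δ D e n) {i : ℕ} (hi : i < m) :
    IsEquation (χ.dδ i) x (δ (i + 1) / δ i) := (h.δ_eq _ hi).sub (h.δ_eq _ hi.le)

theorem dD_eq (h : IsModelAt χ x δ D e n) {i : ℕ} (hi : i < m) :
    IsEquation (χ.dD i) x (D (i + 1) / D i) := (h.D_eq _ hi).sub (h.D_eq _ hi.le)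

theorem dδ_sub_dD_eq (h : IsModelAt χ x δ D e n) {i : ℕ} (hi : i < m) :
    IsEquation (χ.dδ i - χ.dD i) x (δ (i + 1) / D (i + 1) / (δ i / D i)) := by
  rw [div_div_div_comm]; exact (h.dδ_eq hi).sub (h.dD_eq hi)

variable (h : IsModelAt χ x δ D e n) (hχ : χ.IsEchelon)

include h hχ

theorem dD_mem {i : ℕ} (hi : i < m) :
    ((D (i + 1) / D i : (X.functionField)ˣ) : X.functionField) ∈ localRing x :=
  hχ.dD_effective i hi x _ (h.dD_eq hi)

theorem dδ_div_dD_mem {i : ℕ} (hi : i < m) :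
    ((δ (i + 1) / D (i + 1) / (δ i / D i) : (X.functionField)ˣ) : X.functionField)
      ∈ localRing x :=
  hχ.dD_le i hi x _ (h.dδ_sub_dD_eq hi)

/-- The stalk of the echelon modification. -/
theorem chain_eq_diag [Fintype I] :
    χ.chain m 0 x = diag (localRing x) e fun a => (D (n a))⁻¹ := by
  refine h.adapted.chain_eq_diag h.D_zero h.δ_zero (fun i => h.dD_mem hχ)
    (fun i => h.dδ_div_dD_mem hχ) (fun i hi => ?_) (fun j i => χ.chain j i x) ?_ (fun i => rfl)
    (fun j hj => ?_) fun j hj i => ?_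
  · exact hχ.noCommonComponent (i + 1) hi x _ _ (h.D_eq _ hi)
      ((h.δ_eq _ hi).sub (h.D_eq _ hi))
  · exact congrFun hχ.sub_zero.symm x
  · change twist (χ.dD j) (χ.chain j 1) x ⊔ χ.chain j 0 x = _
    rw [twist_eq_scale _ (h.dD_eq hj)]
  · change twist (χ.dδ j) (χ.chain j (i + 2)) x ⊓ χ.chain (j + 1) 0 x = _
    rw [twist_eq_scale _ (h.dδ_eq hj)]

theorem twist_sub_le_chain [Fintype I] {i : ℕ} (hi : i ≤ m) :
    twist (χ.D i) (χ.sub i) x ≤ χ.chain m 0 x := by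
  rw [h.chain_eq_diag hχ, twist_eq_scale _ (h.D_eq i hi)]
  exact h.adapted.scale_le_diag (fun i => h.dD_mem hχ) (fun i => h.dδ_div_dD_mem hχ) hi

theorem chain_le_of_twist_sub_le [Fintype I] {P : Submodule (localRing x) (GenericStalk χ.bundle)}
    (hP : ∀ i ≤ m, twist (χ.D i) (χ.sub i) x ≤ P) : χ.chain m 0 x ≤ P := by
  rw [h.chain_eq_diag hχ]
  exact h.adapted.diag_le_of_scale_le fun i hi => by
    rw [← twist_eq_scale (χ.sub i) (h.D_eq i hi)]; exact hP i hi

end IsModelAt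

namespace RawDatum

variable {χ : RawDatum X m}

theorem IsEchelon.twist_sub_le_chain (h : χ.IsEchelon) {i : ℕ} (hi : i ≤ m) :
    twist (χ.D i) (χ.sub i) ≤ χ.chain m 0 := fun x => by
  obtain ⟨r, hr, -⟩ := h.exists_bundle
  obtain ⟨δ, D, e, n, hmod⟩ := h.exists_isModelAt hr x
  exact hmod.self_of_nhds.twist_sub_le_chain h hi

/-- The echelon modification is the sum of the sheaves `E^i(D_i)`. -/
theorem IsEchelon.chain_le_of_twist_sub_le (h : χ.IsEchelon) {x : X}
    {P : Submodule (localRing x) (GenericStalk χ.bundle)}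
    (hP : ∀ i ≤ m, twist (χ.D i) (χ.sub i) x ≤ P) : χ.chain m 0 x ≤ P := by
  obtain ⟨r, hr, -⟩ := h.exists_bundle
  obtain ⟨δ, D, e, n, hmod⟩ := h.exists_isModelAt hr x
  exact hmod.self_of_nhds.chain_le_of_twist_sub_le h hP

end RawDatum

end Model

/-! ### The modification: local freeness and functoriality -/

section Modification

open Topology

variable {X : Scheme.{u}} [IsIntegral X] {m : ℕ}

/-- Surjectivity is local once injectivity is known; equality of the stalks gives local preimages up
to equality of generic germs, which torsion-freeness turns into equality of sections. -/
theorem bijective_app_of_image_eq {M N : X.Modules} (hM : IsTorsionFree M) (hN : IsTorsionFree N)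
    {φ : M ⟶ N} (hφ : Function.Injective (genMap φ)) {U : X.Opens}
    (h : ∀ x ∈ U, image φ x = lattice N x) : Function.Bijective (φ.app U) := by
  have hinj : ∀ U, Function.Injective (φ.app U) :=
    have := hM.mono_of_injective hφ
    app_injective φ
  refine ⟨hinj U, TopCat.Presheaf.app_surjective_of_injective_of_locally_surjective
    (F := ⟨M.presheaf, M.isSheaf⟩) (G := ⟨N.presheaf, N.isSheaf⟩) ⟨φ.mapPresheaf⟩ U
    (fun x _ => TopCat.Presheaf.stalkFunctor_map_injective_of_app_injective hinj _)
    fun t x hx => ?_⟩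
  have h1 : genGerm N hx t ∈ image φ x := h x hx ▸ genGerm_mem_lattice hx t
  obtain ⟨W, hW, s, hs⟩ := mem_image_iff.1 h1
  refine ⟨U ⊓ W, ⟨hx, hW⟩, homOfLE inf_le_left, M.presheaf.map (homOfLE inf_le_right).op s, ?_⟩
  refine hN (U ⊓ W) x ⟨hx, hW⟩ ?_
  refine (congrArg _ (app_res φ inf_le_right s)).trans ?_
  exact (genGerm_res N _ _ _).trans (hs.symm.trans (genGerm_res N _ _ _).symm)

omit [IsIntegral X] in
theorem isIso_restrict_of_bijective {M N : X.Modules} {φ : M ⟶ N} {U : X.Opens}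
    (h : ∀ W ≤ U, Function.Bijective (φ.app W)) :
    IsIso ((Scheme.Modules.restrictFunctor U.ι).map φ) := by
  rw [Scheme.Modules.Hom.isIso_iff_isIso_app]
  intro W
  rw [ConcreteCategory.isIso_iff_bijective]
  exact h _ (ι_image_le W)

namespace RawDatum

variable (χ : RawDatum X m)

/-- The rational sections of the modification are those of the bundle. -/
def evalMod : GenericStalk χ.modification →ₗ[X.functionField] GenericStalk χ.bundle :=
  evalGen (χ.chain m 0)

theorem evalMod_toModification (v : GenericStalk χ.bundle) :
    χ.evalMod (genMap χ.toModification v) = v :=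
  (evalGen_genMap_lift (χ.chain m 0) (𝟙 χ.bundle) (χ.image_id_le_chain m) v).trans
    (LinearMap.congr_fun genMap_id v)

theorem evalMod_injective : Function.Injective χ.evalMod := evalGen_injective _

theorem toModification_evalMod (w : GenericStalk χ.modification) :
    genMap χ.toModification (χ.evalMod w) = w :=
  χ.evalMod_injective (χ.evalMod_toModification _)

theorem injective_genMap_toModification : Function.Injective (genMap χ.toModification) :=
  Function.LeftInverse.injective χ.evalMod_toModification

theorem isTorsionFree_modification : IsTorsionFree χ.modification := isTorsionFree_toModules _

theorem evalMod_mem {x : X} {w : GenericStalk χ.modification}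
    (hw : w ∈ lattice χ.modification x) : χ.evalMod w ∈ χ.chain m 0 x := evalGen_mem _ hw

theorem hom_modification_ext {F : X.Modules} {φ ψ : F ⟶ χ.modification}
    (h : ∀ v, χ.evalMod (genMap φ v) = χ.evalMod (genMap ψ v)) : φ = ψ :=
  toModules_hom_ext h

variable {χ}

/-- Two maps out of the echelon modification that agree on `E` are equal. -/
theorem modification_hom_ext {F : X.Modules} (hF : IsTorsionFree F) {φ ψ : χ.modification ⟶ F}
    (h : χ.toModification ≫ φ = χ.toModification ≫ ψ) : φ = ψ :=
  hF.hom_ext <| LinearMap.ext fun w => by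
    rw [← χ.toModification_evalMod w, ← genMap_comp_apply, h, genMap_comp_apply]

theorem IsEchelon.isVectorBundle_modification (h : χ.IsEchelon) :
    IsVectorBundle χ.modification := by
  obtain ⟨r, hr, -⟩ := h.exists_bundle
  refine ⟨r, isLocallyFreeOfRank_toModules fun x => ?_⟩
  obtain ⟨δ, D, e, n, hmod⟩ := h.exists_isModelAt hr x
  obtain ⟨U, hU, hUo, hx⟩ := eventually_nhds_iff.1 hmod
  refine ⟨⟨U, hUo⟩, hx, e.unitsSMul fun a => (D (n a))⁻¹, ⟨fun y hy => ?_⟩⟩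
  rw [(hU y hy).chain_eq_diag h]
  simp only [diag]
  congr 2
  ext a
  rw [Module.Basis.unitsSMul_apply]
  rfl

theorem IsEchelon.isGenericEquality (h : χ.IsEchelon) : IsGenericEquality χ.toModification := by
  obtain ⟨r, hr, -⟩ := h.exists_bundle
  refine ⟨hr.isTorsionFree.mono_of_injective χ.injective_genMap_toModification, ?_⟩
  obtain ⟨δ, D, e, n, hmod⟩ := h.exists_isModelAt hr (genericPoint X)
  -- Near the generic point the functions `D_{n(a)}⁻¹` are regular, so the extra generators of the
  -- modification already lie in `E`.
  have hall : ∀ c : X.functionField, ∀ᶠ y in 𝓝 (genericPoint X), c ∈ localRing y := fun c => by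
    obtain ⟨U, hU, r, rfl⟩ := exists_toFunctionField c
    exact eventually_mem_localRing (toFunctionField_mem hU r)
  obtain ⟨U, hU, hUo, hx⟩ := eventually_nhds_iff.1
    (hmod.and (Filter.eventually_all.2 fun a => hall ((D (n a))⁻¹ : (X.functionField)ˣ)))
  refine ⟨⟨U, hUo⟩, ⟨_, hx⟩, isIso_restrict_of_bijective fun W hW =>
    bijective_app_of_image_eq hr.isTorsionFree χ.isTorsionFree_modification
      χ.injective_genMap_toModification fun y hy => ?_⟩
  refine le_antisymm (image_le_lattice _ _) fun w hw => ?_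
  rw [← χ.toModification_evalMod w]
  refine genMap_mem_image _ ?_
  have h1 := χ.evalMod_mem hw
  obtain ⟨h2, h3⟩ := hU y (hW hy)
  rw [h2.chain_eq_diag h, mem_diag_iff] at h1
  rw [← h.sub_zero]
  refine h2.adapted.mem_zero_iff.2 fun a => ?_
  have h4 := h1 a
  rw [inv_inv] at h4
  have h5 := mul_mem (h3 a) h4
  rwa [Units.inv_mul_cancel_left] at h5

end RawDatum

namespace EchelonDatum

variable {χ ψ ω : EchelonDatum X m}

/-- Both modifications are sums of twists, and `E^i(D_i)` goes to `F^i(D_i) ⊆ F^i(D'_i)`. Adapted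
bases for the two data need not be compatible. -/
theorem Hom.genMap_mem_chain (a : Hom χ ψ) (x : X) (v : GenericStalk χ.bundle)
    (hv : v ∈ χ.chain m 0 x) : genMap a.hom v ∈ ψ.chain m 0 x := by
  suffices h : χ.chain m 0 x ≤
      (ψ.chain m 0 x).comap ((genMap a.hom).restrictScalars (localRing x)) from h hv
  refine χ.isEchelon.chain_le_of_twist_sub_le fun i hi v hv => ?_
  refine ψ.isEchelon.twist_sub_le_chain hi x fun g hg => ?_
  obtain ⟨f, hf⟩ := exists_isEquation (χ.D i) x
  have h1 : genMap a.hom ((f : X.functionField) • v) ∈ ψ.sub i x := by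
    obtain ⟨b, hb⟩ := a.fil i hi
    obtain ⟨w, hw, h2⟩ := mem_image_iff_exists_lattice.1 (hv f hf)
    rw [← h2, ← genMap_comp_apply, ← hb, genMap_comp_apply]
    exact genMap_mem_image _ (image_le_lattice _ _ (genMap_mem_image b hw))
  have h2 := smul_mem_of_mem (a.D_le i hi x _ (hg.sub hf)) h1
  rwa [map_smul, smul_smul, ← Units.val_mul, div_mul_cancel] at h2

/-- The map of echelon modifications induced by a morphism of echelon data. -/
def modMap (a : χ ⟶ ψ) : χ.modification ⟶ ψ.modification :=
  toModulesMap (χ.chain m 0) (ψ.chain m 0) (genMap (Hom.hom a)) (Hom.genMap_mem_chain a)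

theorem evalMod_modMap (a : χ ⟶ ψ) (w : GenericStalk χ.modification) :
    ψ.evalMod (genMap (modMap a) w) = genMap (Hom.hom a) (χ.evalMod w) :=
  evalGen_genMap_toModulesMap _ _ _ _ w

theorem modMap_id (χ : EchelonDatum X m) : modMap (𝟙 χ) = 𝟙 χ.modification :=
  χ.hom_modification_ext fun w => by
    rw [evalMod_modMap, genMap_id]
    exact LinearMap.congr_fun (genMap_id (M := χ.bundle)) _

theorem modMap_comp (a : χ ⟶ ψ) (b : ψ ⟶ ω) : modMap (a ≫ b) = modMap a ≫ modMap b :=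
  ω.hom_modification_ext fun w => by
    rw [evalMod_modMap, genMap_comp_apply, evalMod_modMap, evalMod_modMap, ← genMap_comp_apply]
    rfl

theorem toModification_modMap (a : χ ⟶ ψ) :
    χ.toModification ≫ modMap a = Hom.hom a ≫ ψ.toModification :=
  ψ.hom_modification_ext fun v => by
    rw [genMap_comp_apply, evalMod_modMap, genMap_comp_apply, RawDatum.evalMod_toModification,
      RawDatum.evalMod_toModification]

end EchelonDatum

end Modification

/-! ### Base change along dominant morphisms -/

section PullbackDatum

open Topology

variable {X Y : Scheme.{u}} [IsIntegral X] [IsIntegral Y] (f : Y ⟶ X) [IsDominant f] {m : ℕ}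

/-- The pulled-back map takes the pullback of a basis to the pullback of the image basis. This
replaces flatness: on torsion-free sheaves it yields injectivity. -/
theorem bijective_genMap_pullback {M N : X.Modules} {r s : ℕ} (hM : IsLocallyFreeOfRank M r)
    (hN : IsLocallyFreeOfRank N s) {φ : M ⟶ N} (hφ : Function.Bijective (genMap φ)) :
    Function.Bijective (genMap ((Scheme.Modules.pullback f).map φ)) := by
  obtain ⟨U, -, b, -⟩ := hM.exists_isLocalBasis (genericPoint X)
  let T := LinearEquiv.ofBijective (genMap φ) hφ
  have h1 : genMap ((Scheme.Modules.pullback f).map φ) =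
      ((pullBasis f hM b).equiv (pullBasis f hN (b.map T)) (Equiv.refl _)).toLinearMap := by
    refine (pullBasis f hM b).ext fun a => ?_
    rw [LinearEquiv.coe_coe, Module.Basis.equiv_apply, pullBasis_apply, pullBasis_apply,
      ← pullGen_genMap]
    rfl
  rw [h1]
  exact LinearEquiv.bijective _

theorem pullSub_image {M N : X.Modules} (φ : M ⟶ N) (P : RatSubsheaf M) {Q : RatSubsheaf N} {y : Y}
    (hQ : (Q (f y) : Set (GenericStalk N)) = genMap φ '' P (f y)) :
    pullSub f Q y = (pullSub f P y).map
      ((genMap ((Scheme.Modules.pullback f).map φ)).restrictScalars (localRing y)) := by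
  rw [pullSub, pullSub, Submodule.map_span]
  congr 1
  rw [hQ, ← Set.image_comp, ← Set.image_comp]
  exact Set.image_congr fun v _ => pullGen_genMap f φ v

theorem IsModelAt.pullback {χ : RawDatum X m} {y : Y} {δ D : ℕ → (X.functionField)ˣ} {I : Type*}
    [Fintype I] {e : Module.Basis I X.functionField (GenericStalk χ.bundle)} {n : I → ℕ}
    (h : IsModelAt χ (f y) δ D e n) {r : ℕ} (hr : IsLocallyFreeOfRank χ.bundle r) :
    IsModelAt (χ.pullback f) y (fun i => pullUnits f (δ i)) (fun i => pullUnits f (D i))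
      (pullBasis f hr e) n where
  δ_zero := by rw [h.δ_zero, map_one]
  D_zero := by rw [h.D_zero, map_one]
  δ_eq i hi := (h.δ_eq i hi).pullback f
  D_eq i hi := (h.D_eq i hi).pullback f
  adapted := ⟨h.adapted.le, fun i hi => by
    simp_rw [← map_div]
    refine Eq.trans ?_ (pullSub_eq_diag f hr (h.adapted.eq_diag i hi))
    exact congrFun (image_pullback f (χ.incl i)) y⟩

namespace RawDatum

variable {χ : RawDatum X m}

theorem pullback_dδ (i : ℕ) : (χ.pullback f).dδ i = pullbackDivisor f (χ.dδ i) :=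
  (pullbackDivisor_sub f).symm

theorem pullback_dD (i : ℕ) : (χ.pullback f).dD i = pullbackDivisor f (χ.dD i) :=
  (pullbackDivisor_sub f).symm

/-- Local models pull back, and a local model implies persistence for every `j`. The only condition
that is not automatic is the absence of common components. -/
theorem IsEchelon.pullback (h : χ.IsEchelon)
    (hcop : ∀ i ≤ m, NoCommonComponent (pullbackDivisor f (χ.D i))
      (pullbackDivisor f (χ.δ i) - pullbackDivisor f (χ.D i))) : (χ.pullback f).IsEchelon := by
  obtain ⟨r, hr, hfil⟩ := h.exists_bundle
  have hmod : ∀ y : Y, ∃ (δ D : ℕ → (Y.functionField)ˣ)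
      (e : Module.Basis (Fin r) Y.functionField (GenericStalk (χ.pullback f).bundle))
      (n : Fin r → ℕ), IsModelAt (χ.pullback f) y δ D e n := fun y => by
    obtain ⟨δ, D, e, n, hmod⟩ := h.exists_isModelAt hr (f y)
    exact ⟨_, _, _, _, hmod.self_of_nhds.pullback f hr⟩
  have hδ : ∀ i < m, IsEffective ((χ.pullback f).dδ i) := fun i hi => by
    rw [pullback_dδ]; exact (h.dδ_effective i hi).pullback f
  have hmem : ∀ {y : Y} {δ D : ℕ → (Y.functionField)ˣ}
      {e : Module.Basis (Fin r) Y.functionField (GenericStalk (χ.pullback f).bundle)}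
      {n : Fin r → ℕ}, IsModelAt (χ.pullback f) y δ D e n → ∀ i < m,
      ((δ (i + 1) / δ i : (Y.functionField)ˣ) : Y.functionField) ∈ localRing y :=
    fun hy i hi => hδ i hi _ _ (hy.dδ_eq hi)
  refine
    { isIso_zero := ?_
      mono := fun i hi => ?_
      chain := fun i hi => ?_
      locallyFree := ⟨r, fun i hi => (hfil i hi).pullback f⟩
      δ_zero := ?_
      dδ_effective := hδ
      twist_le := fun i hi y => ?_
      injective := fun i hi j hj => funext fun y => ?_
      split := fun i hi j hj y => ?_
      D_zero := ?_
      dD_effective := fun i hi => ?_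
      dD_le := fun i hi => ?_
      noCommonComponent := hcop }
  · have := h.isIso_zero
    exact (inferInstance : IsIso ((Scheme.Modules.pullback f).map (χ.incl 0)))
  · have := h.mono i hi
    have := hr.finiteDimensional
    have := (hfil i hi).finiteDimensional
    -- An injection of bundles of equal rank is bijective on generic stalks, hence so is its
    -- pullback, and the source of the pullback is torsion-free.
    refine ((hfil i hi).pullback f).isTorsionFree.mono_of_injective
      (bijective_genMap_pullback f (hfil i hi) hr ⟨genMap_injective (χ.incl i), ?_⟩).1
    rw [← LinearMap.injective_iff_surjective_of_finrank_eq_finrank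
      ((hfil i hi).finrank_eq.trans hr.finrank_eq.symm)]
    exact genMap_injective (χ.incl i)
  · obtain ⟨j, hj⟩ := h.chain i hi
    exact ⟨(Scheme.Modules.pullback f).map j, ((Scheme.Modules.pullback f).map_comp _ _).symm.trans
      (congrArg (Scheme.Modules.pullback f).map hj)⟩
  · exact (congrArg (pullbackDivisor f) h.δ_zero).trans (pullbackDivisor_zero f)
  · obtain ⟨δ, D, e, n, hy⟩ := hmod y
    rw [twist_eq_scale _ (hy.dδ_eq hi).neg]
    exact hy.adapted.scale_le (hmem hy) hi
  · obtain ⟨δ, D, e, n, hy⟩ := hmod y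
    rw [twist_eq_scale _ (hy.dδ_eq hi).neg, Pi.inf_apply, twist_eq_scale _ (hy.dδ_eq hi).neg]
    exact hy.adapted.inf_scale_eq (hmem hy) hi hj
  · obtain ⟨δ, D, e, n, hy⟩ := hmod y
    rw [twist_eq_scale _ (hy.dδ_eq hi).neg]
    exact hy.adapted.isComplemented (hmem hy) hi hj
  · exact (congrArg (pullbackDivisor f) h.D_zero).trans (pullbackDivisor_zero f)
  · rw [pullback_dD]; exact (h.dD_effective i hi).pullback f
  · rw [pullback_dD, pullback_dδ, ← pullbackDivisor_sub]; exact (h.dD_le i hi).pullback f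

theorem IsEchelon.pullSub_chain (h : χ.IsEchelon) (h' : (χ.pullback f).IsEchelon) :
    pullSub f (χ.chain m 0) = (χ.pullback f).chain m 0 := funext fun y => by
  obtain ⟨r, hr, -⟩ := h.exists_bundle
  obtain ⟨δ, D, e, n, hmod⟩ := h.exists_isModelAt hr (f y)
  have hy := hmod.self_of_nhds
  refine Eq.trans ?_ ((hy.pullback f hr).chain_eq_diag h').symm
  simp_rw [← map_inv]
  exact pullSub_eq_diag f hr (hy.chain_eq_diag h)

/-- A family of stalks need not consist of the stalks of its sheaf of sections. Here it does,
because an element at `x` lies in the span of a basis that serves a whole neighbourhood. -/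
theorem IsEchelon.toModification_mem_lattice_iff (h : χ.IsEchelon) {x : X}
    {v : GenericStalk χ.bundle} :
    genMap χ.toModification v ∈ lattice χ.modification x ↔ v ∈ χ.chain m 0 x := by
  refine ⟨fun hv => ?_, fun hv => ?_⟩
  · have := χ.evalMod_mem hv
    rwa [evalMod_toModification] at this
  · obtain ⟨r, hr, -⟩ := h.exists_bundle
    obtain ⟨δ, D, e, n, hmod⟩ := h.exists_isModelAt hr x
    rw [hmod.self_of_nhds.chain_eq_diag h] at hv
    obtain ⟨U, hU, hUo, hx⟩ := eventually_nhds_iff.1 (hmod.and (eventually_mem_span hv))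
    obtain ⟨w, hw, rfl⟩ : ∃ w ∈ lattice χ.modification x, χ.evalMod w = v :=
      exists_evalGen_eq (χ.chain m 0) (U := ⟨U, hUo⟩)
        (fun y hy => by rw [(hU y hy).1.chain_eq_diag h]; exact (hU y hy).2) hx
    rwa [toModification_evalMod]

theorem bijective_genMap_toModification (χ : RawDatum X m) :
    Function.Bijective (genMap χ.toModification) :=
  ⟨χ.injective_genMap_toModification, fun w => ⟨_, χ.toModification_evalMod w⟩⟩

theorem IsEchelon.bijective_genMap_pullback_toModification (h : χ.IsEchelon) :
    Function.Bijective (genMap ((Scheme.Modules.pullback f).map χ.toModification)) := by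
  obtain ⟨r, hr, -⟩ := h.exists_bundle
  obtain ⟨s, hs⟩ := h.isVectorBundle_modification
  exact bijective_genMap_pullback f hr hs χ.bijective_genMap_toModification

/-- Formation of the echelon modification commutes with pullback. -/
theorem IsEchelon.exists_pullback_iso (h : χ.IsEchelon) (h' : (χ.pullback f).IsEchelon) :
    ∃! e : (Scheme.Modules.pullback f).obj χ.modification ≅ (χ.pullback f).modification,
      (Scheme.Modules.pullback f).map χ.toModification ≫ e.hom = (χ.pullback f).toModification := by
  have hb := h.bijective_genMap_pullback_toModification f
  have hb' := (χ.pullback f).bijective_genMap_toModification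
  let T₁ := LinearEquiv.ofBijective _ hb
  let T₂ : GenericStalk ((Scheme.Modules.pullback f).obj χ.bundle) ≃ₗ[Y.functionField]
      GenericStalk (χ.pullback f).modification := LinearEquiv.ofBijective _ hb'
  obtain ⟨s, hs⟩ := h.isVectorBundle_modification
  -- Both generic stalks are identified with that of `f^*E`; there the two lattices are `pullSub f
  -- (χ.chain m 0)` and the last term of the pulled-back recursion.
  have key : ∀ y u, T₁ u ∈ lattice ((Scheme.Modules.pullback f).obj χ.modification) y ↔
      T₂ u ∈ lattice (χ.pullback f).modification y := fun y u => by
    refine Iff.trans ?_ (h'.toModification_mem_lattice_iff (x := y) (v := u)).symm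
    rw [← h.pullSub_chain f h', lattice_pullback, pullSub_image f χ.toModification (χ.chain m 0)]
    · constructor
      · rintro ⟨w, hw, hwu⟩
        have : w = u := hb.1 hwu
        exact this ▸ hw
      · exact fun hu => ⟨u, hu, rfl⟩
    · ext w
      constructor
      · exact fun hw => ⟨_, χ.evalMod_mem hw, χ.toModification_evalMod w⟩
      · rintro ⟨v, hv, rfl⟩
        exact h.toModification_mem_lattice_iff.2 hv
  obtain ⟨e, he⟩ := exists_iso (hs.pullback f).isTorsionFree
    (χ.pullback f).isTorsionFree_modification (T₁.symm.trans T₂) fun y v => by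
      rw [LinearEquiv.trans_apply, ← key, LinearEquiv.apply_symm_apply]
  refine ⟨e, ?_, fun e' he' => ?_⟩
  · refine (χ.pullback f).isTorsionFree_modification.hom_ext (LinearMap.ext fun v => ?_)
    rw [genMap_comp_apply, he]
    exact congrArg T₂ (T₁.symm_apply_apply v)
  · refine Iso.ext ((χ.pullback f).isTorsionFree_modification.hom_ext (LinearMap.ext fun v => ?_))
    obtain ⟨w, rfl⟩ := hb.2 v
    rw [← genMap_comp_apply]
    dsimp only at he'
    rw [he', he]
    exact (congrArg T₂ (T₁.symm_apply_apply w)).symm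

end RawDatum

end PullbackDatum

/-! ### Extension of adapted maps and clearing of denominators -/

section Extension

open Topology

variable {X : Scheme.{u}} [IsIntegral X] {m : ℕ}

/-- A map from `E` to `F` extends to the echelon modification if it maps each `E^i(D_i)` to `F`. -/
theorem RawDatum.IsEchelon.existsUnique_extension {χ : RawDatum X m} (h : χ.IsEchelon)
    {F : X.Modules} (hF : IsTorsionFree F) {φ : χ.bundle ⟶ F} (hφ : χ.IsAdapted φ) :
    ∃! ψ : χ.modification ⟶ F, χ.toModification ≫ ψ = φ := by
  have key : ∀ x, χ.chain m 0 x ≤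
      (lattice F x).comap ((genMap φ).restrictScalars (localRing x)) := fun x =>
    h.chain_le_of_twist_sub_le fun i hi v hv => by
      obtain ⟨f, hf⟩ := exists_isEquation (χ.D i) x
      have h1 : genMap φ ((f : X.functionField) • v) ∈ image (χ.incl i ≫ φ) x := by
        obtain ⟨w, hw, h2⟩ := mem_image_iff_exists_lattice.1 (hv f hf)
        rw [← h2, ← genMap_comp_apply]
        exact genMap_mem_image _ hw
      have h2 := hφ i hi x h1 _ hf.neg
      rwa [map_smul, smul_smul, Units.inv_mul, one_smul] at h2
  obtain ⟨ψ, hψ⟩ := hF.exists_hom ((genMap φ).comp χ.evalMod) fun x w hw =>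
    key x (χ.evalMod_mem hw)
  refine ⟨ψ, hF.hom_ext (LinearMap.ext fun v => ?_), fun ψ' hψ' => ?_⟩
  · rw [genMap_comp_apply, hψ, LinearMap.comp_apply, RawDatum.evalMod_toModification]
  · refine RawDatum.modification_hom_ext hF (hψ'.trans (hF.hom_ext (LinearMap.ext fun v => ?_)))
    rw [genMap_comp_apply, hψ, LinearMap.comp_apply, RawDatum.evalMod_toModification]

theorem IsGenericEquality.bijective {M N : X.Modules} {φ : M ⟶ N} (h : IsGenericEquality φ) :
    Function.Bijective (genMap φ) := by
  have := h.mono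
  refine ⟨genMap_injective φ, fun v => ?_⟩
  obtain ⟨U, hU, hiso⟩ := h.generic
  obtain ⟨W, hW, s, rfl⟩ := exists_genGerm v
  have hUg := genericPoint_mem_of_nonempty hU
  rw [Scheme.Modules.Hom.isIso_iff_isIso_app] at hiso
  have h1 := (ConcreteCategory.isIso_iff_bijective _).1 (hiso (U.ι ⁻¹ᵁ W))
  have h2 : Function.Bijective (φ.app (U.ι ''ᵁ U.ι ⁻¹ᵁ W)) := h1
  rw [Scheme.Hom.image_preimage_eq_opensRange_inf, Scheme.Opens.opensRange_ι] at h2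
  obtain ⟨t, ht⟩ := h2.2 (N.presheaf.map (homOfLE inf_le_right).op s)
  have hUW : genericPoint X ∈ U ⊓ W := ⟨hUg, hW⟩
  refine ⟨genGerm M hUW t, ?_⟩
  rw [genMap_genGerm, ht, genGerm_res]

theorem IsLocalBasis.mem_iff {M : X.Modules} {N : RatSubsheaf M} {U : X.Opens} {I : Type*}
    [Fintype I] {b : Module.Basis I X.functionField (GenericStalk M)} (hb : IsLocalBasis N U b)
    {y : X} (hy : y ∈ U) {v : GenericStalk M} : v ∈ N y ↔ ∀ a, b.repr v a ∈ localRing y := by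
  have h1 : N y = diag (localRing y) b fun _ => 1 := by
    rw [hb.eq_span y hy]; simp [diag]
  rw [h1, mem_diag_iff]
  simp

theorem isFrame_unit (S : Scheme.{u}) :
    IsFrame (unitModule S) ⊤ fun _ : ULift.{u} (Fin 1) => unitSection ⊤ := fun W h => by
  have h1 : ∀ c : ULift.{u} (Fin 1) → Γ(S, W),
      ofUnit (∑ i, c i • res (unitModule S) h (unitSection ⊤)) = c 0 := fun c => by
    rw [Fintype.sum_eq_single 0 fun i hi => (hi (Subsingleton.elim _ _)).elim]
    exact (congrArg (fun t => ofUnit (c 0 • t)) (unitSection_res (homOfLE h))).trans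
      (ofUnit_smul (c 0))
  refine ⟨fun c d hcd => funext fun i => ?_, fun s => ⟨fun _ => ofUnit s, h1 _⟩⟩
  have h2 := (h1 c).symm.trans ((congrArg ofUnit hcd).trans (h1 d))
  rwa [Subsingleton.elim i 0]

theorem isLocallyFreeOfRank_unit (S : Scheme.{u}) : IsLocallyFreeOfRank (unitModule S) 1 :=
  fun _ => ⟨⊤, trivial, (isFrame_unit S).nonempty_iso⟩

theorem IsFrame.isLocalBasis {M : X.Modules} {U : X.Opens} {I : Type*} [Fintype I]
    {g : I → Γ(M, U)} (hg : IsFrame M U g) {x : X} (hx : x ∈ U) :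
    IsLocalBasis (lattice M) U (hg.basis hx) := ⟨fun _ hy => hg.lattice_eq hx hy⟩

theorem mem_localRing_of_mul_mem {s : Γ(X, ⊤)} {x : X} (hx : x ∈ X.basicOpen s)
    {c : X.functionField}
    (hc : toFunctionField (x := x) (U := ⊤) trivial s * c ∈ localRing x) : c ∈ localRing x := by
  have h1 : IsUnit (X.presheaf.germ ⊤ x trivial s) := (X.mem_basicOpen s x trivial).1 hx
  obtain ⟨t, ht⟩ := h1.exists_left_inv
  have h2 : toFunctionField (x := x) (U := ⊤) trivial s =
      algebraMap (X.presheaf.stalk x) X.functionField (X.presheaf.germ ⊤ x trivial s) :=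
    (have : Nonempty (⊤ : X.Opens) := ⟨⟨x, trivial⟩⟩
     Scheme.algebraMap_germ_eq_germToFunctionField X (U := ⊤) trivial s).symm
  have h3 : algebraMap (X.presheaf.stalk x) X.functionField t ∈ localRing x := ⟨t, rfl⟩
  have h4 := mul_mem h3 hc
  rwa [← mul_assoc, h2, ← map_mul, ht, map_one, one_mul] at h4

/-- A rational function on an affine scheme that is regular where neither `s` nor `h` vanishes
becomes regular where `s` does not vanish after multiplication by a power of `h`. -/
theorem eventually_pow_mul_mem [IsAffine X] {s h : Γ(X, ⊤)} {x : X} (hx : x ∈ X.basicOpen h)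
    {c : X.functionField}
    (hc : ∀ y ∈ X.basicOpen s ⊓ X.basicOpen h, c ∈ localRing y) :
    ∀ᶠ N : ℕ in Filter.atTop, ∀ y ∈ X.basicOpen s,
      toFunctionField (x := x) (U := ⊤) trivial h ^ N * c ∈ localRing y := by
  rcases (X.basicOpen s : Set X).eq_empty_or_nonempty with hs | ⟨y, hy⟩
  · exact Filter.Eventually.of_forall fun N y hy => (Set.eq_empty_iff_forall_notMem.1 hs y hy).elim
  have hg : genericPoint X ∈ X.basicOpen (s * h) := by
    rw [Scheme.basicOpen_mul]
    exact ⟨genericPoint_mem hy, genericPoint_mem hx⟩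
  rw [← Scheme.basicOpen_mul] at hc
  obtain ⟨r, hr⟩ := exists_toFunctionField_eq hg hc
  have := (isAffineOpen_top X).isLocalization_basicOpen (s * h)
  -- Write `c = b / (s h)^N`. Where `s` is invertible, `h^N c` is regular, and so is `h^N' c` for
  -- every `N' ≥ N`.
  obtain ⟨N, b, hb⟩ := IsLocalization.Away.surj (s * h) r
  have h1 := congrArg (toFunctionField hg) hb
  have h2 : ∀ a : Γ(X, ⊤), toFunctionField hg (algebraMap Γ(X, ⊤) Γ(X, X.basicOpen (s * h)) a) =
      toFunctionField (x := x) (U := ⊤) trivial a := fun a =>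
    toFunctionField_res hg (homOfLE (X.basicOpen_le (s * h))) a
  rw [map_mul, map_pow, h2, h2, hr, map_mul, mul_pow] at h1
  filter_upwards [Filter.eventually_ge_atTop N] with N' hN' z hz
  have h3 : toFunctionField (x := z) (U := ⊤) trivial (s ^ N) *
      (toFunctionField (x := x) (U := ⊤) trivial h ^ N * c) ∈ localRing z := by
    have h4 := toFunctionField_mem (x := z) (U := ⊤) trivial b
    convert h4 using 1
    refine Eq.trans ?_ h1
    rw [map_pow]
    change toFunctionField (x := x) (U := ⊤) trivial s ^ N * _ = _
    ring
  have h5 : z ∈ X.basicOpen (s ^ N) := (X.mem_basicOpen (U := ⊤) _ z trivial).2 <| by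
    rw [map_pow]; exact ((X.mem_basicOpen s z trivial).1 hz).pow N
  have h6 := mem_localRing_of_mul_mem h5 h3
  obtain ⟨k, rfl⟩ := Nat.exists_eq_add_of_le' hN'
  rw [pow_add, mul_assoc]
  exact mul_mem (pow_mem (toFunctionField_mem (x := z) (U := ⊤) trivial h) k) h6

/-- On an affine scheme, a rational map `E → L` that is adapted where `h` does not vanish becomes
an adapted map after multiplication by a power of `h`. -/
theorem exists_isAdapted [IsAffine X] {χ : RawDatum X m} [IsIso (χ.incl 0)] (hD : χ.D 0 = 0)
    (hχ : ∃ r, ∀ i ≤ m, IsLocallyFreeOfRank (χ.fil i) r) {L : X.Modules}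
    (hL : IsTorsionFree L) {I : Type*} [Fintype I]
    {b : Module.Basis I X.functionField (GenericStalk L)} (hb : IsLocalBasis (lattice L) ⊤ b)
    (T : GenericStalk χ.bundle →ₗ[X.functionField] GenericStalk L) {h : Γ(X, ⊤)} {x : X}
    (hx : x ∈ X.basicOpen h)
    (hT : ∀ y ∈ X.basicOpen h, ∀ i ≤ m, ∀ v ∈ χ.sub i y, T v ∈ twist (-χ.D i) (lattice L) y) :
    ∃ (N : ℕ) (φ : χ.bundle ⟶ L), χ.IsAdapted φ ∧
      genMap φ = toFunctionField (x := x) (U := ⊤) trivial h ^ N • T := by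
  obtain ⟨r, hr⟩ := hχ
  set η := toFunctionField (x := x) (U := ⊤) trivial h
  -- Near `z` the condition concerns finitely many coordinates of finitely many generators. Asking
  -- for all large exponents lets finitely many such conditions be met together.
  have hloc : ∀ z : X, ∃ S ∈ 𝓝 z, ∀ᶠ N : ℕ in Filter.atTop, ∀ y ∈ S, ∀ i ∈ Set.Iic m,
      ∀ v ∈ χ.sub i y, η ^ N • T v ∈ twist (-χ.D i) (lattice L) y := fun z => by
    choose d hd using fun i => exists_isEquation (χ.D i) z
    have hg : ∀ i, ∃ g : ULift.{u} (Fin r) → GenericStalk χ.bundle, i ∈ Set.Iic m →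
        ∀ᶠ y in 𝓝 z, χ.sub i y = Submodule.span (localRing y) (Set.range g) := fun i => by
      by_cases hi : i ≤ m
      · obtain ⟨g, hg⟩ := (hr i hi).eventually_image_eq_span (χ.incl i) z
        exact ⟨g, fun _ => hg⟩
      -- Indices beyond `m` carry no condition; the generators there are placeholders.
      · exact ⟨fun _ => 0, fun h => (hi h).elim⟩
    choose g hg using hg
    obtain ⟨S, hS, hSo, hz⟩ := eventually_nhds_iff.1
      (((Set.finite_Iic m).eventually_all.2 fun i hi => hg i hi).and
        ((Set.finite_Iic m).eventually_all.2 fun i _ => (hd i).eventually))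
    obtain ⟨s, hs, hzs⟩ := (isAffineOpen_top X).exists_basicOpen_le (V := ⟨S, hSo⟩) ⟨z, hz⟩ trivial
    refine ⟨X.basicOpen s, (X.basicOpen s).isOpen.mem_nhds hzs, ?_⟩
    have h1 : ∀ᶠ N : ℕ in Filter.atTop, ∀ i ∈ Set.Iic m, ∀ k a, ∀ y ∈ X.basicOpen s,
        η ^ N * b.repr (((d i)⁻¹ : (X.functionField)ˣ) • T (g i k)) a ∈ localRing y := by
      refine (Set.finite_Iic m).eventually_all.2 fun i hi => Filter.eventually_all.2 fun k =>
        Filter.eventually_all.2 fun a => eventually_pow_mul_mem hx fun y hy => ?_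
      refine (hb.mem_iff trivial).1 ?_ a
      refine hT y hy.2 i hi _ ?_ _ ((hS y (hs hy.1)).2 i hi).neg
      rw [(hS y (hs hy.1)).1 i hi]
      exact Submodule.subset_span (Set.mem_range_self k)
    filter_upwards [h1] with N hN y hy i hi v hv
    rw [(hS y (hs hy)).1 i hi] at hv
    suffices h2 : Submodule.span (localRing y) (Set.range (g i)) ≤
        (twist (-χ.D i) (lattice L) y).comap ((η ^ N • T).restrictScalars (localRing y)) from h2 hv
    refine Submodule.span_le.2 (Set.range_subset_iff.2 fun k => ?_)
    change η ^ N • T (g i k) ∈ twist (-χ.D i) (lattice L) y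
    rw [twist_eq_scale _ ((hS y (hs hy)).2 i hi).neg, mem_scale, smul_comm]
    refine (hb.mem_iff trivial).2 fun a => ?_
    rw [map_smul, Finsupp.smul_apply, smul_eq_mul]
    exact hN i hi k a y hy
  -- An affine scheme is quasi-compact, so one exponent works everywhere.
  have hglob : ∀ᶠ N : ℕ in Filter.atTop, ∀ y ∈ Set.univ, ∀ i ∈ Set.Iic m,
      ∀ v ∈ χ.sub i y, η ^ N • T v ∈ twist (-χ.D i) (lattice L) y := by
    refine (isCompact_univ (X := X)).induction_on (p := fun S => ∀ᶠ N : ℕ in Filter.atTop,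
      ∀ y ∈ S, ∀ i ∈ Set.Iic m, ∀ v ∈ χ.sub i y, η ^ N • T v ∈ twist (-χ.D i) (lattice L) y)
      (Filter.Eventually.of_forall fun N y hy => hy.elim)
      (fun S S' hSS h => h.mono fun N hN y hy => hN y (hSS hy)) (fun S S' h h' => ?_) fun z _ => ?_
    · filter_upwards [h, h'] with N hN hN' y hy
      exact hy.elim (hN y) (hN' y)
    · rw [nhdsWithin_univ]; exact hloc z
  obtain ⟨N, hN⟩ := hglob.exists
  -- The condition for `i = 0`, where `E^0 = E` and `D_0 = 0`, says that the rational map is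
  -- regular.
  obtain ⟨φ, hφ⟩ := hL.exists_hom (η ^ N • T) fun y v hv => by
    have h1 := hN y trivial 0 (Nat.zero_le m) v (by
      rwa [show χ.sub 0 = lattice χ.bundle from image_eq_lattice (χ.incl 0)])
    rw [hD] at h1
    have h2 := h1 1 isEquation_zero.neg
    simpa using h2
  refine ⟨N, φ, fun i hi y v hv => ?_, hφ⟩
  obtain ⟨w, hw, rfl⟩ := mem_image_iff_exists_lattice.1 hv
  rw [genMap_comp_apply, hφ]
  exact hN y trivial i hi _ (genMap_mem_image _ hw)

end Extension

/-! ### Maximality of the modification -/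

section Maximality

open Topology

variable {X U : Scheme.{u}} [IsIntegral X] [IsIntegral U] (g : U ⟶ X) [IsDominant g] {m : ℕ}

theorem functionFieldMap_algebraMap (y : U) (a : X.presheaf.stalk (g y)) :
    functionFieldMap g (algebraMap _ X.functionField a) =
      algebraMap (U.presheaf.stalk y) U.functionField ((g.stalkMap y).hom a) := by
  have h := ((genericPoint_spec U).specializes trivial : genericPoint U ⤳ y)
  symm
  refine (Scheme.Hom.stalkSpecializes_stalkMap_apply g _ _ h a).symm.trans
    (congrArg (g.stalkMap (genericPoint U)).hom ?_)
  change _ = (X.presheaf.stalkSpecializes _ ≫ X.presheaf.stalkSpecializes _).hom a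
  rw [TopCat.Presheaf.stalkSpecializes_comp]

/-- An open immersion is an isomorphism on stalks and injective on function fields, so regularity
may be tested on `U`. -/
theorem mem_localRing_of_functionFieldMap_mem [IsOpenImmersion g] {y : U} {c : X.functionField}
    (hc : functionFieldMap g c ∈ localRing y) : c ∈ localRing (g y) := by
  obtain ⟨b, hb⟩ := hc
  obtain ⟨a, rfl⟩ := ((ConcreteCategory.isIso_iff_bijective (g.stalkMap y)).1 inferInstance).2 b
  exact ⟨a, (functionFieldMap g).injective ((functionFieldMap_algebraMap g y a).trans hb)⟩

namespace RawDatum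

variable {χ : RawDatum X m}

/-- The function `D_{n(a)} e_a^*` maps `E^i` into the multiples of `D_i`, so it is adapted near the
point. Multiplied by `s^N`, with `s` invertible at the point, it is adapted on all of `U` and
extends to `E'`. Its value on a germ of `E'` is therefore regular, and `s^N` can be divided out at
the point. -/
theorem IsEchelon.repr_mem_of_adaptedMapsExtend (h : χ.IsEchelon) [IsAffine U] [IsOpenImmersion g]
    {E' : X.Modules} {j : χ.bundle ⟶ E'} (hj : χ.AdaptedMapsExtend j g) {y : U}
    {δ D : ℕ → (X.functionField)ˣ} {I : Type*} [Fintype I]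
    {e : Module.Basis I X.functionField (GenericStalk χ.bundle)} {n : I → ℕ}
    (hmod : ∀ᶠ z in 𝓝 (g y), IsModelAt χ z δ D e n) {v : GenericStalk χ.bundle}
    (hv : genMap j v ∈ lattice E' (g y)) (a : I) :
    (D (n a) : X.functionField) * e.repr v a ∈ localRing (g y) := by
  obtain ⟨r, hr, hfil⟩ := h.exists_bundle
  obtain ⟨O, hO, hOo, hy⟩ := eventually_nhds_iff.1 hmod
  obtain ⟨s, hs, hys⟩ := (isAffineOpen_top U).exists_basicOpen_le
    (V := g ⁻¹ᵁ ⟨O, hOo⟩) ⟨y, hy⟩ trivial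
  let L : U.Modules := unitModule U
  have hL : IsLocallyFreeOfRank L 1 := isLocallyFreeOfRank_unit U
  let b : Module.Basis (ULift.{u} (Fin 1)) U.functionField (GenericStalk L) :=
    (isFrame_unit U).basis (x := y) trivial
  have hb : IsLocalBasis (lattice L) ⊤ b := (isFrame_unit U).isLocalBasis trivial
  let e' : Module.Basis I U.functionField (GenericStalk (χ.pullback g).bundle) := pullBasis g hr e
  -- The `a`-th coordinate times `D (n a)`, as a rational map to the structure sheaf of `U`; `b 0`
  -- is the section 1.
  let T : GenericStalk (χ.pullback g).bundle →ₗ[U.functionField] GenericStalk L :=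
    (LinearMap.toSpanSingleton U.functionField _ (b 0)).comp
      (functionFieldMap g (D (n a)) • e'.coord a)
  have hTb : ∀ w c, b.repr (c • T w) 0 = c * (functionFieldMap g (D (n a)) * e'.repr w a) := by
    intro w c
    change b.repr (c • (functionFieldMap g (D (n a)) * e'.repr w a) • b 0) 0 = _
    rw [map_smul, map_smul, b.repr_self, Finsupp.smul_apply, Finsupp.smul_apply,
      Finsupp.single_eq_same, smul_eq_mul, smul_eq_mul, mul_one]
  have : IsIso ((χ.pullback g).incl 0) := by
    have := h.isIso_zero
    exact (inferInstance : IsIso ((Scheme.Modules.pullback g).map (χ.incl 0)))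
  have hT : ∀ z ∈ U.basicOpen s, ∀ i ≤ m, ∀ w ∈ (χ.pullback g).sub i z,
      T w ∈ twist (-(χ.pullback g).D i) (lattice L) z := fun z hz i hi w hw => by
    have h1 := hO (g z) (hs hz)
    have h2 := h1.pullback g hr
    rw [twist_eq_scale _ (h2.D_eq i hi).neg, mem_scale, hb.mem_iff trivial]
    intro k
    rw [Subsingleton.elim k 0, hTb]
    refine h2.adapted.inv_mul_mul_repr_mem (D := fun i => pullUnits g (D i))
      (fun i hi => ?_) (fun i hi => ?_) hi hw a
    · rw [← map_div]; exact functionFieldMap_mem g (h1.dD_mem h hi)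
    · rw [← map_div, ← map_div, ← map_div]; exact functionFieldMap_mem g (h1.dδ_div_dD_mem h hi)
  obtain ⟨N, φ, hφ, hφT⟩ := exists_isAdapted
    ((congrArg (pullbackDivisor g) h.D_zero).trans (pullbackDivisor_zero g))
    ⟨r, fun i hi => (hfil i hi).pullback g⟩ hL.isTorsionFree hb T hys hT
  obtain ⟨ψ, hψ⟩ := hj L hL φ hφ
  have h1 : genMap φ (pullGen g _ v) ∈ lattice L y := by
    have h2 := image_le_lattice _ _ (genMap_mem_image ψ (pullGen_mem_lattice g E' hv))
    rw [pullGen_genMap, ← genMap_comp_apply] at h2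
    rwa [← hψ]
  rw [hφT, hb.mem_iff trivial] at h1
  have h3 : toFunctionField (x := y) (U := ⊤) trivial (s ^ N) *
      (functionFieldMap g (D (n a)) * e'.repr (pullGen g _ v) a) ∈ localRing y := by
    rw [map_pow]
    exact Eq.mp (congrArg (· ∈ localRing y) (hTb (pullGen g _ v) _)) (h1 0)
  have h4 : y ∈ U.basicOpen (s ^ N) := (U.mem_basicOpen (U := ⊤) _ y trivial).2 <| by
    rw [map_pow]; exact ((U.mem_basicOpen s y trivial).1 hys).pow N
  have h5 := mem_localRing_of_mul_mem h4 h3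
  refine mem_localRing_of_functionFieldMap_mem g ?_
  rw [map_mul, ← repr_pullGen g hr]
  exact h5

/-- The echelon modification is the largest bundle to which adapted maps extend. -/
theorem IsEchelon.existsUnique_hom_modification (h : χ.IsEchelon) {E' : X.Modules}
    {j : χ.bundle ⟶ E'} (hE' : IsVectorBundle E') (hj : IsGenericEquality j)
    (hext : ∀ x : X, ∃ (U : Scheme.{u}) (_ : IsIntegral U) (_ : IsAffine U) (g : U ⟶ X)
      (_ : IsOpenImmersion g) (_ : IsDominant g),
      x ∈ Set.range g ∧ χ.AdaptedMapsExtend j g) :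
    ∃! k : E' ⟶ χ.modification, Mono k ∧ j ≫ k = χ.toModification := by
  obtain ⟨r, hr, -⟩ := h.exists_bundle
  obtain ⟨r', hr'⟩ := hE'
  -- Generic equality identifies the rational sections of `E'` with those of `E`, so the claim
  -- becomes an inclusion of lattices at each point.
  let J := LinearEquiv.ofBijective _ hj.bijective
  have key : ∀ x, ∀ v ∈ lattice E' x,
      (genMap χ.toModification).comp J.symm.toLinearMap v ∈ lattice χ.modification x := by
    intro x v hv
    obtain ⟨U, hU, hUa, g, hg, hgd, ⟨y, rfl⟩, hjg⟩ := hext x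
    obtain ⟨w, rfl⟩ := J.surjective v
    obtain ⟨δ, D, e, n, hmod⟩ := h.exists_isModelAt hr (g y)
    rw [LinearMap.comp_apply, LinearEquiv.coe_coe, J.symm_apply_apply,
      h.toModification_mem_lattice_iff, hmod.self_of_nhds.chain_eq_diag h, mem_diag_iff]
    intro a
    rw [inv_inv]
    exact h.repr_mem_of_adaptedMapsExtend g hjg hmod hv a
  obtain ⟨k, hk⟩ := χ.isTorsionFree_modification.exists_hom _ key
  have hjk : j ≫ k = χ.toModification :=
    χ.isTorsionFree_modification.hom_ext <| LinearMap.ext fun v => by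
      rw [genMap_comp_apply, hk, LinearMap.comp_apply]
      exact congrArg _ (J.symm_apply_apply v)
  refine ⟨k, ⟨hr'.isTorsionFree.mono_of_injective ?_, hjk⟩, fun k' hk' =>
    χ.isTorsionFree_modification.hom_ext <| LinearMap.ext fun v => ?_⟩
  · rw [hk]
    exact χ.injective_genMap_toModification.comp J.symm.injective
  · obtain ⟨w, rfl⟩ := hj.bijective.2 v
    rw [← genMap_comp_apply, ← genMap_comp_apply, hk'.2, hjk]

end RawDatum

end Maximality

end

end Echelon

theorem mainTheorem1 {X : Scheme.{u}} [IsIntegral X] {m : ℕ} :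
    -- `Mod(χ, E)` is locally free, contains `E` and is generically equal to it
    (∀ χ : EchelonDatum X m,
      IsVectorBundle χ.modification ∧ IsGenericEquality χ.toModification) ∧
    -- it depends functorially on `(χ, E)`
    (∃ modMap : ∀ {χ ψ : EchelonDatum X m}, (χ ⟶ ψ) → (χ.modification ⟶ ψ.modification),
      (∀ χ : EchelonDatum X m, modMap (𝟙 χ) = 𝟙 χ.modification) ∧
      (∀ {χ ψ ω : EchelonDatum X m} (a : χ ⟶ ψ) (b : ψ ⟶ ω),
        modMap (a ≫ b) = modMap a ≫ modMap b) ∧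
      (∀ {χ ψ : EchelonDatum X m} (a : χ ⟶ ψ),
        χ.toModification ≫ modMap a = EchelonDatum.Hom.hom a ≫ ψ.toModification)) ∧
    -- its formation commutes with pullback along dominant morphisms
    (∀ (χ : EchelonDatum X m) {Y : Scheme.{u}} [IsIntegral Y] (f : Y ⟶ X) [IsDominant f],
      (∀ i ≤ m, NoCommonComponent (pullbackDivisor f (χ.D i))
        (pullbackDivisor f (χ.δ i) - pullbackDivisor f (χ.D i))) →
      (χ.pullback f).IsEchelon ∧
      ∃! e : (Scheme.Modules.pullback f).obj χ.modification ≅ (χ.pullback f).modification,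
        (Scheme.Modules.pullback f).map χ.toModification ≫ e.hom =
          (χ.pullback f).toModification) ∧
    -- universal property: adapted maps to line bundles extend
    (∀ (χ : EchelonDatum X m) (L : X.Modules), IsLocallyFreeOfRank L 1 →
      ∀ φ : χ.bundle ⟶ L, χ.IsAdapted φ →
        ∃! ψ : χ.modification ⟶ L, χ.toModification ≫ ψ = φ) ∧
    -- and `Mod(χ, E)` is the largest bundle to which they extend
    (∀ (χ : EchelonDatum X m) (E' : X.Modules) (j : χ.bundle ⟶ E'),
      IsVectorBundle E' → IsGenericEquality j →
      (∀ x : X, ∃ (U : Scheme.{u}) (_ : IsIntegral U) (_ : IsAffine U) (g : U ⟶ X)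
        (_ : IsOpenImmersion g) (_ : IsDominant g),
        x ∈ Set.range g ∧ χ.AdaptedMapsExtend j g) →
      ∃! k : E' ⟶ χ.modification, Mono k ∧ j ≫ k = χ.toModification) :=
  ⟨fun χ => ⟨χ.isEchelon.isVectorBundle_modification, χ.isEchelon.isGenericEquality⟩,
    ⟨EchelonDatum.modMap, EchelonDatum.modMap_id, EchelonDatum.modMap_comp,
      EchelonDatum.toModification_modMap⟩,
    fun χ _ _ f _ hcop =>
      ⟨χ.isEchelon.pullback f hcop, χ.isEchelon.exists_pullback_iso f (χ.isEchelon.pullback f hcop)⟩,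
    fun χ _ hL _ hφ => χ.isEchelon.existsUnique_extension hL.isTorsionFree hφ,
    fun χ _ _ hE' hj hext => χ.isEchelon.existsUnique_hom_modification hE' hj hext⟩
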